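/- Let $d\ge 1$, let $D\subset\mathbb R^d$ be a non-empty bounded open set, $\mathcal M$ a countable index set with levels $|\mu|\in\mathbb N_0$, and $\theta_0,\theta_\mu\in L_\infty(D)$ $(\mu\in\mathcal M)$ such that, with $\alpha>0$ and constants $c,C>0$, (i) $c\,2^{-|\mu|}\le\operatorname{diam}\operatorname{supp}\theta_\mu\le C\,2^{-|\mu|}$ for all $\mu\in\mathcal M$; (ii) $\#\{\mu:|\mu|=\ell,\ \operatorname{supp}\theta_\mu\cap B(x,r)\neq\emptyset\}\le C\max\{1,2^{d\ell}r^d\}$ for all $\ell\in\mathbb N_0$, $x\in\mathbb R^d$, $r>0$; (iii) $\|\theta_\mu\|_{L_\infty(D)}\le C\,2^{-\alpha|\mu|}$ for all $\mu\in\mathcal M$. Let $Y=[-1,1]^{\mathcal M}$ with the uniform product measure $\sigma$, $V=H^1_0(D)$ with $\|v\|_V=\|\nabla v\|_{L_2(D)}$, $\mathcal V=L_2(Y,V,\sigma)$, $a(x,y)=\exp\bigl(\theta_0(x)+\sum_{\mu\in\mathcal M}y_\mu\theta_\mu(x)\bigr)$, and let $B:\mathcal V\to\mathcal V'$ be given by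 $\langle Bv,w\rangle=\int_Y\int_D a(x,y)\nabla v(y)\cdot\nabla w(y)\,dx\,d\sigma(y)$. Let $\mathcal F$ be the set of finitely supported $\nu\in\mathbb N_0^{\mathcal M}$, $L_\nu$ the $\sigma$-orthonormal product Legendre polynomials, $[v]_\nu=\int_Y v L_\nu\,d\sigma$ and $[a]_{\nu\nu'}(x)=\int_Y a(x,y)L_\nu(y)L_{\nu'}(y)\,d\sigma(y)$. For an integer $Q\ge1$, call $|\cdot|_Q:\mathcal M\to\mathbb N_0$ an admissible level assignment with constant $C'$ if: distinct $\mu,\mu'$ with $|\mu|_Q=|\mu'|_Q$ satisfy $\theta_\mu\theta_{\mu'}=0$ a.e. in $D$; for every $\mu$ and every $\ell<|\mu|_Q$ there is at most one $\mu'$ with $|\mu'|_Q=\ell$ and $\theta_\mu\theta_{\mu'}\ne0$ in $L_\infty(D)$; $\#\{\mu:|\mu|_Q=\ell\}\le C'2^{d\ell/Q}$ for all $\ell$; and $\sum_{|\mu|_Q=\ell}|\theta_\mu|\le C'2^{-\alpha\ell/Q}$ a.e. in $D$ for all $\ell$. Let $\mathcal F(\mathbb N_0)$ be the set of finitely supported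 sequences $\mathbf k=(k_\ell)_{\ell\in\mathbb N_0}$ in $\mathbb N_0$. For $\mathbf k\in\mathcal F(\mathbb N_0)$ and $\nu\in\mathcal F$ let $$\mathcal S_{\mathbf k}(\nu)=\Bigl\{\nu'\in\mathcal F:\ \sum_{|\mu|_Q=\ell}|\nu_\mu-\nu'_\mu|=k_\ell\ \text{for all }\ell,\quad \prod_{\mu:\,\nu_\mu\ne\nu'_\mu}\theta_\mu\ne0\ \text{in }L_\infty(D)\Bigr\},\qquad \operatorname{cost}(\mathbf k)=\sup_{\nu\in\mathcal F}\#\mathcal S_{\mathbf k}(\nu),$$ and for finite $\mathcal K\subset\mathcal F(\mathbb N_0)$ let $B_{\mathcal K}$ be given by $$\langle B_{\mathcal K}v,w\rangle=\sum_{\mathbf k\in\mathcal K}\sum_{\nu\in\mathcal F}\sum_{\nu'\in\mathcal S_{\mathbf k}(\nu)}\int_D[a]_{\nu\nu'}\nabla[v]_{\nu'}\cdot\nabla[w]_\nu\,dx .$$ **Theorem.** (a) There is an integer $Q\ge1$, depending only on $d$, $c$, $C$, such that an admissible level assignment $|\cdot|_Q$ exists, with a constant $C'$ that depends only on $d,c,C,\alpha$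 and $D$. (b) Let $|\cdot|_Q$ be any admissible level assignment with constant $C'$, and let $\|\theta_0\|_{L_\infty(D)}\le R$ with $R\ge 0$. Then $\operatorname{cost}(\mathbf k)<\infty$ for all $\mathbf k$, the series that define $B_{\mathcal K}$ converge absolutely, and there is an enumeration $(\mathbf k_j)_{j\ge1}$ of $\mathcal F(\mathbb N_0)$, each element occurring exactly once, such that the sets $\mathcal K_J=\{\mathbf k_j:j\le J\}$ satisfy, for every $s<\alpha/d$ and every $J\ge1$, $$\|B-B_{\mathcal K_J}\|_{\mathcal V\to\mathcal V'}\le A_s\Bigl(\sum_{j=1}^J\operatorname{cost}(\mathbf k_j)\Bigr)^{-s},$$ where $A_s$ depends only on $s,\alpha,d,Q$ and $c,C,C',R$. Moreover, if $\mathcal M=\emptyset$ or the lowest level of the assignment that occurs is at most $\ell_0$, then for every $J\ge1$ $$\sum_{j=1}^{J+1}\operatorname{cost}(\mathbf k_j)\le G\,2^{d/Q}\sum_{j=1}^{J}\operatorname{cost}(\mathbf k_j),$$ where $G$ depends only on $\alpha,d,Q,c,C,C',R$ and $\ell_0$. -/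

import Mathlib

open MeasureTheory Set
open scoped ENNReal ContDiff

universe u

noncomputable section

namespace StochGalerkin

/-- The physical space `ℝ^d` with the Euclidean norm. -/
abbrev Space (d : ℕ) : Type := EuclideanSpace ℝ (Fin d)

/-! ### The spatial space `V = H¹₀(D)` -/

/-- Pairs `(φ, ∇φ)` in `L²(D) × L²(D; ℝ^d)` that come from test functions `φ ∈ C_c^∞(D)`. -/
def testPairs {d : ℕ} (D : Set (Space d)) :
    Set (WithLp 2 (Lp ℝ 2 (volume.restrict D) × Lp (Space d) 2 (volume.restrict D))) :=
  {z | ∃ φ : Space d → ℝ, ContDiff ℝ ∞ φ ∧ HasCompactSupport φ ∧ tsupport φ ⊆ D ∧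
    (z.fst : Space d → ℝ) =ᵐ[volume.restrict D] φ ∧
    (z.snd : Space d → Space d) =ᵐ[volume.restrict D] gradient φ}

/-- `H¹₀(D)`: the closure of the test functions in the `H¹(D)` norm; an element is a pair made of
the function and its weak gradient. -/
def H10 {d : ℕ} (D : Set (Space d)) :
    Submodule ℝ (WithLp 2 (Lp ℝ 2 (volume.restrict D) × Lp (Space d) 2 (volume.restrict D))) :=
  (Submodule.span ℝ (testPairs D)).topologicalClosure

/-- The weak gradient of an element of `H¹₀(D)`. -/
def grad {d : ℕ} {D : Set (Space d)} (v : H10 D) : Lp (Space d) 2 (volume.restrict D) :=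
  (v : WithLp 2 (Lp ℝ 2 (volume.restrict D) × Lp (Space d) 2 (volume.restrict D))).snd

/-! ### The parameter domain, its measure and the space `L²(Y, V, σ)` -/

/-- The uniform probability measure `dy / 2` on `[-1, 1]`. -/
def uniformOne : Measure ℝ := (2 : ℝ≥0∞)⁻¹ • volume.restrict (Icc (-1) 1)

instance : IsProbabilityMeasure uniformOne := by
  constructor
  simp only [uniformOne, Measure.smul_apply, smul_eq_mul, Measure.restrict_apply_univ,
    Real.volume_Icc]
  norm_num
  exact ENNReal.inv_mul_cancel (by norm_num) (by norm_num)

/-- The uniform (product) measure on `Y = [-1, 1]^M`, as a measure on `M → ℝ` carried by `Y`. -/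
def sigma (M : Type u) : Measure (M → ℝ) := Measure.infinitePi fun _ : M => uniformOne

/-- The space `L²(Y, V, σ)` with `V = H¹₀(D)`. -/
abbrev VV {d : ℕ} (D : Set (Space d)) (M : Type u) : Type u := Lp (H10 D) 2 (sigma M)

/-- The norm of `L²(Y, V, σ)` for the norm `‖v‖_V = ‖∇v‖_{L²(D)}` on `V = H¹₀(D)`. -/
def energyNorm {d : ℕ} {D : Set (Space d)} {M : Type u} (v : VV D M) : ℝ≥0∞ :=
  eLpNorm (fun y => grad (v y)) 2 (sigma M)

/-- The norm of the operator `VV → VV'` given by the bilinear form `T`, as a supremum over the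
unit balls of the norm `energyNorm` (it is `∞` when `T` is unbounded). -/
def opNorm {d : ℕ} {D : Set (Space d)} {M : Type u} (T : VV D M → VV D M → ℝ) : ℝ≥0∞ :=
  ⨆ (v : VV D M) (_ : energyNorm v ≤ 1) (w : VV D M) (_ : energyNorm w ≤ 1), ‖T v w‖ₑ

/-! ### Legendre expansions -/

/-- The Legendre polynomial of degree `n`, by Rodrigues' formula, normalized in
`L²([-1, 1], dy / 2)`. -/
def legendre (n : ℕ) : Polynomial ℝ :=
  Polynomial.C (Real.sqrt (2 * n + 1) / (2 ^ n * n.factorial)) *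
    Polynomial.derivative^[n] ((Polynomial.X ^ 2 - 1) ^ n)

/-- Product Legendre polynomials `L_ν(y) = ∏_μ L_{ν_μ}(y_μ)`; the factors with `ν_μ = 0` equal 1. -/
def prodLegendre {M : Type u} (ν : M →₀ ℕ) (y : M → ℝ) : ℝ :=
  ∏ μ ∈ ν.support, (legendre (ν μ)).eval (y μ)

/-- The Legendre coefficient `[v]_ν = ∫_Y v(y) L_ν(y) dσ(y)` in `V`. -/
def coeff {d : ℕ} {D : Set (Space d)} {M : Type u} (v : VV D M) (ν : M →₀ ℕ) : H10 D :=
  ∫ y, prodLegendre ν y • v y ∂(sigma M)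

/-! ### The log-affine coefficient and its operator -/

/-- `a(x, y) = exp (θ₀(x) + ∑_μ y_μ θ_μ(x))`. -/
def logAffine {d : ℕ} {M : Type u} (θ₀ : Space d → ℝ) (θ : M → Space d → ℝ)
    (x : Space d) (y : M → ℝ) : ℝ :=
  Real.exp (θ₀ x + ∑' μ, y μ * θ μ x)

/-- `⟨B v, w⟩ = ∫_Y ∫_D a(x, y) ∇v(y) · ∇w(y) dx dσ(y)`. -/
def formB {d : ℕ} (D : Set (Space d)) {M : Type u} (θ₀ : Space d → ℝ) (θ : M → Space d → ℝ)
    (v w : VV D M) : ℝ :=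
  ∫ y, (∫ x in D, logAffine θ₀ θ x y * inner ℝ (grad (v y) x) (grad (w y) x)) ∂(sigma M)

/-- `[a]_{νν'}(x) = ∫_Y a(x, y) L_ν(y) L_ν'(y) dσ(y)`. -/
def coeffA {d : ℕ} {M : Type u} (θ₀ : Space d → ℝ) (θ : M → Space d → ℝ) (ν ν' : M →₀ ℕ)
    (x : Space d) : ℝ :=
  ∫ y, logAffine θ₀ θ x y * prodLegendre ν y * prodLegendre ν' y ∂(sigma M)

/-- The multi-index `(|ν_μ - ν'_μ|)_μ`. -/
def absDiff {M : Type u} (ν ν' : M →₀ ℕ) : M →₀ ℕ :=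
  Finsupp.zipWith Nat.dist (Nat.dist_self 0) ν ν'

/-- `S_k(ν)`: the `ν'` such that `∑_{lev μ = ℓ} |ν_μ - ν'_μ| = k_ℓ` for all `ℓ`, and such that
the product of the `θ_μ` over all `μ` with `ν_μ ≠ ν'_μ` is not zero in `L^∞(D)`. -/
def interactionSet {d : ℕ} (D : Set (Space d)) {M : Type u} (θ : M → Space d → ℝ) (lev : M → ℕ)
    (k : ℕ →₀ ℕ) (ν : M →₀ ℕ) : Set (M →₀ ℕ) :=
  {ν' | (∀ ℓ : ℕ, ((absDiff ν ν').sum fun μ n => if lev μ = ℓ then n else 0) = k ℓ) ∧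
    ¬ ((fun x => ∏ μ ∈ (absDiff ν ν').support, θ μ x) =ᵐ[volume.restrict D] 0)}

/-- `cost(k) = sup_ν #S_k(ν)`. -/
def cost {d : ℕ} (D : Set (Space d)) {M : Type u} (θ : M → Space d → ℝ) (lev : M → ℕ)
    (k : ℕ →₀ ℕ) : ℕ∞ :=
  ⨆ ν : M →₀ ℕ, (interactionSet D θ lev k ν).encard

/-- `⟨[B]_{νν'} [v]_ν', [w]_ν⟩ = ∫_D [a]_{νν'} ∇[v]_ν' · ∇[w]_ν dx`. -/
def formEntry {d : ℕ} (D : Set (Space d)) {M : Type u} (θ₀ : Space d → ℝ)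
    (θ : M → Space d → ℝ) (v w : VV D M) (ν ν' : M →₀ ℕ) : ℝ :=
  ∫ x in D, coeffA θ₀ θ ν ν' x * inner ℝ (grad (coeff v ν') x) (grad (coeff w ν) x)

/-- The truncated operator `B_K`, given by
`⟨B_K v, w⟩ = ∑_{k ∈ K} ∑_ν ∑_{ν' ∈ S_k(ν)} ∫_D [a]_{νν'} ∇[v]_ν' · ∇[w]_ν dx`. -/
def formBK {d : ℕ} (D : Set (Space d)) {M : Type u} (θ₀ : Space d → ℝ) (θ : M → Space d → ℝ)
    (lev : M → ℕ) (K : Finset (ℕ →₀ ℕ)) (v w : VV D M) : ℝ :=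
  ∑ k ∈ K, ∑' ν : M →₀ ℕ, ∑' ν' : interactionSet D θ lev k ν, formEntry D θ₀ θ v w ν ν'

/-! ### Assumptions on the expansion -/

/-- The (closed) support of the class of `f` in `L^∞(D)`. -/
def essSupport {d : ℕ} (D : Set (Space d)) (f : Space d → ℝ) : Set (Space d) :=
  {x | ∀ U ∈ nhds x, volume (U ∩ {z ∈ D | f z ≠ 0}) ≠ 0}

/-- Multilevel structure of `(θ_μ)` with levels `|μ| = lvl μ`, decay rate `α` and constants
`c`, `C`. -/
structure IsMultilevel {d : ℕ} (D : Set (Space d)) {M : Type u} (θ₀ : Space d → ℝ)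
    (θ : M → Space d → ℝ) (lvl : M → ℕ) (α c C : ℝ) : Prop where
  memLp_zero : MemLp θ₀ ∞ (volume.restrict D)
  memLp : ∀ μ, MemLp (θ μ) ∞ (volume.restrict D)
  le_diam : ∀ μ, c * (2 : ℝ) ^ (-(lvl μ : ℝ)) ≤ Metric.diam (essSupport D (θ μ))
  diam_le : ∀ μ, Metric.diam (essSupport D (θ μ)) ≤ C * (2 : ℝ) ^ (-(lvl μ : ℝ))
  localized : ∀ (ℓ : ℕ) (x : Space d) (r : ℝ), 0 < r →
    {μ | lvl μ = ℓ ∧ (essSupport D (θ μ) ∩ Metric.ball x r).Nonempty}.Finite ∧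
    ({μ | lvl μ = ℓ ∧ (essSupport D (θ μ) ∩ Metric.ball x r).Nonempty}.ncard : ℝ) ≤
      C * max 1 ((2 : ℝ) ^ (d * ℓ) * r ^ d)
  decay : ∀ μ, eLpNorm (θ μ) ∞ (volume.restrict D) ≤
    ENNReal.ofReal (C * (2 : ℝ) ^ (-(α * lvl μ)))

/-- The level assignment `lev = |·|_Q` with `Q` sublevels per level and constant `C`. -/
structure IsLevelAssignment {d : ℕ} (D : Set (Space d)) {M : Type u} (θ : M → Space d → ℝ)
    (α : ℝ) (Q : ℕ) (C : ℝ) (lev : M → ℕ) : Prop where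
  disjoint_same : ∀ μ μ', lev μ = lev μ' → μ ≠ μ' →
    (fun x => θ μ x * θ μ' x) =ᵐ[volume.restrict D] 0
  unique_lower : ∀ μ, ∀ ℓ < lev μ,
    {μ' | lev μ' = ℓ ∧ ¬ ((fun x => θ μ x * θ μ' x) =ᵐ[volume.restrict D] 0)}.Subsingleton
  finite_level : ∀ ℓ, {μ | lev μ = ℓ}.Finite
  card_level : ∀ ℓ : ℕ, ({μ | lev μ = ℓ}.ncard : ℝ) ≤ C * (2 : ℝ) ^ ((d : ℝ) / Q * ℓ)
  decay : ∀ ℓ : ℕ, ∀ᵐ x ∂(volume.restrict D),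
    ∑' μ : {μ // lev μ = ℓ}, |θ μ x| ≤ C * (2 : ℝ) ^ (-(α / Q * ℓ))

end StochGalerkin

end

noncomputable section

namespace StochGalerkin

/-! ### Enumerating a countable set by decreasing weight -/

/-! Existence of levels. On each dyadic level, call two indices close when their supports come
within `C 2^{-level}` of each other. By localization an index has boundedly many close ones, so
finitely many colours separate them. The new level is `Q · lvl + colour`. Indices with the same new
level are not close, so their supports are disjoint. Two of them cannot both meet a support of a
higher new level either, because its diameter is at most `C 2^{-level}`.

Compression. Put `B = 2^{d/Q}`, `t = α/d`, `q = B^{-t}`. The argument compares three quantities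
attached to a level sequence `k`.

Size of the block: orthogonality of `L_m L_n` to polynomials of degree below `|m - n|` removes the
Taylor polynomial of the exponential, so `|[a]_{νν'}|` is at most a constant times `∏ |θ_μ|^{n_μ} /
n_μ!` with `n = |ν - ν'|` (`abs_integral_exp_mul_prodLegendre_le`). At almost every `x` at most one
`θ_μ` per level is nonzero, so for given `ν` and `k` only the signs of `ν' - ν` on the levels of `k`
remain free. Row sums are thus bounded by a multiple of `∏ 2 (C q^ℓ)^{k_ℓ} / k_ℓ!`
(`tsum_levelDiff_le`), and a Schur test, applied pointwise in `x`, turns this into an operator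
bound.

Cost: the index changed on the highest level determines those on the lower levels, which gives
`cost(k) ≤ C 2^{#supp k} B^{max supp k}` (`encard_interactionSet_le`).

Weight: with `w(k) = ∏ (2 B^ℓ k_ℓ)⁻¹`, the block is at most a constant times `costBound(k)
w(k)^{1+t}` (`exists_prod_le`), where `costBound` is a product majorant of the cost. Moreover `∑
costBound · w^σ` converges for every `σ > 1`, being dominated by an Euler product. Ordering by
decreasing `w` and a Stechkin argument give the rate `s` for every `s < t` (`tail_le`).

The growth of total cost uses the sharper cost bound: cost times weight is bounded, while the
sequences supported on one occupied level alone supply about `1/w` earlier terms of cost at least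
one (`next_cost_le`). -/

theorem exists_equiv_antitone {ι : Type*} [Countable ι] [Infinite ι] (f : ι → ℝ)
    (hf : ∀ i, {j | f i ≤ f j}.Finite) : ∃ e : ℕ ≃ ι, Antitone (f ∘ e) := by
  -- Ties in `f` are broken by an injection into `ℕ`. This makes the order strict and total with
  -- finitely many predecessors of each element; their number is its position.
  obtain ⟨enc, henc⟩ := exists_injective_nat ι
  let lt : ι → ι → Prop := fun i j => f j < f i ∨ (f i = f j ∧ enc i < enc j)
  have lt_irrefl : ∀ i, ¬ lt i i := fun i h => by simp [lt] at h
  have lt_trans : ∀ {i j k}, lt i j → lt j k → lt i k := by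
    intro i j k hij hjk
    simp only [lt] at *
    rcases hij with h | ⟨h, h'⟩ <;> rcases hjk with g | ⟨g, g'⟩
    · exact Or.inl (g.trans h)
    · exact Or.inl (g ▸ h)
    · exact Or.inl (h ▸ g)
    · exact Or.inr ⟨h.trans g, h'.trans g'⟩
  have lt_tri : ∀ i j, lt i j ∨ i = j ∨ lt j i := by
    intro i j
    rcases lt_trichotomy (f i) (f j) with h | h | h
    · exact Or.inr (Or.inr (Or.inl h))
    · rcases lt_trichotomy (enc i) (enc j) with g | g | g
      · exact Or.inl (Or.inr ⟨h, g⟩)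
      · exact Or.inr (Or.inl (henc g))
      · exact Or.inr (Or.inr (Or.inr ⟨h.symm, g⟩))
    · exact Or.inl (Or.inl h)
  have fin : ∀ i, {j | lt j i}.Finite := fun i => (hf i).subset fun j hj => by
    rcases hj with h | ⟨h, -⟩
    · exact h.le
    · exact h.ge
  let rank : ι → ℕ := fun i => {j | lt j i}.ncard
  have rank_lt : ∀ {i j}, lt i j → rank i < rank j := by
    intro i j hij
    refine Set.ncard_lt_ncard ⟨fun k hk => lt_trans hk hij, fun h => lt_irrefl i (h hij)⟩ (fin j)
  have inj : Function.Injective rank := by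
    intro i j hij
    rcases lt_tri i j with h | h | h
    · exact absurd (rank_lt h) (by omega)
    · exact h
    · exact absurd (rank_lt h) (by omega)
  -- Ranks have no gaps: the predecessors of `i` are its last predecessor `m` together with those of
  -- `m`. Since the set of ranks is infinite, every natural number is attained.
  have pred : ∀ n, (∃ i, rank i = n + 1) → ∃ i, rank i = n := by
    rintro n ⟨i, hi⟩
    obtain ⟨m, hm, hmax⟩ := Set.Finite.exists_maximalFor rank {j | lt j i} (fin i)
      (Set.nonempty_of_ncard_ne_zero (by change rank i ≠ 0; omega))
    refine ⟨m, ?_⟩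
    have : {j | lt j i} = insert m {j | lt j m} := by
      ext j
      constructor
      · intro hj
        rcases lt_tri j m with h | h | h
        · exact Or.inr h
        · exact Or.inl h
        · exact absurd (hmax hj (rank_lt h).le) (not_le.2 (rank_lt h))
      · rintro (rfl | h)
        · exact hm
        · exact lt_trans h hm
    have h2 := Set.ncard_insert_of_notMem (s := {j | lt j m}) (a := m) (lt_irrefl m) (fin m)
    rw [← this] at h2
    change rank i = rank m + 1 at h2
    omega
  have surj : Function.Surjective rank := by
    intro n
    by_contra hn
    have hall : ∀ m, n ≤ m → ¬ ∃ i, rank i = m := by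
      intro m hm
      induction m, hm using Nat.le_induction with
      | base => exact hn
      | succ m _ ih => exact fun h => ih (pred m h)
    have : (Set.range rank).Finite := (Set.finite_lt_nat n).subset <| by
      rintro _ ⟨i, rfl⟩
      by_contra h
      exact hall _ (not_lt.1 h) ⟨i, rfl⟩
    exact Set.infinite_range_of_injective inj this
  let e := (Equiv.ofBijective rank ⟨inj, surj⟩)
  refine ⟨e.symm, fun m n hmn => ?_⟩
  by_contra! h
  have h1 := rank_lt (i := e.symm n) (j := e.symm m) (Or.inl h)
  have h2 : ∀ n, rank (e.symm n) = n := fun n => e.apply_symm_apply n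
  rw [h2, h2] at h1
  omega

/-! ### Weights of product form on finitely supported sequences -/

/-- Through its graph, a finitely supported sequence is a finite subset of `ι × ℕ`. The sum is
therefore a subfamily of the expansion of `∏ (1 + g i n)`, which converges with `∑ g`. -/
theorem summable_finsupp_prod {ι : Type*} (g : ι → ℕ → ℝ) (hg : ∀ i n, 0 ≤ g i n)
    (hs : Summable fun p : ι × ℕ => g p.1 p.2) : Summable fun k : ι →₀ ℕ => k.prod g := by
  have h := (summable_finsetProd_of_summable_nonneg (fun p : ι × ℕ => hg p.1 p.2) hs).comp_injective
    (Finsupp.graph_injective ι ℕ)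
  refine h.congr fun k => ?_
  simp only [Function.comp, Finsupp.graph, Finsupp.prod]
  rw [Finset.prod_map]
  rfl

/-- The weight by which the level sequences are ordered. -/
def weight (D : ℝ) (k : ℕ →₀ ℕ) : ℝ := k.prod fun ℓ n => (2 * D ^ ℓ * n)⁻¹

/-- An upper bound for the costs, in product form. -/
def costBound (D K C : ℝ) (k : ℕ →₀ ℕ) : ℝ := C * k.prod fun ℓ _ => K * D ^ ℓ

section

variable {D K C : ℝ}

theorem weight_zero : weight D 0 = 1 := by simp [weight]

theorem weight_pos (hD : 1 < D) (k : ℕ →₀ ℕ) : 0 < weight D k := by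
  refine Finset.prod_pos fun ℓ hℓ => ?_
  have : 0 < k ℓ := Nat.pos_of_ne_zero (Finsupp.mem_support_iff.1 hℓ)
  positivity

theorem weight_factor_le (hD : 1 < D) (ℓ n : ℕ) (hn : n ≠ 0) : (2 * D ^ ℓ * n : ℝ)⁻¹ ≤ 1 / 2 := by
  rw [one_div]
  refine inv_anti₀ (by norm_num) ?_
  have h1 : (1 : ℝ) ≤ D ^ ℓ := one_le_pow₀ hD.le
  have h2 : (1 : ℝ) ≤ n := by exact_mod_cast Nat.one_le_iff_ne_zero.2 hn
  nlinarith

/-- The factor 2 in the weight separates zero, of weight 1, from all other sequences; hence zero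
comes first in the enumeration. -/
theorem weight_le_half (hD : 1 < D) {k : ℕ →₀ ℕ} (hk : k ≠ 0) : weight D k ≤ 1 / 2 := by
  obtain ⟨ℓ, hℓ⟩ := Finsupp.support_nonempty_iff.2 hk
  rw [weight, Finsupp.prod, ← Finset.mul_prod_erase _ _ hℓ]
  calc _ ≤ (1 / 2 : ℝ) * 1 := by
        refine mul_le_mul (weight_factor_le hD _ _ (Finsupp.mem_support_iff.1 hℓ)) ?_
          (Finset.prod_nonneg fun i _ => by positivity) (by norm_num)
        refine Finset.prod_le_one (fun i _ => by positivity) fun i hi => ?_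
        exact (weight_factor_le hD _ _ (Finsupp.mem_support_iff.1 (Finset.mem_of_mem_erase hi))).trans
          (by norm_num)
    _ = 1 / 2 := by norm_num

theorem weight_single (ℓ n : ℕ) (hn : n ≠ 0) :
    weight D (Finsupp.single ℓ n) = (2 * D ^ ℓ * n : ℝ)⁻¹ := by
  classical
  rw [weight, Finsupp.prod, Finsupp.support_single _ hn]
  simp

theorem costBound_pos (hD : 1 < D) (hK : 0 < K) (hC : 0 < C) (k : ℕ →₀ ℕ) :
    0 < costBound D K C k :=
  mul_pos hC (Finset.prod_pos fun ℓ _ => by positivity)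

/-- The product structure reduces the claim to summing the factors over pairs `(ℓ, n)`, that is, to
a geometric series in `D^{1-σ}` times the series of `n^{-σ}`; both converge because `σ > 1`. -/
theorem summable_costBound_mul_weight (hD : 1 < D) (hK : 0 < K) {σ : ℝ} (hσ : 1 < σ) :
    Summable fun k => costBound D K C k * weight D k ^ σ := by
  have hD0 : 0 < D := by linarith
  have key : ∀ k : ℕ →₀ ℕ, costBound D K C k * weight D k ^ σ =
      C * k.prod fun ℓ n => K * D ^ ℓ * ((2 * D ^ ℓ * n : ℝ)⁻¹) ^ σ := by
    intro k
    rw [costBound, weight, Finsupp.prod, Finsupp.prod, Finsupp.prod,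
      ← Real.finsetProd_rpow _ _ (fun i _ => by positivity), mul_assoc, ← Finset.prod_mul_distrib]
  simp_rw [key]
  refine Summable.mul_left C (summable_finsupp_prod _ (fun ℓ n => by positivity) ?_)
  have h1 : Summable fun ℓ : ℕ => (D ^ (1 - σ)) ^ ℓ :=
    summable_geometric_of_lt_one (by positivity)
      (Real.rpow_lt_one_of_one_lt_of_neg hD (by linarith))
  have h2 : Summable fun n : ℕ => ((n : ℝ) ^ σ)⁻¹ := Real.summable_nat_rpow_inv.2 hσ
  have h3 := (h1.mul_of_nonneg h2 (fun _ => by simp; positivity)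
    (fun _ => by simp; positivity)).mul_left (K * 2 ^ (-σ))
  refine h3.congr fun p => ?_
  rw [Real.inv_rpow (by positivity), Real.mul_rpow (by positivity) (by positivity),
    Real.mul_rpow (by positivity) (by positivity), Real.rpow_neg (by norm_num),
    ← Real.rpow_natCast (D ^ (1 - σ)), ← Real.rpow_mul hD0.le, mul_comm (1 - σ),
    Real.rpow_mul hD0.le, Real.rpow_natCast, Real.rpow_sub (by positivity), Real.rpow_one]
  field_simp

/-- For `K = C = 1` the cost bound is at least 1, so convergence of the series with `σ = 2` leaves
only finitely many weights above `ε`. -/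
theorem finite_weight_ge (hD : 1 < D) {ε : ℝ} (hε : 0 < ε) : {k | ε ≤ weight D k}.Finite := by
  have h := (summable_costBound_mul_weight (C := 1) hD one_pos one_lt_two).tendsto_cofinite_zero
  have h2 := h.eventually (gt_mem_nhds (show 0 < ε ^ (2 : ℝ) by positivity))
  rw [Filter.eventually_cofinite] at h2
  refine h2.subset fun k hk => ?_
  have hk' : ε ≤ weight D k := hk
  have h1 : (1 : ℝ) ≤ costBound D 1 1 k := by
    rw [costBound, one_mul]
    refine Finset.prod_induction (fun ℓ : ℕ => 1 * D ^ ℓ) (1 ≤ ·)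
      (fun a b => one_le_mul_of_one_le_of_one_le) le_rfl fun ℓ _ => ?_
    rw [one_mul]
    exact one_le_pow₀ hD.le
  have h3 : ε ^ (2 : ℝ) ≤ weight D k ^ (2 : ℝ) := Real.rpow_le_rpow hε.le hk' (by norm_num)
  exact not_lt.2 (h3.trans (le_mul_of_one_le_left (Real.rpow_nonneg (weight_pos hD k).le 2) h1))

theorem exists_enumeration (hD : 1 < D) :
    ∃ e : ℕ ≃ (ℕ →₀ ℕ), Antitone (fun n => weight D (e n)) ∧ e 0 = 0 := by
  obtain ⟨e, he⟩ := exists_equiv_antitone (weight D)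
    fun k => finite_weight_ge hD (weight_pos hD k)
  refine ⟨e, he, ?_⟩
  by_contra h
  have h1 := weight_le_half hD h
  have h2 : weight D (e (e.symm 0)) ≤ weight D (e 0) := he (Nat.zero_le _)
  rw [e.apply_symm_apply, weight_zero] at h2
  linarith

/-- A weighted Stechkin estimate. -/
theorem tail_le {e : ℕ ≃ (ℕ →₀ ℕ)} (he : Antitone fun n => weight D (e n))
    (hD : 1 < D) (hK : 0 < K) (hC : 0 < C) {s t : ℝ} (hs : 0 ≤ s) (hst : s < t)
    {cost : (ℕ →₀ ℕ) → ℝ}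
    (hcost : ∀ k, cost k ≤ costBound D K C k) {J : ℕ}
    (hJ : 0 < ∑ j ∈ Finset.range J, cost (e j)) :
    (∑' j : ℕ, costBound D K C (e (j + J)) * weight D (e (j + J)) ^ (1 + t)) ≤
      (∑' k, costBound D K C k * weight D k ^ ((1 + t) / (1 + s))) ^ (1 + s) *
        (∑ j ∈ Finset.range J, cost (e j)) ^ (-s) := by
  -- This exponent gives `1 + t - σ = σ s`. The surplus power of the weights in the tail is then at
  -- most `(r^σ)^s ≤ (N / S)^s`, where `r` is the first weight of the tail.
  set σ := (1 + t) / (1 + s) with hσ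
  have hs1 : 0 < 1 + s := by linarith
  have hσ1 : 1 < σ := by rw [hσ, lt_div_iff₀ hs1]; linarith
  set S := ∑ j ∈ Finset.range J, cost (e j)
  set N := ∑' k, costBound D K C k * weight D k ^ σ with hN
  have hsum : Summable fun k => costBound D K C k * weight D k ^ σ :=
    summable_costBound_mul_weight hD hK hσ1
  have hsum' : Summable fun j => costBound D K C (e j) * weight D (e j) ^ σ :=
    hsum.comp_injective e.injective
  have hnn : ∀ k, 0 ≤ costBound D K C k * weight D k ^ σ := fun k =>
    mul_nonneg (costBound_pos hD hK hC k).le (Real.rpow_nonneg (weight_pos hD k).le _)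
  have hN' : N = ∑' j, costBound D K C (e j) * weight D (e j) ^ σ :=
    (e.tsum_eq fun k => costBound D K C k * weight D k ^ σ).symm
  set r := weight D (e J)
  have hr : 0 < r := weight_pos hD _
  -- The first `J` weights are at least `r`, and the costs lie below the cost bound.
  have h1 : r ^ σ * S ≤ N := by
    rw [hN']
    refine le_trans ?_ (hsum'.sum_le_tsum (Finset.range J) fun j _ => hnn _)
    rw [Finset.mul_sum]
    refine Finset.sum_le_sum fun j hj => ?_
    rw [mul_comm]
    refine mul_le_mul (hcost _) (Real.rpow_le_rpow hr.le (he (Finset.mem_range.1 hj).le)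
      (by linarith)) (Real.rpow_nonneg hr.le _) (costBound_pos hD hK hC _).le
  have hN0 : 0 < N := lt_of_lt_of_le (mul_pos (Real.rpow_pos_of_pos hr _) hJ) h1
  have h2 : r ^ (1 + t - σ) ≤ (N / S) ^ s := by
    have h3 : r ^ σ ≤ N / S := by rwa [le_div_iff₀ hJ]
    have h4 : 1 + t - σ = σ * s := by rw [hσ]; field_simp; ring
    rw [h4, Real.rpow_mul hr.le]
    exact Real.rpow_le_rpow (Real.rpow_nonneg hr.le _) h3 hs
  have hshift : Summable fun j => costBound D K C (e (j + J)) * weight D (e (j + J)) ^ σ :=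
    (summable_nat_add_iff J).2 hsum'
  have h5 : ∀ j, costBound D K C (e (j + J)) * weight D (e (j + J)) ^ (1 + t) ≤
      costBound D K C (e (j + J)) * weight D (e (j + J)) ^ σ * r ^ (1 + t - σ) := by
    intro j
    have hw := weight_pos hD (e (j + J))
    rw [mul_assoc]
    refine mul_le_mul_of_nonneg_left ?_ (costBound_pos hD hK hC _).le
    calc weight D (e (j + J)) ^ (1 + t)
        = weight D (e (j + J)) ^ σ * weight D (e (j + J)) ^ (1 + t - σ) := by
          rw [← Real.rpow_add hw]; congr 1; ring
      _ ≤ _ := by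
          refine mul_le_mul_of_nonneg_left ?_ (Real.rpow_nonneg hw.le _)
          refine Real.rpow_le_rpow hw.le (he (Nat.le_add_left _ _)) ?_
          have : 1 + t - σ = σ * s := by rw [hσ]; field_simp; ring
          rw [this]; exact mul_nonneg (by linarith) hs
  have hsumt : Summable fun j => costBound D K C (e (j + J)) * weight D (e (j + J)) ^ (1 + t) :=
    Summable.of_nonneg_of_le (fun j => mul_nonneg (costBound_pos hD hK hC _).le
      (Real.rpow_nonneg (weight_pos hD _).le _)) h5 (hshift.mul_right _)
  calc _ ≤ ∑' j, costBound D K C (e (j + J)) * weight D (e (j + J)) ^ σ * r ^ (1 + t - σ) :=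
        hsumt.tsum_le_tsum h5 (hshift.mul_right _)
    _ = (∑' j, costBound D K C (e (j + J)) * weight D (e (j + J)) ^ σ) * r ^ (1 + t - σ) :=
        tsum_mul_right
    _ ≤ N * (N / S) ^ s := by
        refine mul_le_mul ?_ h2 (Real.rpow_nonneg hr.le _) hN0.le
        rw [hN', ← hsum'.sum_add_tsum_nat_add J]
        exact le_add_of_nonneg_left (Finset.sum_nonneg fun j _ => hnn _)
    _ = N ^ (1 + s) * S ^ (-s) := by
        rw [Real.div_rpow hN0.le hJ.le, Real.rpow_add hN0, Real.rpow_one, Real.rpow_neg hJ.le]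
        field_simp

/-- Each new cost is dominated by the sum of the previous ones. -/
theorem next_cost_le {e : ℕ ≃ (ℕ →₀ ℕ)} (he : Antitone fun n => weight D (e n)) (he0 : e 0 = 0)
    (hD : 1 < D) (hC : 0 < C) {cost : (ℕ →₀ ℕ) → ℝ} (hcost0 : ∀ k, 0 ≤ cost k)
    (hcost : ∀ k, cost k ≤ C * 2 ^ k.support.card * D ^ (k.support.sup id))
    {ℓ₁ : ℕ} (hone : ∀ n, 1 ≤ cost (Finsupp.single ℓ₁ n)) {J : ℕ} (hJ : 1 ≤ J) :
    cost (e J) ≤ 2 * C * D ^ ℓ₁ * ∑ j ∈ Finset.range J, cost (e j) := by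
  set r := weight D (e J)
  have hr : 0 < r := weight_pos hD _
  have hJ0 : e J ≠ 0 := fun h => by
    have := e.injective (h.trans he0.symm); omega
  -- The factors 2 of the weight cancel `2 ^ #supp`, and the factor of the largest level `m` in the
  -- support cancels `D ^ m`; all remaining factors are at most 1.
  have h1 : cost (e J) * r ≤ C := by
    set k := e J
    refine (mul_le_mul_of_nonneg_right (hcost k) hr.le).trans ?_
    rw [mul_assoc, mul_assoc]
    refine mul_le_of_le_one_right hC.le ?_
    have hne : k.support.Nonempty := Finsupp.support_nonempty_iff.2 hJ0
    obtain ⟨m, hm, hmax⟩ := Finset.exists_mem_eq_sup k.support hne id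
    have hprod : r = (2 ^ k.support.card : ℝ)⁻¹ * ∏ ℓ ∈ k.support, (D ^ ℓ * (k ℓ : ℝ))⁻¹ := by
      simp only [r, weight, Finsupp.prod]
      rw [← inv_pow, ← Finset.prod_const, ← Finset.prod_mul_distrib]
      exact Finset.prod_congr rfl fun ℓ _ => by rw [mul_assoc, mul_inv]
    have hfac : ∀ ℓ ∈ k.support, (D ^ ℓ * (k ℓ : ℝ))⁻¹ ≤ (D ^ ℓ)⁻¹ := by
      intro ℓ hℓ
      have : (1 : ℝ) ≤ k ℓ := by
        exact_mod_cast Nat.one_le_iff_ne_zero.2 (Finsupp.mem_support_iff.1 hℓ)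
      exact inv_anti₀ (by positivity) (le_mul_of_one_le_right (by positivity) this)
    have hle : ∏ ℓ ∈ k.support, (D ^ ℓ * (k ℓ : ℝ))⁻¹ ≤ (D ^ m)⁻¹ := by
      rw [← Finset.mul_prod_erase _ _ hm]
      refine (mul_le_of_le_one_right (by positivity) ?_).trans (hfac m hm)
      refine Finset.prod_le_one (fun i _ => by positivity) fun i hi => ?_
      exact (hfac i (Finset.mem_of_mem_erase hi)).trans (inv_le_one_of_one_le₀ (one_le_pow₀ hD.le))
    rw [hmax, hprod]
    have hDm : (0 : ℝ) < D ^ m := by positivity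
    calc _ = D ^ m * ∏ ℓ ∈ k.support, (D ^ ℓ * (k ℓ : ℝ))⁻¹ := by
          simp only [id]; field_simp
      _ ≤ D ^ m * (D ^ m)⁻¹ := by gcongr
      _ = 1 := mul_inv_cancel₀ hDm.ne'
  -- For `0 < n < x` the sequence with the single entry `n` on level `ℓ₁` has weight above `r`,
  -- hence precedes position `J`; `n = 0` gives `e 0`, which precedes it because `1 ≤ J`. These are
  -- `⌈x⌉` sequences of cost at least 1.
  have hDl : (0 : ℝ) < D ^ ℓ₁ := by positivity
  set x := (2 * D ^ ℓ₁ * r)⁻¹ with hx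
  have hxS : x ≤ ∑ j ∈ Finset.range J, cost (e j) := by
    have hsub : (Finset.range ⌈x⌉₊).image (fun n => e.symm (Finsupp.single ℓ₁ n)) ⊆
        Finset.range J := by
      intro j hj
      obtain ⟨n, hn, rfl⟩ := Finset.mem_image.1 hj
      rw [Finset.mem_range, Nat.lt_ceil] at hn
      rw [Finset.mem_range]
      rcases Nat.eq_zero_or_pos n with rfl | hn0
      · rw [Finsupp.single_zero, ← he0, e.symm_apply_apply]; omega
      · by_contra! hge
        have h3 : weight D (e (e.symm (Finsupp.single ℓ₁ n))) ≤ r := he hge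
        rw [e.apply_symm_apply, weight_single _ _ (by omega)] at h3
        have hn' : (0 : ℝ) < n := by exact_mod_cast hn0
        rw [hx, lt_inv_comm₀ hn' (by positivity)] at hn
        rw [inv_le_comm₀ (by positivity) hr] at h3
        have : r⁻¹ * r = 1 := inv_mul_cancel₀ hr.ne'
        have h4 : (n : ℝ)⁻¹ * n = 1 := inv_mul_cancel₀ hn'.ne'
        nlinarith
    have hinj : Function.Injective fun n => e.symm (Finsupp.single ℓ₁ n) :=
      e.symm.injective.comp (Finsupp.single_injective ℓ₁)
    calc x ≤ ⌈x⌉₊ := Nat.le_ceil x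
      _ = ∑ j ∈ (Finset.range ⌈x⌉₊).image (fun n => e.symm (Finsupp.single ℓ₁ n)), (1 : ℝ) := by
          rw [Finset.sum_const, Finset.card_image_of_injective _ hinj]; simp
      _ ≤ ∑ j ∈ (Finset.range ⌈x⌉₊).image (fun n => e.symm (Finsupp.single ℓ₁ n)), cost (e j) := by
          refine Finset.sum_le_sum fun j hj => ?_
          obtain ⟨n, -, rfl⟩ := Finset.mem_image.1 hj
          rw [e.apply_symm_apply]; exact hone n
      _ ≤ _ := Finset.sum_le_sum_of_subset_of_nonneg hsub fun j _ _ => hcost0 _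
  calc cost (e J) ≤ C / r := by rwa [le_div_iff₀ hr]
    _ = 2 * C * D ^ ℓ₁ * x := by rw [hx]; field_simp
    _ ≤ _ := by gcongr

theorem costSharp_le_costBound (hD : 1 < D) (hK : 2 ≤ K) (hC : 0 < C) (k : ℕ →₀ ℕ) :
    C * 2 ^ k.support.card * D ^ (k.support.sup id) ≤ costBound D K C k := by
  rw [costBound, mul_assoc, Finsupp.prod, Finset.prod_mul_distrib, Finset.prod_const,
    Finset.prod_pow_eq_pow_sum]
  have : k.support.sup id ≤ ∑ i ∈ k.support, i := 
    Finset.sup_le fun i hi => Finset.single_le_sum (f := fun i : ℕ => i) (fun _ _ => Nat.zero_le _) hi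
  gcongr
  exact hD.le

end

/-! ### Essential supports -/

section

variable {d : ℕ} {D : Set (Space d)}

theorem essSupport_subset_closure (f : Space d → ℝ) : essSupport D f ⊆ closure D := by
  intro x hx
  rw [mem_closure_iff_nhds]
  intro U hU
  by_contra h
  refine hx U hU (measure_mono_null ?_ measure_empty)
  rintro z ⟨hz, hzD, -⟩
  exact h ⟨z, hz, hzD⟩

/-- A set that is null near each of its points is null, so the part of `{f ≠ 0}` in `D` outside the
essential support can be discarded. -/
theorem ae_mem_essSupport (hD : MeasurableSet D) (f : Space d → ℝ) :
    ∀ᵐ x ∂(volume.restrict D), f x ≠ 0 → x ∈ essSupport D f := by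
  rw [ae_restrict_iff' hD, ae_iff]
  have h : {x | ¬(x ∈ D → f x ≠ 0 → x ∈ essSupport D f)} =
      {z ∈ D | f z ≠ 0} ∩ (essSupport D f)ᶜ := by
    ext x; simp; tauto
  rw [h]
  refine measure_null_of_locally_null _ fun x hx => ?_
  have hx2 := hx.2
  simp only [essSupport, mem_compl_iff, mem_ofPred_eq, not_forall, not_not] at hx2
  obtain ⟨U, hU, h0⟩ := hx2
  refine ⟨U ∩ ({z ∈ D | f z ≠ 0} ∩ (essSupport D f)ᶜ), ?_, ?_⟩
  · exact Filter.inter_mem (mem_nhdsWithin_of_mem_nhds hU) self_mem_nhdsWithin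
  · exact measure_mono_null (inter_subset_inter_right U inter_subset_left) h0

theorem mul_ae_eq_zero_of_disjoint (hD : MeasurableSet D) {f g : Space d → ℝ}
    (h : ∀ x ∈ essSupport D f, x ∉ essSupport D g) :
    (fun x => f x * g x) =ᵐ[volume.restrict D] 0 := by
  filter_upwards [ae_mem_essSupport hD f, ae_mem_essSupport hD g] with x hf hg
  by_contra hne
  simp only [Pi.zero_apply, mul_eq_zero, not_or] at hne
  exact h x (hf hne.1) (hg hne.2)

/-- The empty set has diameter zero, which the lower diameter bound excludes. -/
theorem IsMultilevel.nonempty_essSupport {M : Type*} {θ₀ : Space d → ℝ} {θ : M → Space d → ℝ}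
    {lvl : M → ℕ} {α c C : ℝ} (h : IsMultilevel D θ₀ θ lvl α c C) (hc : 0 < c) (μ : M) :
    (essSupport D (θ μ)).Nonempty := by
  rw [nonempty_iff_ne_empty]
  intro h0
  have h1 := h.le_diam μ
  rw [h0, Metric.diam_empty] at h1
  have : 0 < c * (2 : ℝ) ^ (-(lvl μ : ℝ)) := by positivity
  linarith

theorem IsMultilevel.not_ae_eq_zero {M : Type*} {θ₀ : Space d → ℝ} {θ : M → Space d → ℝ}
    {lvl : M → ℕ} {α c C : ℝ} (h : IsMultilevel D θ₀ θ lvl α c C) (hD : MeasurableSet D)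
    (hc : 0 < c) (μ : M) :
    ¬ (θ μ =ᵐ[volume.restrict D] 0) := by
  intro h0
  obtain ⟨x, hx⟩ := h.nonempty_essSupport hc μ
  refine hx univ Filter.univ_mem (measure_mono_null inter_subset_right ?_)
  rw [Filter.EventuallyEq, ae_restrict_iff' hD, ae_iff] at h0
  refine measure_mono_null (fun z hz => ?_) h0
  simpa using hz

end

/-! ### Greedy colouring -/

/-- The neighbours of a new vertex use at most `N` of the `N + 1` colours. The relation may be
reflexive; a vertex counted as its own neighbour does no harm. -/
theorem exists_greedy_colouring {ι : Type*} (r : ι → ι → Prop) (hr : ∀ i j, r i j → r j i) {N : ℕ}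
    (s : Finset ι) (hfin : ∀ i ∈ s, {j | r i j}.Finite) (hN : ∀ i ∈ s, {j | r i j}.ncard ≤ N) :
    ∃ col : ι → Fin (N + 1), ∀ i ∈ s, ∀ j ∈ s, i ≠ j → r i j → col i ≠ col j := by
  classical
  induction s using Finset.induction_on with
  | empty => exact ⟨fun _ => 0, by simp⟩
  | insert a s ha ih =>
    obtain ⟨col, hcol⟩ := ih (fun i hi => hfin i (Finset.mem_insert_of_mem hi))
      fun i hi => hN i (Finset.mem_insert_of_mem hi)
    have hf := hfin a (Finset.mem_insert_self a s)
    obtain ⟨x, hx⟩ : ∃ x : Fin (N + 1), x ∉ hf.toFinset.image col := by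
      by_contra! h
      have h1 : (Finset.univ : Finset (Fin (N + 1))) ⊆ hf.toFinset.image col := fun x _ => h x
      have h2 := (Finset.card_le_card h1).trans Finset.card_image_le
      rw [Finset.card_univ, Fintype.card_fin, ← Set.ncard_eq_toFinset_card _ hf] at h2
      exact absurd (hN a (Finset.mem_insert_self a s)) (by omega)
    have hx' : ∀ j, r a j → col j ≠ x := fun j hj h =>
      hx (Finset.mem_image.2 ⟨j, by simpa using hj, h⟩)
    refine ⟨Function.update col a x, fun i hi j hj hij hrij => ?_⟩
    rcases Finset.mem_insert.1 hi with rfl | hi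
    · rw [Function.update_self, Function.update_of_ne hij.symm]
      exact (hx' j hrij).symm
    · have hia : i ≠ a := fun h => ha (h ▸ hi)
      rcases Finset.mem_insert.1 hj with rfl | hj
      · rw [Function.update_self, Function.update_of_ne hij]
        exact hx' i (hr _ _ hrij)
      · have hja : j ≠ a := fun h => ha (h ▸ hj)
        rw [Function.update_of_ne hia, Function.update_of_ne hja]
        exact hcol i hi j hj hij hrij

/-! ### Existence of level assignments -/

section

variable {d : ℕ} {D : Set (Space d)} {M : Type u} {θ₀ : Space d → ℝ} {θ : M → Space d → ℝ}
  {lvl : M → ℕ} {α c C : ℝ}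

/-- The localization bound compares a cardinality with a positive multiple of `C`. -/
theorem IsMultilevel.const_nonneg (h : IsMultilevel D θ₀ θ lvl α c C) : 0 ≤ C := by
  by_contra! hC
  have h1 := (h.localized 0 0 1 one_pos).2
  have h2 : C * max 1 ((2 : ℝ) ^ (d * 0) * 1 ^ d) < 0 :=
    mul_neg_of_neg_of_pos hC (lt_of_lt_of_le one_pos (le_max_left _ _))
  have h3 : (0 : ℝ) ≤ ({μ | lvl μ = 0 ∧ (essSupport D (θ μ) ∩ Metric.ball 0 1).Nonempty}.ncard : ℝ) :=
    Nat.cast_nonneg _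
  linarith

/-- Two indices on the same level are close if their supports have points at distance at most
`C 2^{-level}`. -/
def Close (D : Set (Space d)) (θ : M → Space d → ℝ) (lvl : M → ℕ) (C : ℝ) (μ μ' : M) : Prop :=
  lvl μ = lvl μ' ∧ ∃ x ∈ essSupport D (θ μ), ∃ z ∈ essSupport D (θ μ'),
    dist x z ≤ C * (2 : ℝ) ^ (-(lvl μ : ℝ))

theorem Close.symm {μ μ' : M} (h : Close D θ lvl C μ μ') : Close D θ lvl C μ' μ := by
  obtain ⟨h1, x, hx, z, hz, hxz⟩ := h
  exact ⟨h1.symm, z, hz, x, hx, by rwa [dist_comm, ← h1]⟩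

/-- From a point of the support of `θ_μ`, every close support is reached within twice `C
2^{-level}`: once across the support, once across the gap. The extra `1` in the radius makes the
ball open, and the scaling makes the count independent of the level. -/
theorem IsMultilevel.close_finite (h : IsMultilevel D θ₀ θ lvl α c C) (hc : 0 < c)
    (hb : Bornology.IsBounded D) (μ : M) :
    {μ' | Close D θ lvl C μ μ'}.Finite ∧
      ({μ' | Close D θ lvl C μ μ'}.ncard : ℝ) ≤ C * (2 * C + 1) ^ d := by
  have hC := h.const_nonneg
  obtain ⟨x₀, hx₀⟩ := h.nonempty_essSupport hc μ
  set r := (2 * C + 1) * (2 : ℝ) ^ (-(lvl μ : ℝ)) with hr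
  have hp : (0 : ℝ) < (2 : ℝ) ^ (-(lvl μ : ℝ)) := by positivity
  have hr0 : 0 < r := by positivity
  obtain ⟨h1, h2⟩ := h.localized (lvl μ) x₀ r hr0
  have hbd : Bornology.IsBounded (essSupport D (θ μ)) :=
    -- Boundedness matters: `Metric.diam` of an unbounded set is zero and would not control
    -- distances.
    hb.closure.subset (essSupport_subset_closure _)
  have hsub : {μ' | Close D θ lvl C μ μ'} ⊆
      {μ' | lvl μ' = lvl μ ∧ (essSupport D (θ μ') ∩ Metric.ball x₀ r).Nonempty} := by
    rintro μ' ⟨hl, x, hx, z, hz, hxz⟩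
    refine ⟨hl.symm, z, hz, ?_⟩
    rw [Metric.mem_ball, dist_comm]
    calc dist x₀ z ≤ dist x₀ x + dist x z := dist_triangle _ _ _
      _ ≤ C * (2 : ℝ) ^ (-(lvl μ : ℝ)) + C * (2 : ℝ) ^ (-(lvl μ : ℝ)) :=
        add_le_add ((Metric.dist_le_diam_of_mem hbd hx₀ hx).trans (h.diam_le μ)) hxz
      _ < r := by rw [hr]; linarith
  refine ⟨h1.subset hsub, ?_⟩
  have h3 : ({μ' | Close D θ lvl C μ μ'}.ncard : ℝ) ≤
      ({μ' | lvl μ' = lvl μ ∧ (essSupport D (θ μ') ∩ Metric.ball x₀ r).Nonempty}.ncard : ℝ) := by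
    exact_mod_cast Set.ncard_le_ncard hsub h1
  refine h3.trans (h2.trans_eq ?_)
  congr 1
  have h4 : (2 : ℝ) ^ (d * lvl μ) * r ^ d = (2 * C + 1) ^ d := by
    rw [hr, mul_pow, Real.rpow_neg (by norm_num), Real.rpow_natCast, mul_comm d, pow_mul, inv_pow]
    field_simp
  rw [h4]
  exact max_eq_right (one_le_pow₀ (by linarith))

theorem IsMultilevel.finite_level (h : IsMultilevel D θ₀ θ lvl α c C) (hc : 0 < c)
    {r : ℝ} (hr0 : 0 < r) (hr : closure D ⊆ Metric.ball 0 r) (ℓ : ℕ) :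
    {μ | lvl μ = ℓ}.Finite ∧
      ({μ | lvl μ = ℓ}.ncard : ℝ) ≤ C * max 1 (r ^ d) * (2 : ℝ) ^ (d * ℓ) := by
  obtain ⟨h1, h2⟩ := h.localized ℓ 0 r hr0
  have heq : {μ | lvl μ = ℓ ∧ (essSupport D (θ μ) ∩ Metric.ball 0 r).Nonempty} =
      {μ | lvl μ = ℓ} := by
    ext μ
    refine ⟨fun h => h.1, fun hμ => ⟨hμ, ?_⟩⟩
    obtain ⟨x, hx⟩ := h.nonempty_essSupport hc μ
    exact ⟨x, hx, hr (essSupport_subset_closure _ hx)⟩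
  rw [heq] at h1 h2
  refine ⟨h1, h2.trans ?_⟩
  rw [mul_assoc]
  refine mul_le_mul_of_nonneg_left ?_ h.const_nonneg
  have h1 : (1 : ℝ) ≤ 2 ^ (d * ℓ) := one_le_pow₀ (by norm_num)
  refine max_le ?_ ?_
  · exact one_le_mul_of_one_le_of_one_le (le_max_left _ _) h1
  · rw [mul_comm]
    gcongr
    exact le_max_right _ _

theorem IsMultilevel.exists_levelAssignment (h : IsMultilevel D θ₀ θ lvl α c C) (hc : 0 < c)
    (hα : 0 < α) (hD : IsOpen D) (hb : Bornology.IsBounded D)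
    {r : ℝ} (hr0 : 0 < r) (hr : closure D ⊆ Metric.ball 0 r) :
    ∃ lev : M → ℕ, IsLevelAssignment D θ α (⌈C * (2 * C + 1) ^ d⌉₊ + 1)
      (C * max 1 (r ^ d) + C * 2 ^ α) lev := by
  set Q := ⌈C * (2 * C + 1) ^ d⌉₊ + 1 with hQ
  have hQ0 : 0 < Q := by omega
  have hC := h.const_nonneg
  have hfin : ∀ ℓ, {μ | lvl μ = ℓ}.Finite := fun ℓ => (h.finite_level hc hr0 hr ℓ).1
  have hcol : ∀ ℓ, ∃ col : M → Fin Q, ∀ μ ∈ (hfin ℓ).toFinset, ∀ μ' ∈ (hfin ℓ).toFinset,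
      μ ≠ μ' → Close D θ lvl C μ μ' → col μ ≠ col μ' := by
    intro ℓ
    refine exists_greedy_colouring _ (fun _ _ => Close.symm) _
      (fun μ _ => (h.close_finite hc hb μ).1) fun μ _ => ?_
    have h1 := (h.close_finite hc hb μ).2.trans (Nat.le_ceil _)
    rw [Nat.cast_le] at h1
    omega
  choose col hcol using hcol
  have hdiv : ∀ μ, (Q * lvl μ + (col (lvl μ) μ : ℕ)) / Q = lvl μ := fun μ => by
    rw [Nat.mul_add_div hQ0, Nat.div_eq_of_lt (col (lvl μ) μ).2, add_zero]
  have hclose : ∀ μ μ', Q * lvl μ + (col (lvl μ) μ : ℕ) = Q * lvl μ' + (col (lvl μ') μ' : ℕ) →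
      μ ≠ μ' → lvl μ = lvl μ' ∧ ¬ Close D θ lvl C μ μ' := by
    intro μ μ' heq hne
    have hl : lvl μ = lvl μ' := by rw [← hdiv μ, heq, hdiv μ']
    refine ⟨hl, fun hcl => hcol (lvl μ) μ (by simp) μ' (by simp [hl]) hne hcl ?_⟩
    rw [hl] at heq ⊢
    exact Fin.ext (by omega)
  have hmeet : ∀ μ μ', ¬ ((fun x => θ μ x * θ μ' x) =ᵐ[volume.restrict D] 0) →
      ∃ x ∈ essSupport D (θ μ), x ∈ essSupport D (θ μ') := by
    intro μ μ' hne
    by_contra! hdis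
    exact hne (mul_ae_eq_zero_of_disjoint hD.measurableSet hdis)
  have hdisj : ∀ μ μ', Q * lvl μ + (col (lvl μ) μ : ℕ) = Q * lvl μ' + (col (lvl μ') μ' : ℕ) →
      μ ≠ μ' → (fun x => θ μ x * θ μ' x) =ᵐ[volume.restrict D] 0 := by
    intro μ μ' heq hne
    by_contra hne0
    obtain ⟨x, hx, hx'⟩ := hmeet μ μ' hne0
    obtain ⟨hl, hncl⟩ := hclose μ μ' heq hne
    exact hncl ⟨hl, x, hx, x, hx', by rw [dist_self]; positivity⟩
  have hsub : ∀ ℓ, {μ | Q * lvl μ + (col (lvl μ) μ : ℕ) = ℓ} ⊆ {μ | lvl μ = ℓ / Q} := by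
    rintro _ μ rfl
    exact (hdiv μ).symm
  refine ⟨fun μ => Q * lvl μ + col (lvl μ) μ, hdisj, ?_, fun ℓ => (hfin _).subset (hsub ℓ), ?_, ?_⟩
  · intro μ ℓ hℓ μ₁ ⟨h1, hne1⟩ μ₂ ⟨h2, hne2⟩
    by_contra hne
    obtain ⟨hl, hncl⟩ := hclose μ₁ μ₂ (h1.trans h2.symm) hne
    obtain ⟨x, hx, hx1⟩ := hmeet _ _ hne1
    obtain ⟨z, hz, hz2⟩ := hmeet _ _ hne2
    refine hncl ⟨hl, x, hx1, z, hz2, ?_⟩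
    have hbd : Bornology.IsBounded (essSupport D (θ μ)) :=
      hb.closure.subset (essSupport_subset_closure _)
    refine (Metric.dist_le_diam_of_mem hbd hx hz).trans ((h.diam_le μ).trans ?_)
    -- Division by `Q` recovers the original level and is monotone. The support of `θ_μ`, which
    -- meets both others, is thus small on the scale of `μ₁`, and `μ₁` and `μ₂` are close.
    have hle : lvl μ₁ ≤ lvl μ := by
      rw [← hdiv μ₁, ← hdiv μ, h1]
      exact Nat.div_le_div_right hℓ.le
    refine mul_le_mul_of_nonneg_left (Real.rpow_le_rpow_of_exponent_le (by norm_num) ?_) hC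
    exact neg_le_neg (by exact_mod_cast hle)
  · intro ℓ
    have h1 : ({μ | Q * lvl μ + (col (lvl μ) μ : ℕ) = ℓ}.ncard : ℝ) ≤
        ({μ | lvl μ = ℓ / Q}.ncard : ℝ) := by
      exact_mod_cast Set.ncard_le_ncard (hsub ℓ) (hfin _)
    refine h1.trans ((h.finite_level hc hr0 hr _).2.trans ?_)
    refine mul_le_mul (le_add_of_nonneg_right (by positivity)) ?_ (by positivity) (by positivity)
    rw [← Real.rpow_natCast]
    refine Real.rpow_le_rpow_of_exponent_le (by norm_num) ?_
    push_cast
    rw [div_mul_eq_mul_div, mul_div_assoc]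
    exact mul_le_mul_of_nonneg_left Nat.cast_div_le (Nat.cast_nonneg _)
  · intro ℓ
    have hf : Finite {μ // Q * lvl μ + (col (lvl μ) μ : ℕ) = ℓ} := (hfin _).subset (hsub ℓ)
    have hae1 : ∀ᵐ x ∂(volume.restrict D), ∀ μ : {μ // Q * lvl μ + (col (lvl μ) μ : ℕ) = ℓ},
        |θ μ x| ≤ C * (2 : ℝ) ^ (-(α * lvl μ)) := by
      rw [ae_all_iff]
      intro μ
      have := h.decay μ
      rw [eLpNorm_exponent_top] at this
      filter_upwards [ae_le_eLpNormEssSup (f := θ μ) (μ := volume.restrict D)] with x hx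
      have h2 := hx.trans this
      rw [Real.enorm_eq_ofReal_abs] at h2
      exact (ENNReal.ofReal_le_ofReal_iff (by positivity)).1 h2
    have hae2 : ∀ᵐ x ∂(volume.restrict D), ∀ μ μ' : {μ // Q * lvl μ + (col (lvl μ) μ : ℕ) = ℓ},
        μ ≠ μ' → θ μ x * θ μ' x = 0 := by
      rw [ae_all_iff]; intro μ
      rw [ae_all_iff]; intro μ'
      by_cases hne : μ = μ'
      · simp [hne]
      · filter_upwards [hdisj μ μ' (μ.2.trans μ'.2.symm) (fun h => hne (Subtype.ext h))] with x hx _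
        exact hx
    filter_upwards [hae1, hae2] with x hx1 hx2
    by_cases hz : ∀ μ : {μ // Q * lvl μ + (col (lvl μ) μ : ℕ) = ℓ}, θ μ x = 0
    · simp only [hz, abs_zero, tsum_zero]
      positivity
    · push Not at hz
      obtain ⟨μ, hμ⟩ := hz
      rw [tsum_eq_single μ fun μ' hne => by
        rcases mul_eq_zero.1 (hx2 μ' μ hne) with h | h
        · rw [h, abs_zero]
        · exact absurd h hμ]
      refine (hx1 μ).trans ?_
      -- At almost every `x` the level sum has at most one nonzero term. Since `ℓ ≤ Q (lvl μ + 1)`,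
      -- passing from the original level to `ℓ / Q` costs a factor `2 ^ α`.
      have h3 : (2 : ℝ) ^ (-(α * lvl μ)) ≤ 2 ^ α * (2 : ℝ) ^ (-(α / Q * ℓ)) := by
        rw [← Real.rpow_add (by norm_num)]
        refine Real.rpow_le_rpow_of_exponent_le (by norm_num) ?_
        have hlt : ℓ ≤ Q * (lvl μ + 1) := by
          have := μ.2; have := (col (lvl μ) μ).2; rw [mul_add]; omega
        have hlt' : (ℓ : ℝ) ≤ Q * (lvl μ + 1) := by exact_mod_cast hlt
        have hQ' : (0 : ℝ) < Q := by exact_mod_cast hQ0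
        have h4 : (ℓ : ℝ) / Q ≤ lvl μ + 1 := by rw [div_le_iff₀ hQ']; linarith
        have h5 : α / Q * ℓ = α * (ℓ / Q) := by ring
        rw [h5]
        nlinarith
      calc C * (2 : ℝ) ^ (-(α * lvl μ)) ≤ C * (2 ^ α * (2 : ℝ) ^ (-(α / Q * ℓ))) := by gcongr
        _ ≤ _ := by
          rw [← mul_assoc]
          refine mul_le_mul_of_nonneg_right (le_add_of_nonneg_left (by positivity)) (by positivity)

end

/-! ### The uniform measure on `[-1, 1]` -/

theorem integral_uniformOne {E : Type*} [NormedAddCommGroup E] [NormedSpace ℝ E] (f : ℝ → E) :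
    ∫ t, f t ∂uniformOne = (2 : ℝ)⁻¹ • ∫ t in (-1 : ℝ)..1, f t := by
  rw [uniformOne, integral_smul_measure, intervalIntegral.integral_of_le (by norm_num),
    integral_Icc_eq_integral_Ioc]
  simp

theorem integrable_uniformOne {f : ℝ → ℝ} (hf : Continuous f) : Integrable f uniformOne :=
  (hf.continuousOn.integrableOn_Icc).smul_measure (by simp)

theorem ae_uniformOne_abs_le : ∀ᵐ t ∂uniformOne, |t| ≤ 1 := by
  refine Measure.ae_smul_measure ?_ _
  filter_upwards [ae_restrict_mem measurableSet_Icc] with t ht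
  exact abs_le.2 ht

/-! ### Legendre polynomials -/

section

open Polynomial

theorem integral_derivative_mul (p q : ℝ[X]) (h1 : p.eval 1 = 0) (h2 : p.eval (-1) = 0) :
    ∫ t in (-1 : ℝ)..1, (derivative p).eval t * q.eval t =
      -∫ t in (-1 : ℝ)..1, p.eval t * (derivative q).eval t := by
  have h := intervalIntegral.integral_deriv_mul_eq_sub_of_hasDeriv_right (a := -1) (b := 1)
    (u := fun t => p.eval t) (v := fun t => q.eval t) (u' := fun t => (derivative p).eval t)
    (v' := fun t => (derivative q).eval t) p.continuous.continuousOn q.continuous.continuousOn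
    (fun t _ => (p.hasDerivAt t).hasDerivWithinAt) (fun t _ => (q.hasDerivAt t).hasDerivWithinAt)
    (p.derivative.continuous.intervalIntegrable _ _)
    (q.derivative.continuous.intervalIntegrable _ _)
  rw [intervalIntegral.integral_add ((p.derivative.continuous.fun_mul q.continuous).intervalIntegrable _ _)
    ((p.continuous.fun_mul q.derivative.continuous).intervalIntegrable _ _), h1, h2] at h
  linarith

theorem integral_iterate_derivative_mul (n j : ℕ) (hj : j ≤ n) (q : ℝ[X]) :
    ∫ t in (-1 : ℝ)..1, (derivative^[j] ((X ^ 2 - 1 : ℝ[X]) ^ n)).eval t * q.eval t =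
      (-1) ^ j * ∫ t in (-1 : ℝ)..1, ((X ^ 2 - 1 : ℝ[X]) ^ n).eval t * (derivative^[j] q).eval t := by
  induction j generalizing q with
  | zero => simp
  | succ j ih =>
    -- The boundary terms vanish: `(X ^ 2 - 1) ^ (n - j)` divides the `j`-th derivative, and `j < n`
    -- here.
    have hv : ∀ x : ℝ, x ^ 2 = 1 → (derivative^[j] ((X ^ 2 - 1 : ℝ[X]) ^ n)).eval x = 0 := by
      intro x hx
      obtain ⟨r, hr⟩ := pow_sub_dvd_iterate_derivative_pow (X ^ 2 - 1 : ℝ[X]) n j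
      rw [hr, eval_mul, eval_pow, eval_sub, eval_pow, eval_X, eval_one, hx, sub_self,
        zero_pow (by omega), zero_mul]
    rw [Function.iterate_succ_apply', integral_derivative_mul _ _ (hv 1 (by norm_num))
      (hv (-1) (by norm_num)), ih (by omega), Function.iterate_succ_apply, pow_succ]
    ring

theorem monic_sq_sub_one_pow (n : ℕ) : ((X ^ 2 - 1 : ℝ[X]) ^ n).Monic :=
  (monic_X_pow_sub_C 1 two_ne_zero).pow n

theorem natDegree_sq_sub_one_pow (n : ℕ) : ((X ^ 2 - 1 : ℝ[X]) ^ n).natDegree = 2 * n := by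
  rw [natDegree_pow, ← C_1, natDegree_X_pow_sub_C, mul_comm]

theorem integral_sq_sub_one_pow (n : ℕ) :
    ∫ t in (-1 : ℝ)..1, ((X ^ 2 - 1 : ℝ[X]) ^ n).eval t =
      (-1) ^ n * (2 ^ (2 * n + 1) * (n.factorial : ℝ) ^ 2 / (2 * n + 1).factorial) := by
  induction n with
  | zero => norm_num
  | succ n ih =>
    -- Integrating the derivative of `X (X² - 1)^{n+1}`, which vanishes at both endpoints, gives a
    -- two-term recursion for the integrals.
    have h := integral_derivative_mul (X * (X ^ 2 - 1) ^ (n + 1)) 1 (by simp) (by simp)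
    have hd : derivative (X * (X ^ 2 - 1 : ℝ[X]) ^ (n + 1)) =
        C (2 * n + 3 : ℝ) * (X ^ 2 - 1) ^ (n + 1) + C (2 * n + 2 : ℝ) * (X ^ 2 - 1) ^ n := by
      simp only [derivative_mul, derivative_X, derivative_pow, derivative_sub, derivative_one,
        map_add, map_mul, map_ofNat, map_natCast]
      push_cast
      simp
      ring
    rw [hd] at h
    simp only [eval_add, eval_mul, eval_C, eval_one, mul_one, derivative_one, eval_zero, mul_zero,
      intervalIntegral.integral_zero, neg_zero] at h
    rw [intervalIntegral.integral_add
      ((continuous_const.fun_mul (Polynomial.continuous _)).intervalIntegrable _ _)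
      ((continuous_const.fun_mul (Polynomial.continuous _)).intervalIntegrable _ _),
      intervalIntegral.integral_const_mul, intervalIntegral.integral_const_mul, ih] at h
    have h3 : (2 * (n : ℝ) + 3) ≠ 0 := by positivity
    have h4 : ∫ t in (-1 : ℝ)..1, ((X ^ 2 - 1 : ℝ[X]) ^ (n + 1)).eval t = -(2 * n + 2) *
        ((-1) ^ n * (2 ^ (2 * n + 1) * (n.factorial : ℝ) ^ 2 / (2 * n + 1).factorial)) /
          (2 * n + 3) := by
      rw [eq_div_iff h3]; linarith
    have h5 : ((2 * (n + 1) + 1).factorial : ℝ) = (2 * n + 3) * ((2 * n + 2) *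
        (2 * n + 1).factorial) := by
      rw [show 2 * (n + 1) + 1 = (2 * n + 1) + 1 + 1 by ring, Nat.factorial_succ, Nat.factorial_succ]
      push_cast; ring
    have h6 : ((2 * n + 1).factorial : ℝ) ≠ 0 := by positivity
    rw [h4, h5, Nat.factorial_succ n]
    push_cast
    field_simp
    ring

theorem iterate_derivative_two_mul (n : ℕ) :
    derivative^[n] (derivative^[n] ((X ^ 2 - 1 : ℝ[X]) ^ n)) = C ((2 * n).factorial : ℝ) := by
  rw [← Function.iterate_add_apply, ← two_mul]
  have h1 := natDegree_iterate_derivative ((X ^ 2 - 1 : ℝ[X]) ^ n) (2 * n)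
  rw [natDegree_sq_sub_one_pow, Nat.sub_self] at h1
  rw [eq_C_of_natDegree_le_zero h1, coeff_iterate_derivative, zero_add, Nat.descFactorial_self]
  have h2 := (monic_sq_sub_one_pow n).coeff_natDegree
  rw [natDegree_sq_sub_one_pow] at h2
  rw [h2, nsmul_eq_mul, mul_one]

theorem natDegree_legendre_le (n : ℕ) : (legendre n).natDegree ≤ n := by
  refine (natDegree_C_mul_le _ _).trans ((natDegree_iterate_derivative _ _).trans ?_)
  rw [natDegree_sq_sub_one_pow]; omega

theorem legendre_const_ne_zero (n : ℕ) : Real.sqrt (2 * n + 1) / (2 ^ n * n.factorial) ≠ 0 := by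
  have : 0 < Real.sqrt (2 * n + 1) := Real.sqrt_pos.2 (by positivity)
  positivity

theorem degree_legendre (n : ℕ) : (legendre n).degree = n := by
  have h1 : (legendre n).coeff n ≠ 0 := by
    have h2 := (monic_sq_sub_one_pow n).coeff_natDegree
    rw [natDegree_sq_sub_one_pow] at h2
    rw [legendre, coeff_C_mul, coeff_iterate_derivative, ← two_mul, h2, nsmul_eq_mul, mul_one]
    refine mul_ne_zero (legendre_const_ne_zero n) ?_
    exact_mod_cast (Nat.descFactorial_pos.2 (by omega)).ne'
  refine le_antisymm ((degree_le_natDegree).trans (by exact_mod_cast natDegree_legendre_le n)) ?_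
  exact le_degree_of_ne_zero h1

theorem span_legendre : Submodule.span ℝ (Set.range legendre) = ⊤ :=
  Polynomial.Sequence.span ⟨legendre, degree_legendre⟩ fun i => by
    rw [isUnit_iff_ne_zero, leadingCoeff_ne_zero]
    intro h
    have := degree_legendre i
    rw [show legendre i = 0 from h, degree_zero] at this
    simp at this

theorem integral_legendre_mul_of_natDegree_lt {n : ℕ} {q : ℝ[X]} (hq : q.natDegree < n) :
    ∫ t, (legendre n).eval t * q.eval t ∂uniformOne = 0 := by
  rw [integral_uniformOne]
  simp only [legendre, eval_mul, eval_C, mul_assoc]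
  rw [intervalIntegral.integral_const_mul, integral_iterate_derivative_mul n n le_rfl,
    iterate_derivative_eq_zero hq]
  simp

theorem integral_legendre_sq (n : ℕ) :
    ∫ t, (legendre n).eval t * (legendre n).eval t ∂uniformOne = 1 := by
  rw [integral_uniformOne]
  set c := Real.sqrt (2 * n + 1) / (2 ^ n * n.factorial) with hc
  have h1 : ∀ t, (legendre n).eval t * (legendre n).eval t = c ^ 2 *
      ((derivative^[n] ((X ^ 2 - 1 : ℝ[X]) ^ n)).eval t *
        (derivative^[n] ((X ^ 2 - 1 : ℝ[X]) ^ n)).eval t) := by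
    intro t; simp only [legendre, eval_mul, eval_C, ← hc]; ring
  simp_rw [h1]
  rw [intervalIntegral.integral_const_mul, integral_iterate_derivative_mul n n le_rfl,
    iterate_derivative_two_mul]
  simp only [eval_C]
  rw [intervalIntegral.integral_mul_const, integral_sq_sub_one_pow, hc, div_pow,
    Real.sq_sqrt (by positivity), Nat.factorial_succ]
  have h2 : ((-1 : ℝ) ^ n) * (-1) ^ n = 1 := by rw [← mul_pow]; norm_num
  have h3 : ((2 * n).factorial : ℝ) ≠ 0 := by positivity
  have h4 : (n.factorial : ℝ) ≠ 0 := by positivity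
  have h5 : (2 * (n : ℝ) + 1) ≠ 0 := by positivity
  push_cast
  rw [smul_eq_mul]
  field_simp
  rw [← pow_mul] 
  ring_nf
  simp

theorem integral_legendre_mul (m n : ℕ) :
    ∫ t, (legendre m).eval t * (legendre n).eval t ∂uniformOne = if m = n then 1 else 0 := by
  rcases lt_trichotomy m n with h | rfl | h
  · rw [if_neg h.ne]
    simp_rw [mul_comm ((legendre m).eval _)]
    exact integral_legendre_mul_of_natDegree_lt ((natDegree_legendre_le m).trans_lt h)
  · rw [if_pos rfl]; exact integral_legendre_sq m
  · rw [if_neg h.ne']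
    exact integral_legendre_mul_of_natDegree_lt ((natDegree_legendre_le n).trans_lt h)

theorem legendre_zero : legendre 0 = 1 := by simp [legendre]

/-- Multiplying `q` by the Legendre polynomial of smaller degree keeps the degree below the larger
of `m` and `n`, where orthogonality applies. -/
theorem integral_legendre_mul_legendre_mul {m n : ℕ} {q : ℝ[X]} (hq : q.natDegree < Nat.dist m n) :
    ∫ t, q.eval t * ((legendre m).eval t * (legendre n).eval t) ∂uniformOne = 0 := by
  rcases le_total m n with h | h
  · rw [Nat.dist_eq_sub_of_le h] at hq
    have h1 := natDegree_mul_le (p := q) (q := legendre m)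
    have h2 := natDegree_legendre_le m
    rw [← integral_legendre_mul_of_natDegree_lt (n := n) (q := q * legendre m) (by omega)]
    refine integral_congr_ae (.of_forall fun t => ?_)
    simp only [eval_mul]; ring
  · rw [Nat.dist_eq_sub_of_le_right h] at hq
    have h1 := natDegree_mul_le (p := q) (q := legendre n)
    have h2 := natDegree_legendre_le n
    rw [← integral_legendre_mul_of_natDegree_lt (n := m) (q := q * legendre n) (by omega)]
    refine integral_congr_ae (.of_forall fun t => ?_)
    simp only [eval_mul]; ring

theorem abs_exp_sub_sum_le (x : ℝ) (k : ℕ) :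
    |Real.exp x - ∑ i ∈ Finset.range k, x ^ i / i.factorial| ≤
      |x| ^ k / k.factorial * Real.exp |x| := by
  have hs : ∀ x : ℝ, HasSum (fun i : ℕ => x ^ i / i.factorial) (Real.exp x) := fun x => by
    rw [Real.exp_eq_exp_ℝ]; exact NormedSpace.expSeries_div_hasSum_exp x
  have h1 : Real.exp x - ∑ i ∈ Finset.range k, x ^ i / i.factorial =
      ∑' i : ℕ, x ^ (i + k) / (i + k).factorial := by
    rw [← (hs x).tsum_eq, ← (hs x).summable.sum_add_tsum_nat_add k, add_sub_cancel_left]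
  have h2 : ∀ i : ℕ, ‖x ^ (i + k) / ((i + k).factorial : ℝ)‖ ≤
      |x| ^ k / k.factorial * (|x| ^ i / i.factorial) := by
    intro i
    rw [Real.norm_eq_abs, abs_div, abs_pow, Nat.abs_cast, div_mul_div_comm, ← pow_add, add_comm k]
    have : k.factorial * i.factorial ≤ (i + k).factorial :=
      Nat.le_of_dvd (Nat.factorial_pos _) (add_comm k i ▸ Nat.factorial_mul_factorial_dvd_factorial_add k i)
    gcongr
    exact_mod_cast this
  rw [h1, ← Real.norm_eq_abs, ← (hs |x|).tsum_eq, ← tsum_mul_left]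
  exact tsum_of_norm_bounded ((hs |x|).summable.mul_left _).hasSum h2

/-- The Taylor polynomial of degree below `|m - n|` integrates to zero against `L_m L_n`, so only
the exponential remainder counts. Its bound on `[-1, 1]` comes out of the integral, and `|L_m L_n| ≤
(L_m² + L_n²) / 2` integrates to 1. -/
theorem abs_integral_exp_mul_legendre_le (θ : ℝ) (m n : ℕ) :
    |∫ t, Real.exp (t * θ) * ((legendre m).eval t * (legendre n).eval t) ∂uniformOne| ≤
      |θ| ^ Nat.dist m n / (Nat.dist m n).factorial * Real.exp |θ| := by
  set k := Nat.dist m n with hk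
  set q : ℝ[X] := ∑ i ∈ Finset.range k, C (θ ^ i / i.factorial) * X ^ i with hq
  have hqe : ∀ t, q.eval t = ∑ i ∈ Finset.range k, (t * θ) ^ i / i.factorial := by
    intro t
    rw [hq, eval_finsetSum]
    refine Finset.sum_congr rfl fun i _ => ?_
    simp only [eval_mul, eval_C, eval_pow, eval_X]; ring
  have hint : ∫ t, q.eval t * ((legendre m).eval t * (legendre n).eval t) ∂uniformOne = 0 := by
    rcases Nat.eq_zero_or_pos k with h0 | h0
    · simp [hqe, h0]
    · refine integral_legendre_mul_legendre_mul ?_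
      refine (natDegree_sum_le_of_forall_le (n := k - 1) _ _ fun i hi => ?_).trans_lt (by omega)
      have := Finset.mem_range.1 hi
      exact (natDegree_C_mul_X_pow_le _ _).trans (by omega)
  have hc : Continuous fun t => (legendre m).eval t * (legendre n).eval t :=
    (Polynomial.continuous _).mul (Polynomial.continuous _)
  have h1 : ∫ t, Real.exp (t * θ) * ((legendre m).eval t * (legendre n).eval t) ∂uniformOne =
      ∫ t, (Real.exp (t * θ) - q.eval t) * ((legendre m).eval t * (legendre n).eval t)
        ∂uniformOne := by
    simp_rw [sub_mul]
    rw [integral_sub (integrable_uniformOne ((by fun_prop : Continuous fun t =>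
      Real.exp (t * θ)).fun_mul hc)) (integrable_uniformOne (q.continuous.fun_mul hc)), hint, sub_zero]
  have hint2 : Integrable (fun t => |θ| ^ k / k.factorial * Real.exp |θ| *
      (((legendre m).eval t * (legendre m).eval t + (legendre n).eval t * (legendre n).eval t) / 2))
      uniformOne := integrable_uniformOne (by fun_prop)
  rw [h1, ← Real.norm_eq_abs]
  refine (norm_integral_le_of_norm_le hint2 ?_).trans_eq ?_
  · filter_upwards [ae_uniformOne_abs_le] with t ht
    rw [norm_mul]
    refine mul_le_mul ?_ ?_ (norm_nonneg _) (by positivity)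
    · rw [hqe, Real.norm_eq_abs]
      refine (abs_exp_sub_sum_le _ _).trans ?_
      have : |t * θ| ≤ |θ| := by
        rw [abs_mul]; exact mul_le_of_le_one_left (abs_nonneg _) ht
      gcongr
    · rw [Real.norm_eq_abs, abs_mul]
      nlinarith [sq_nonneg (|(legendre m).eval t| - |(legendre n).eval t|),
        abs_mul_abs_self ((legendre m).eval t), abs_mul_abs_self ((legendre n).eval t)]
  · rw [integral_const_mul, integral_div, integral_add (integrable_uniformOne (by fun_prop))
      (integrable_uniformOne (by fun_prop)), integral_legendre_sq, integral_legendre_sq]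
    norm_num

end

/-! ### Product Legendre polynomials -/

section

variable {M : Type u}

instance : IsProbabilityMeasure (sigma M) := by unfold sigma; infer_instance

theorem ae_sigma_abs_le [Countable M] : ∀ᵐ y ∂(sigma M), ∀ μ, |y μ| ≤ 1 := by
  rw [ae_all_iff]
  intro μ
  exact (measurePreserving_eval_infinitePi (fun _ : M => uniformOne) μ).quasiMeasurePreserving.ae
    ae_uniformOne_abs_le

theorem prodLegendre_eq_prod {ν : M →₀ ℕ} {F : Finset M} (hF : ν.support ⊆ F) (y : M → ℝ) :
    prodLegendre ν y = ∏ μ ∈ F, (legendre (ν μ)).eval (y μ) := by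
  refine Finset.prod_subset hF fun μ _ hμ => ?_
  rw [Finsupp.notMem_support_iff.1 hμ, legendre_zero, Polynomial.eval_one]

theorem continuous_prodLegendre (ν : M →₀ ℕ) : Continuous (prodLegendre ν) :=
  continuous_finsetProd _ fun μ _ => (Polynomial.continuous _).comp (continuous_apply μ)

theorem isCompact_cube : IsCompact {y : M → ℝ | ∀ μ, |y μ| ≤ 1} := by
  have : {y : M → ℝ | ∀ μ, |y μ| ≤ 1} = Set.pi univ fun _ => Icc (-1) 1 := by
    ext y; simp only [mem_ofPred_eq, Set.mem_pi, mem_univ, true_implies, mem_Icc, abs_le]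
  rw [this]
  exact isCompact_univ_pi fun _ => isCompact_Icc

theorem exists_abs_prodLegendre_le (ν : M →₀ ℕ) :
    ∃ B, 0 ≤ B ∧ ∀ y : M → ℝ, (∀ μ, |y μ| ≤ 1) → |prodLegendre ν y| ≤ B := by
  obtain ⟨B, hB⟩ := (isCompact_cube (M := M)).exists_bound_of_continuousOn
    (continuous_prodLegendre ν).continuousOn
  exact ⟨B, (norm_nonneg _).trans (hB 0 (by simp)), fun y hy => hB y hy⟩

theorem memLp_top_prodLegendre [Countable M] (ν : M →₀ ℕ) : MemLp (prodLegendre ν) ∞ (sigma M) := by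
  obtain ⟨B, -, hB⟩ := exists_abs_prodLegendre_le ν
  refine memLp_top_of_bound (continuous_prodLegendre ν).aestronglyMeasurable B ?_
  filter_upwards [ae_sigma_abs_le] with y hy
  exact hB y hy

theorem integral_prod_sigma (F : Finset M) (g : M → ℝ → ℝ) (hg : ∀ μ, Continuous (g μ)) :
    ∫ y, ∏ μ ∈ F, g μ (y μ) ∂(sigma M) = ∏ μ ∈ F, ∫ t, g μ t ∂uniformOne := by
  have h1 := integral_restrict_infinitePi (fun _ : M => uniformOne) (s := F)
    (f := fun y => ∏ μ : F, g μ (y μ)) (Continuous.aestronglyMeasurable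
      (continuous_finsetProd _ fun μ _ => (hg μ).comp (continuous_apply μ)))
  rw [integral_fintype_prod_eq_prod (𝕜 := ℝ) (fun μ : F => g μ)] at h1
  rw [← Finset.prod_coe_sort F fun μ => ∫ t, g μ t ∂uniformOne, ← h1, sigma]
  refine integral_congr_ae (.of_forall fun y => ?_)
  exact (Finset.prod_coe_sort F fun μ => g μ (y μ)).symm

theorem integral_prodLegendre_mul (ν ν' : M →₀ ℕ) [Decidable (ν = ν')] :
    ∫ y, prodLegendre ν y * prodLegendre ν' y ∂(sigma M) = if ν = ν' then 1 else 0 := by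
  classical
  set F := ν.support ∪ ν'.support
  simp_rw [prodLegendre_eq_prod (F := F) Finset.subset_union_left,
    prodLegendre_eq_prod (F := F) Finset.subset_union_right, ← Finset.prod_mul_distrib]
  rw [integral_prod_sigma F (fun μ t => (legendre (ν μ)).eval t * (legendre (ν' μ)).eval t)
    fun μ => (Polynomial.continuous _).mul (Polynomial.continuous _)]
  simp_rw [integral_legendre_mul]
  split_ifs with h
  · simp [h]
  · obtain ⟨μ, hμ⟩ := Finsupp.ne_iff.1 h
    refine Finset.prod_eq_zero (i := μ) ?_ (if_neg hμ)
    by_contra hn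
    simp only [F, Finset.mem_union, Finsupp.mem_support_iff, not_or, not_not] at hn
    exact hμ (hn.1.trans hn.2.symm)

theorem tendsto_exp_sum {φ : M → ℝ} (hφ : Summable fun μ => |φ μ|) {y : M → ℝ}
    (hy : ∀ μ, |y μ| ≤ 1) : Summable (fun μ => y μ * φ μ) ∧
      ∀ F : Finset M, Real.exp (∑ μ ∈ F, y μ * φ μ) ≤ Real.exp (∑' μ, |φ μ|) := by
  have hle : ∀ μ, |y μ * φ μ| ≤ |φ μ| := fun μ => by
    rw [abs_mul]; exact mul_le_of_le_one_left (abs_nonneg _) (hy μ)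
  refine ⟨(Summable.of_nonneg_of_le (fun _ => abs_nonneg _) hle hφ).of_abs, fun F => ?_⟩
  refine Real.exp_le_exp.2 ((Finset.sum_le_sum fun μ _ => (le_abs_self _).trans (hle μ)).trans ?_)
  exact hφ.sum_le_tsum F fun _ _ => abs_nonneg _

/-- For finitely many coordinates both the integrand and the measure factorize, and the
one-dimensional bound applies to each factor. Dominated convergence on the cube passes to the full
sum. -/
theorem abs_integral_exp_mul_prodLegendre_le [Countable M] {φ : M → ℝ}
    (hφ : Summable fun μ => |φ μ|) (ν ν' : M →₀ ℕ) :
    |∫ y, Real.exp (∑' μ, y μ * φ μ) * prodLegendre ν y * prodLegendre ν' y ∂(sigma M)| ≤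
      Real.exp (∑' μ, |φ μ|) * (absDiff ν ν').prod fun μ n => |φ μ| ^ n / n.factorial := by
  classical
  obtain ⟨B, hB0, hB⟩ := exists_abs_prodLegendre_le ν
  obtain ⟨B', -, hB'⟩ := exists_abs_prodLegendre_le ν'
  have hlim : Filter.Tendsto (fun F : Finset M => ∫ y, Real.exp (∑ μ ∈ F, y μ * φ μ) *
      prodLegendre ν y * prodLegendre ν' y ∂(sigma M)) Filter.atTop
      (nhds (∫ y, Real.exp (∑' μ, y μ * φ μ) * prodLegendre ν y * prodLegendre ν' y
        ∂(sigma M))) := by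
    refine tendsto_integral_filter_of_dominated_convergence
      (fun _ => Real.exp (∑' μ, |φ μ|) * B * B') (.of_forall fun F => ?_) (.of_forall fun F => ?_)
      (integrable_const _) ?_
    · refine Continuous.aestronglyMeasurable ?_
      have := continuous_prodLegendre ν
      have := continuous_prodLegendre ν'
      fun_prop
    · filter_upwards [ae_sigma_abs_le] with y hy
      rw [norm_mul, norm_mul, Real.norm_eq_abs, Real.abs_exp]
      exact mul_le_mul (mul_le_mul ((tendsto_exp_sum hφ hy).2 F) (hB y hy) (abs_nonneg _)
        (Real.exp_pos _).le) (hB' y hy) (abs_nonneg _) (by positivity)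
    · filter_upwards [ae_sigma_abs_le] with y hy
      exact (((Real.continuous_exp.tendsto _).comp (tendsto_exp_sum hφ hy).1.hasSum).mul_const
        _).mul_const _
  refine le_of_tendsto hlim.abs ?_
  filter_upwards [Filter.eventually_ge_atTop (ν.support ∪ ν'.support)] with F hF
  have h1 : ν.support ⊆ F := Finset.subset_union_left.trans hF
  have h2 : ν'.support ⊆ F := Finset.subset_union_right.trans hF
  have h3 : (absDiff ν ν').support ⊆ F := by
    refine Finset.Subset.trans (fun μ hμ => ?_) hF
    rw [Finsupp.mem_support_iff, absDiff, Finsupp.zipWith_apply] at hμ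
    by_contra hn
    simp only [Finset.mem_union, Finsupp.mem_support_iff, not_or, not_not] at hn
    rw [hn.1, hn.2] at hμ
    exact hμ (Nat.dist_self 0)
  have h4 : ∀ y : M → ℝ, Real.exp (∑ μ ∈ F, y μ * φ μ) * prodLegendre ν y * prodLegendre ν' y =
      ∏ μ ∈ F, Real.exp (y μ * φ μ) *
        ((legendre (ν μ)).eval (y μ) * (legendre (ν' μ)).eval (y μ)) := by
    intro y
    rw [prodLegendre_eq_prod h1, prodLegendre_eq_prod h2, Real.exp_sum, mul_assoc,
      ← Finset.prod_mul_distrib, ← Finset.prod_mul_distrib]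
  simp_rw [h4]
  rw [integral_prod_sigma F (fun μ t => Real.exp (t * φ μ) *
    ((legendre (ν μ)).eval t * (legendre (ν' μ)).eval t)) (fun μ => by fun_prop),
    Finset.abs_prod]
  refine (Finset.prod_le_prod (fun _ _ => abs_nonneg _) fun μ _ =>
    abs_integral_exp_mul_legendre_le (φ μ) (ν μ) (ν' μ)).trans ?_
  rw [Finset.prod_mul_distrib, ← Real.exp_sum, mul_comm]
  have h5 : ∏ μ ∈ F, |φ μ| ^ Nat.dist (ν μ) (ν' μ) / (Nat.dist (ν μ) (ν' μ)).factorial =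
      (absDiff ν ν').prod fun μ n => |φ μ| ^ n / n.factorial := by
    rw [Finsupp.prod_of_support_subset _ h3 _ (by simp)]
    rfl
  rw [h5]
  refine mul_le_mul_of_nonneg_right (Real.exp_le_exp.2 (hφ.sum_le_tsum F fun _ _ => abs_nonneg _)) ?_
  exact Finset.prod_nonneg fun _ _ => by positivity

/-! ### Completeness of the product Legendre polynomials -/

/-- The projection onto the cube `[-1, 1]^M`. -/
def clip (y : M → ℝ) : {y : M → ℝ | ∀ μ, |y μ| ≤ 1} :=
  ⟨fun μ => max (-1) (min 1 (y μ)), fun _ => abs_le.2 ⟨le_max_left _ _,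
    max_le (by norm_num) (min_le_left _ _)⟩⟩

theorem continuous_clip : Continuous (clip (M := M)) := by
  refine Continuous.subtype_mk ?_ _
  fun_prop

theorem clip_eq {y : M → ℝ} (hy : ∀ μ, |y μ| ≤ 1) : (clip y : M → ℝ) = y := by
  ext μ
  have := abs_le.1 (hy μ)
  simp [clip, this.1, this.2]

/-- The product Legendre polynomials on the cube. -/
def cubeLegendre (ν : M →₀ ℕ) : C({y : M → ℝ | ∀ μ, |y μ| ≤ 1}, ℝ) :=
  ⟨fun y => prodLegendre ν y, (continuous_prodLegendre ν).comp continuous_subtype_val⟩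

/-- The coordinate functions on the cube. -/
def cubeCoord (μ : M) : C({y : M → ℝ | ∀ μ, |y μ| ≤ 1}, ℝ) :=
  ⟨fun y => (y : M → ℝ) μ, (continuous_apply μ).comp continuous_subtype_val⟩

/-- With the factors of the other coordinates frozen, the Legendre polynomials in `y_μ` span all
polynomials in `y_μ`; in particular they reach `X * legendre (ν μ)`. -/
theorem cubeCoord_mul_mem (μ : M) (p : C({y : M → ℝ | ∀ μ, |y μ| ≤ 1}, ℝ))
    (hp : p ∈ Submodule.span ℝ (range (cubeLegendre (M := M)))) :
    cubeCoord μ * p ∈ Submodule.span ℝ (range (cubeLegendre (M := M))) := by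
  classical
  induction hp using Submodule.span_induction with
  | zero => simp
  | add p q _ _ hp hq => rw [mul_add]; exact Submodule.add_mem _ hp hq
  | smul r p _ hp => rw [mul_smul_comm]; exact Submodule.smul_mem _ _ hp
  | mem p hp =>
    obtain ⟨ν, rfl⟩ := hp
    let Λ : Polynomial ℝ →ₗ[ℝ] C({y : M → ℝ | ∀ μ, |y μ| ≤ 1}, ℝ) :=
      { toFun := fun q => ⟨fun y => q.eval ((y : M → ℝ) μ) *
          ∏ μ' ∈ ν.support.erase μ, (legendre (ν μ')).eval ((y : M → ℝ) μ'),
            (q.continuous.comp ((continuous_apply μ).comp continuous_subtype_val)).mul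
              (continuous_finsetProd _ fun μ' _ => (Polynomial.continuous _).comp
                ((continuous_apply μ').comp continuous_subtype_val))⟩
        map_add' := fun p q => by ext y; simp [add_mul]
        map_smul' := fun r p => by ext y; simp [mul_assoc] }
    have hmem : ∀ q, Λ q ∈ Submodule.span ℝ (range (cubeLegendre (M := M))) := by
      intro q
      suffices h : ⊤ ≤ (Submodule.span ℝ (range (cubeLegendre (M := M)))).comap Λ from
        h (Submodule.mem_top (x := q))
      rw [← span_legendre, Submodule.span_le]
      rintro _ ⟨n, rfl⟩
      refine Submodule.subset_span ⟨ν.update μ n, ?_⟩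
      ext y
      have hsup : (ν.update μ n).support ⊆ insert μ (ν.support.erase μ) := by
        intro μ' hμ'
        by_cases h : μ' = μ
        · exact Finset.mem_insert.2 (Or.inl h)
        · rw [Finsupp.mem_support_iff, Finsupp.coe_update, Function.update_of_ne h] at hμ'
          simp [h, hμ']
      simp only [cubeLegendre, Λ, LinearMap.coe_mk, AddHom.coe_mk, ContinuousMap.coe_mk]
      rw [prodLegendre_eq_prod hsup, Finset.prod_insert (Finset.notMem_erase _ _)]
      congr 1
      · simp
      · refine Finset.prod_congr rfl fun μ' hμ' => ?_
        rw [Finsupp.coe_update, Function.update_of_ne (Finset.ne_of_mem_erase hμ')]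
    convert hmem (Polynomial.X * legendre (ν μ)) using 1
    ext y
    simp only [cubeCoord, cubeLegendre, Λ, LinearMap.coe_mk, AddHom.coe_mk, ContinuousMap.mul_apply, ContinuousMap.coe_mk,
      Polynomial.eval_mul, Polynomial.eval_X]
    rw [prodLegendre_eq_prod (F := insert μ (ν.support.erase μ)), Finset.prod_insert
      (Finset.notMem_erase _ _), mul_assoc]
    intro μ' hμ'
    by_cases h : μ' = μ
    · simp [h]
    · simp [h, Finsupp.mem_support_iff.1 hμ']

/-- Stone–Weierstrass gives density of the algebra generated by the coordinates. The Legendre span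
contains 1 and is stable under multiplication by this algebra, hence contains it. -/
theorem closure_span_cubeLegendre :
    (Submodule.span ℝ (range (cubeLegendre (M := M)))).topologicalClosure = ⊤ := by
  have : CompactSpace {y : M → ℝ | ∀ μ, |y μ| ≤ 1} := isCompact_iff_compactSpace.1 isCompact_cube
  have h1 := ContinuousMap.subalgebra_topologicalClosure_eq_top_of_separatesPoints
    (Algebra.adjoin ℝ (range (cubeCoord (M := M)))) (by
      intro x y hxy
      obtain ⟨μ, hμ⟩ := Function.ne_iff.1 (fun h => hxy (Subtype.ext h))
      exact ⟨_, ⟨cubeCoord μ, Algebra.subset_adjoin ⟨μ, rfl⟩, rfl⟩, hμ⟩)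
  have h2 : ∀ f ∈ Algebra.adjoin ℝ (range (cubeCoord (M := M))),
      ∀ p ∈ Submodule.span ℝ (range (cubeLegendre (M := M))),
        f * p ∈ Submodule.span ℝ (range (cubeLegendre (M := M))) := by
    intro f hf
    induction hf using Algebra.adjoin_induction with
    | mem f hf => obtain ⟨μ, rfl⟩ := hf; exact cubeCoord_mul_mem μ
    | algebraMap r =>
      intro p hp
      rw [← Algebra.smul_def]; exact Submodule.smul_mem _ _ hp
    | add f g _ _ hf hg =>
      intro p hp
      rw [add_mul]; exact Submodule.add_mem _ (hf p hp) (hg p hp)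
    | mul f g _ _ hf hg =>
      intro p hp
      rw [mul_assoc]; exact hf _ (hg p hp)
  have hone : (1 : C({y : M → ℝ | ∀ μ, |y μ| ≤ 1}, ℝ)) ∈
      Submodule.span ℝ (range (cubeLegendre (M := M))) := by
    refine Submodule.subset_span ⟨0, ?_⟩
    ext y; simp [cubeLegendre, prodLegendre]
  rw [eq_top_iff]
  intro f _
  have hf : f ∈ (Algebra.adjoin ℝ (range (cubeCoord (M := M)))).topologicalClosure := by
    rw [h1]; trivial
  refine closure_mono (fun g hg => ?_) hf
  have := h2 g hg 1 hone
  rwa [mul_one] at this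

/-- Uniform density extends the orthogonality to all continuous functions on the cube, hence to
bounded continuous functions on `M → ℝ`, because the measure lives on the cube. The latter are dense
in `L²`. -/
theorem ae_eq_zero_of_integral_prodLegendre_mul [Countable M] {g : (M → ℝ) → ℝ}
    (hg : MemLp g 2 (sigma M)) (h : ∀ ν, ∫ y, prodLegendre ν y * g y ∂(sigma M) = 0) :
    g =ᵐ[sigma M] 0 := by
  have hwr : (sigma M).WeaklyRegular := by unfold sigma; infer_instance
  have hcomp : CompactSpace {y : M → ℝ | ∀ μ, |y μ| ≤ 1} :=
    isCompact_iff_compactSpace.1 isCompact_cube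
  have hg1 : Integrable g (sigma M) := hg.integrable (by norm_num)
  -- orthogonality to all continuous functions on the cube
  have hcont : ∀ p : C({y : M → ℝ | ∀ μ, |y μ| ≤ 1}, ℝ),
      ∫ y, p (clip y) * g y ∂(sigma M) = 0 := by
    have hmeas : ∀ p : C({y : M → ℝ | ∀ μ, |y μ| ≤ 1}, ℝ),
        Integrable (fun y => p (clip y) * g y) (sigma M) := fun p =>
      hg1.bdd_mul (c := ‖p‖) (p.continuous.comp continuous_clip).aestronglyMeasurable
        (.of_forall fun y => p.norm_coe_le_norm _)
    let Φ : C({y : M → ℝ | ∀ μ, |y μ| ≤ 1}, ℝ) →L[ℝ] ℝ := LinearMap.mkContinuous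
      { toFun := fun p => ∫ y, p (clip y) * g y ∂(sigma M)
        map_add' := fun p q => by
          simp only [ContinuousMap.add_apply, add_mul]
          exact integral_add (hmeas p) (hmeas q)
        map_smul' := fun r p => by
          simp only [ContinuousMap.smul_apply, smul_eq_mul, mul_assoc, RingHom.id_apply]
          exact integral_const_mul _ _ }
      (∫ y, ‖g y‖ ∂(sigma M)) (fun p => by
        simp only [LinearMap.coe_mk, AddHom.coe_mk]
        refine (norm_integral_le_of_norm_le (hg1.norm.mul_const ‖p‖) (.of_forall fun y => ?_)).trans_eq
          (integral_mul_const _ _)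
        rw [norm_mul, mul_comm]
        exact mul_le_mul_of_nonneg_left (p.norm_coe_le_norm _) (norm_nonneg _))
    intro p
    have hker : (Submodule.span ℝ (range (cubeLegendre (M := M)))).topologicalClosure ≤
        (Φ : C({y : M → ℝ | ∀ μ, |y μ| ≤ 1}, ℝ) →ₗ[ℝ] ℝ).ker := by
      refine Submodule.topologicalClosure_minimal _ ?_ Φ.isClosed_ker
      rw [Submodule.span_le]
      rintro _ ⟨ν, rfl⟩
      change ∫ y, prodLegendre ν (clip y) * g y ∂(sigma M) = 0
      rw [← h ν]
      refine integral_congr_ae ?_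
      filter_upwards [ae_sigma_abs_le] with y hy
      rw [clip_eq hy]
    rw [closure_span_cubeLegendre] at hker
    exact hker (Submodule.mem_top (x := p))
  have hbc : ∀ p : BoundedContinuousFunction (M → ℝ) ℝ, ∫ y, p y * g y ∂(sigma M) = 0 := by
    intro p
    rw [← hcont ⟨fun y => p y, p.continuous.comp continuous_subtype_val⟩]
    refine integral_congr_ae ?_
    filter_upwards [ae_sigma_abs_le] with y hy
    simp [clip_eq hy]
  have hinner : ∀ p : BoundedContinuousFunction (M → ℝ) ℝ, 
      inner ℝ (BoundedContinuousFunction.toLp 2 (sigma M) ℝ p) (hg.toLp g) = 0 := by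
    intro p
    rw [L2.inner_def, ← hbc p]
    refine integral_congr_ae ?_
    filter_upwards [hg.coeFn_toLp, BoundedContinuousFunction.coeFn_toLp 2 (sigma M) ℝ p]
      with y h1 h2
    rw [h1, h2]
    simp [mul_comm]
  have hd := BoundedContinuousFunction.toLp_denseRange (E := ℝ) (μ := sigma M) (p := 2) ℝ (by norm_num)
  have hz : hg.toLp g = 0 := by
    refine hd.eq_zero_of_inner_left ℝ ?_
    intro p
    rw [real_inner_comm]; exact hinner p
  exact (MemLp.toLp_eq_toLp_iff hg MemLp.zero').1 (hz.trans (by rfl))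

end

/-! ### Legendre expansions of Hilbert space valued functions -/

section

variable {M : Type u} [Countable M] {E : Type*} [NormedAddCommGroup E] [InnerProductSpace ℝ E]

theorem memLp_prodLegendre_smul (ν : M →₀ ℕ) (h : E) :
    MemLp (fun y => prodLegendre ν y • h) 2 (sigma M) := by
  obtain ⟨B, -, hB⟩ := exists_abs_prodLegendre_le ν
  refine MemLp.of_bound ((continuous_prodLegendre ν).aestronglyMeasurable.smul_const h)
    (B * ‖h‖) ?_
  filter_upwards [ae_sigma_abs_le] with y hy
  rw [norm_smul]
  exact mul_le_mul_of_nonneg_right (hB y hy) (norm_nonneg h)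

theorem inner_toLp_prodLegendre_smul (ν : M →₀ ℕ) (h : E) (f : Lp E 2 (sigma M)) :
    inner ℝ ((memLp_prodLegendre_smul ν h).toLp _) f =
      ∫ y, prodLegendre ν y * inner ℝ h (f y) ∂(sigma M) := by
  rw [L2.inner_def]
  refine integral_congr_ae ?_
  filter_upwards [(memLp_prodLegendre_smul ν h).coeFn_toLp] with y hy
  rw [hy, real_inner_smul_left]

theorem inner_toLp_toLp_prodLegendre_smul (ν ν' : M →₀ ℕ) (h h' : E) [Decidable (ν = ν')] :
    inner ℝ ((memLp_prodLegendre_smul ν h).toLp _) ((memLp_prodLegendre_smul ν' h').toLp _) =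
      if ν = ν' then inner ℝ h h' else 0 := by
  rw [inner_toLp_prodLegendre_smul]
  have : ∫ y, prodLegendre ν y * inner ℝ h ((memLp_prodLegendre_smul ν' h').toLp _ y) ∂(sigma M) =
      ∫ y, (prodLegendre ν y * prodLegendre ν' y) * inner ℝ h h' ∂(sigma M) := by
    refine integral_congr_ae ?_
    filter_upwards [(memLp_prodLegendre_smul ν' h').coeFn_toLp] with y hy
    rw [hy, real_inner_smul_right]; ring
  rw [this, integral_mul_const, integral_prodLegendre_mul]
  split_ifs <;> simp

/-- The isometric embedding `h ↦ L_ν ⊗ h` of `E` into `L²(Y, E, σ)`. -/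
def legendreTensor (ν : M →₀ ℕ) : E →ₗᵢ[ℝ] Lp E 2 (sigma M) :=
  LinearMap.isometryOfInner
    { toFun := fun h => (memLp_prodLegendre_smul ν h).toLp _
      map_add' := fun h h' => by
        rw [← MemLp.toLp_add]
        congr 1
        ext y; simp [smul_add]
      map_smul' := fun r h => by
        rw [RingHom.id_apply, ← MemLp.toLp_const_smul]
        congr 1
        ext y; simp [smul_comm r] }
    fun h h' => by
      classical
      exact (inner_toLp_toLp_prodLegendre_smul ν ν h h').trans (if_pos rfl)

theorem legendreTensor_apply (ν : M →₀ ℕ) (h : E) :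
    legendreTensor ν h = (memLp_prodLegendre_smul ν h).toLp _ := rfl

theorem coeFn_legendreTensor (ν : M →₀ ℕ) (h : E) :
    legendreTensor ν h =ᵐ[sigma M] fun y => prodLegendre ν y • h :=
  (memLp_prodLegendre_smul ν h).coeFn_toLp

/-- The Legendre coefficients of `f ∈ L²(Y, E, σ)`. -/
def legendreCoeff (f : Lp E 2 (sigma M)) (ν : M →₀ ℕ) : E := ∫ y, prodLegendre ν y • f y ∂(sigma M)

theorem integrable_prodLegendre_smul (f : Lp E 2 (sigma M)) (ν : M →₀ ℕ) :
    Integrable (fun y => prodLegendre ν y • f y) (sigma M) := by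
  obtain ⟨B, -, hB⟩ := exists_abs_prodLegendre_le ν
  refine ((Lp.memLp f).integrable (by norm_num)).bdd_smul B
    (continuous_prodLegendre ν).aestronglyMeasurable ?_
  filter_upwards [ae_sigma_abs_le] with y hy
  exact hB y hy

variable [CompleteSpace E]

theorem inner_legendreCoeff (f : Lp E 2 (sigma M)) (ν : M →₀ ℕ) (h : E) :
    inner ℝ h (legendreCoeff f ν) = inner ℝ (legendreTensor ν h) f := by
  rw [legendreTensor_apply, inner_toLp_prodLegendre_smul, legendreCoeff,
    ← integral_inner (integrable_prodLegendre_smul f ν)]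
  simp_rw [real_inner_smul_right]

variable [SecondCountableTopology E]

/-- An element orthogonal to all tensors has scalar components `⟨h, f(y)⟩` with vanishing Legendre
coefficients. Each component is zero almost everywhere, and separability of `E` makes the
exceptional set independent of `h`. -/
theorem isHilbertSum_legendreTensor :
    IsHilbertSum ℝ (fun _ : M →₀ ℕ => E) (legendreTensor (M := M) (E := E)) := by
  classical
  refine IsHilbertSum.mk (fun ν ν' hne h h' => ?_) ?_
  · exact (inner_toLp_toLp_prodLegendre_smul ν ν' h h').trans (if_neg hne)
  · rw [top_le_iff, Submodule.topologicalClosure_eq_top_iff, Submodule.eq_bot_iff]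
    intro f hf
    have h0 : ∀ (ν : M →₀ ℕ) (h : E), inner ℝ (legendreTensor ν h) f = 0 := fun ν h =>
      hf _ (Submodule.mem_iSup_of_mem ν ⟨h, rfl⟩)
    have h1 : ∀ h : E, (fun y => inner ℝ h (f y)) =ᵐ[sigma M] 0 := fun h =>
      ae_eq_zero_of_integral_prodLegendre_mul ((Lp.memLp f).const_inner h) fun ν => by
        rw [← inner_toLp_prodLegendre_smul]; exact h0 ν h
    exact (Lp.eq_zero_iff_ae_eq_zero).2 (ae_eq_zero_of_forall_inner (𝕜 := ℝ) h1)

theorem hasSum_legendreTensor (f : Lp E 2 (sigma M)) :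
    HasSum (fun ν => legendreTensor ν (legendreCoeff f ν)) f := by
  classical
  have hV := isHilbertSum_legendreTensor (M := M) (E := E)
  have h1 := hV.hasSum_linearIsometryEquiv_symm (hV.linearIsometryEquiv f)
  rw [LinearIsometryEquiv.symm_apply_apply] at h1
  have h2 : ∀ ν, legendreCoeff f ν = hV.linearIsometryEquiv f ν := by
    intro ν
    refine ext_inner_left ℝ fun h => ?_
    rw [inner_legendreCoeff]
    have h3 := ((innerSL ℝ (legendreTensor ν h)).hasSum h1).tsum_eq
    simp only [innerSL_apply_apply] at h3
    rw [← h3, tsum_eq_single ν]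
    · exact (inner_toLp_toLp_prodLegendre_smul ν ν h _).trans (if_pos rfl)
    · intro ν' hne
      exact (inner_toLp_toLp_prodLegendre_smul ν ν' h _).trans (if_neg hne.symm)
  simpa only [h2] using h1

theorem hasSum_norm_legendreCoeff_sq (f : Lp E 2 (sigma M)) :
    HasSum (fun ν => ‖legendreCoeff f ν‖ ^ 2) (‖f‖ ^ 2) := by
  have h := (innerSL ℝ f).hasSum (hasSum_legendreTensor f)
  simp only [innerSL_apply_apply, real_inner_self_eq_norm_sq] at h
  refine h.congr_fun fun ν => ?_
  rw [real_inner_comm, ← inner_legendreCoeff, real_inner_self_eq_norm_sq]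

end

/-! ### Forms given by a bounded kernel -/

section

variable {X : Type*} [MeasurableSpace X] {μX : Measure X}
  {Ω : Type*} [MeasurableSpace Ω]
  {F : Type*} [NormedAddCommGroup F] [InnerProductSpace ℝ F]

/-- A jointly measurable kernel bounded by `A`. -/
structure IsBoundedKernel (a : X → Ω → ℝ) (A : ℝ) : Prop where
  measurable : Measurable (Function.uncurry a)
  abs_le : ∀ x y, |a x y| ≤ A

variable {a : X → Ω → ℝ} {A : ℝ}

theorem IsBoundedKernel.integrable (ha : IsBoundedKernel a A) (y : Ω) (h h' : Lp F 2 μX) :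
    Integrable (fun x => a x y * inner ℝ (h x) (h' x)) μX := by
  refine (L2.integrable_inner (𝕜 := ℝ) h h').bdd_mul (c := A)
    (ha.measurable.comp measurable_prodMk_right).aestronglyMeasurable ?_
  exact .of_forall fun x => ha.abs_le x y

theorem Lp.integrable_norm_mul_norm {α E : Type*} [MeasurableSpace α] {μ : Measure α}
    [NormedAddCommGroup E] (f g : Lp E 2 μ) :
    Integrable (fun x => ‖f x‖ * ‖g x‖) μ ∧ ∫ x, ‖f x‖ * ‖g x‖ ∂μ ≤ ‖f‖ * ‖g‖ := by
  have hf := (Lp.memLp f).norm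
  have hg := (Lp.memLp g).norm
  refine ⟨hf.integrable_mul hg, ?_⟩
  have h1 : inner ℝ (hf.toLp _) (hg.toLp _) = ∫ x, ‖f x‖ * ‖g x‖ ∂μ := by
    rw [L2.inner_def]
    refine integral_congr_ae ?_
    filter_upwards [hf.coeFn_toLp, hg.coeFn_toLp] with x h1 h2
    rw [h1, h2]; simp [mul_comm]
  rw [← h1]
  refine (real_inner_le_norm _ _).trans_eq ?_
  rw [Lp.norm_toLp, Lp.norm_toLp, eLpNorm_norm, eLpNorm_norm, ← Lp.norm_def, ← Lp.norm_def]

/-- The multiplication form on `L²(X, F)` at a fixed parameter. -/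
def IsBoundedKernel.fiberForm (ha : IsBoundedKernel a A) (y : Ω) :
    Lp F 2 μX →L[ℝ] Lp F 2 μX →L[ℝ] ℝ :=
  LinearMap.mkContinuous₂
    (LinearMap.mk₂ ℝ (fun h h' => ∫ x, a x y * inner ℝ (h x) (h' x) ∂μX)
      (fun h₁ h₂ h' => by
        rw [← integral_add (ha.integrable y h₁ h') (ha.integrable y h₂ h')]
        refine integral_congr_ae ?_
        filter_upwards [Lp.coeFn_add h₁ h₂] with x hx
        rw [hx, Pi.add_apply, inner_add_left, mul_add])
      (fun r h h' => by
        rw [smul_eq_mul, ← integral_const_mul]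
        refine integral_congr_ae ?_
        filter_upwards [Lp.coeFn_smul r h] with x hx
        rw [hx, Pi.smul_apply, real_inner_smul_left]; ring)
      (fun h h₁ h₂ => by
        rw [← integral_add (ha.integrable y h h₁) (ha.integrable y h h₂)]
        refine integral_congr_ae ?_
        filter_upwards [Lp.coeFn_add h₁ h₂] with x hx
        rw [hx, Pi.add_apply, inner_add_right, mul_add])
      (fun r h h' => by
        rw [smul_eq_mul, ← integral_const_mul]
        refine integral_congr_ae ?_
        filter_upwards [Lp.coeFn_smul r h'] with x hx
        rw [hx, Pi.smul_apply, real_inner_smul_right]; ring))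
    |A| fun h h' => by
      obtain ⟨h1, h2⟩ := Lp.integrable_norm_mul_norm h h'
      rw [LinearMap.mk₂_apply, mul_assoc]
      refine (norm_integral_le_of_norm_le (h1.const_mul |A|) (.of_forall fun x => ?_)).trans ?_
      · rw [norm_mul]
        exact mul_le_mul ((ha.abs_le x y).trans (le_abs_self A)) (norm_inner_le_norm _ _)
          (norm_nonneg _) (abs_nonneg _)
      · rw [integral_const_mul]
        exact mul_le_mul_of_nonneg_left h2 (abs_nonneg _)

theorem IsBoundedKernel.fiberForm_apply (ha : IsBoundedKernel a A) (y : Ω) (h h' : Lp F 2 μX) :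
    ha.fiberForm y h h' = ∫ x, a x y * inner ℝ (h x) (h' x) ∂μX := rfl

theorem IsBoundedKernel.abs_fiberForm_le (ha : IsBoundedKernel a A) (y : Ω) (h h' : Lp F 2 μX) :
    ‖ha.fiberForm y h h'‖ ≤ |A| * (‖h‖ * ‖h'‖) := by
  rw [← mul_assoc]
  refine ContinuousLinearMap.le_of_opNorm₂_le_of_le _ ?_ le_rfl le_rfl
  exact LinearMap.mkContinuous₂_norm_le _ (abs_nonneg _) _

variable {σ : Measure Ω}

/-- The fibre form is a Carathéodory function: continuous in the pair of vectors, measurable in the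
parameter. It is therefore jointly measurable and can be composed with `y ↦ (f y, g y, y)`. -/
theorem IsBoundedKernel.aestronglyMeasurable_fiberForm [SFinite μX] [SecondCountableTopology (Lp F 2 μX)]
    (ha : IsBoundedKernel a A) (f g : Lp (Lp F 2 μX) 2 σ) :
    AEStronglyMeasurable (fun y => ha.fiberForm y (f y) (g y)) σ := by
  let _ : MeasurableSpace (Lp F 2 μX) := borel _
  have : BorelSpace (Lp F 2 μX) := ⟨rfl⟩
  have hc : ∀ y, Continuous fun p : Lp F 2 μX × Lp F 2 μX => ha.fiberForm y p.1 p.2 := fun y =>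
    ((ha.fiberForm y).continuous.comp continuous_fst).clm_apply continuous_snd
  have h1 := stronglyMeasurable_uncurry_of_continuous_of_stronglyMeasurable
    (u := fun (p : Lp F 2 μX × Lp F 2 μX) (y : Ω) => ha.fiberForm y p.1 p.2)
    hc (fun p => by
      simp only [ha.fiberForm_apply]
      refine StronglyMeasurable.integral_prod_right' (ν := μX)
        (f := fun q : Ω × X => a q.2 q.1 * inner ℝ (p.1 q.2) (p.2 q.2)) ?_
      refine (ha.measurable.comp measurable_swap).stronglyMeasurable.mul ?_
      exact ((Lp.stronglyMeasurable p.1).comp_measurable measurable_snd).inner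
        ((Lp.stronglyMeasurable p.2).comp_measurable measurable_snd))
  have h2 : Measurable fun y => ((f y, g y), y) :=
    ((Lp.stronglyMeasurable f).measurable.prodMk (Lp.stronglyMeasurable g).measurable).prodMk
      measurable_id
  exact (h1.comp_measurable h2).aestronglyMeasurable

/-- The form `∫_Ω b(y)(f(y), g(y)) dσ(y)` on `L²(Ω, H)` for bounded bilinear forms `b(y)`. -/
def integratedForm {H : Type*} [NormedAddCommGroup H] [NormedSpace ℝ H]
    (b : Ω → H →L[ℝ] H →L[ℝ] ℝ) (A : ℝ) (hA : 0 ≤ A)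
    (hb : ∀ y h h', ‖b y h h'‖ ≤ A * (‖h‖ * ‖h'‖))
    (hm : ∀ f g : Lp H 2 σ, AEStronglyMeasurable (fun y => b y (f y) (g y)) σ) :
    Lp H 2 σ →L[ℝ] Lp H 2 σ →L[ℝ] ℝ :=
  have hint : ∀ f g : Lp H 2 σ, Integrable (fun y => b y (f y) (g y)) σ := fun f g =>
    ((Lp.integrable_norm_mul_norm f g).1.const_mul A).mono' (hm f g)
      (.of_forall fun y => hb y _ _)
  LinearMap.mkContinuous₂
    (LinearMap.mk₂ ℝ (fun f g => ∫ y, b y (f y) (g y) ∂σ)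
      (fun f₁ f₂ g => by
        rw [← integral_add (hint f₁ g) (hint f₂ g)]
        refine integral_congr_ae ?_
        filter_upwards [Lp.coeFn_add f₁ f₂] with y hy
        rw [hy, Pi.add_apply, map_add, add_apply])
      (fun r f g => by
        rw [smul_eq_mul, ← integral_const_mul]
        refine integral_congr_ae ?_
        filter_upwards [Lp.coeFn_smul r f] with y hy
        rw [hy, Pi.smul_apply, map_smul, smul_apply, smul_eq_mul])
      (fun f g₁ g₂ => by
        rw [← integral_add (hint f g₁) (hint f g₂)]
        refine integral_congr_ae ?_
        filter_upwards [Lp.coeFn_add g₁ g₂] with y hy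
        rw [hy, Pi.add_apply, map_add])
      (fun r f g => by
        rw [smul_eq_mul, ← integral_const_mul]
        refine integral_congr_ae ?_
        filter_upwards [Lp.coeFn_smul r g] with y hy
        rw [hy, Pi.smul_apply, map_smul, smul_eq_mul]))
    A fun f g => by
      obtain ⟨h1, h2⟩ := Lp.integrable_norm_mul_norm f g
      rw [LinearMap.mk₂_apply, mul_assoc]
      refine (norm_integral_le_of_norm_le (h1.const_mul A) (.of_forall fun y => hb y _ _)).trans ?_
      rw [integral_const_mul]
      exact mul_le_mul_of_nonneg_left h2 hA

/-- The form `∫_Ω ∫_X a f · g` on `L²(Ω, L²(X, F))`. -/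
def IsBoundedKernel.form [SFinite μX] [SecondCountableTopology (Lp F 2 μX)]
    (ha : IsBoundedKernel a A) (σ : Measure Ω) :
    Lp (Lp F 2 μX) 2 σ →L[ℝ] Lp (Lp F 2 μX) 2 σ →L[ℝ] ℝ :=
  integratedForm ha.fiberForm |A| (abs_nonneg A) ha.abs_fiberForm_le
    ha.aestronglyMeasurable_fiberForm

theorem IsBoundedKernel.form_apply [SFinite μX] [SecondCountableTopology (Lp F 2 μX)]
    (ha : IsBoundedKernel a A) (f g : Lp (Lp F 2 μX) 2 σ) :
    ha.form σ f g = ∫ y, ∫ x, a x y * inner ℝ (f y x) (g y x) ∂μX ∂σ := rfl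

end

/-! ### Legendre expansion of kernel forms -/

section

variable {X : Type*} [MeasurableSpace X] {μX : Measure X} [SFinite μX] {M : Type u} [Countable M]
  {F : Type*} [NormedAddCommGroup F] [InnerProductSpace ℝ F]
  [SecondCountableTopology (Lp F 2 μX)] {a : X → (M → ℝ) → ℝ} {A : ℝ}

theorem IsBoundedKernel.form_legendreTensor (ha : IsBoundedKernel a A) (ν ν' : M →₀ ℕ)
    (h h' : Lp F 2 μX) :
    ha.form (sigma M) (legendreTensor ν' h) (legendreTensor ν h') =
      ∫ x, (∫ y, a x y * prodLegendre ν y * prodLegendre ν' y ∂(sigma M)) *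
        inner ℝ (h x) (h' x) ∂μX := by
  have h1 : ha.form (sigma M) (legendreTensor ν' h) (legendreTensor ν h') =
      ∫ y, ∫ x, a x y * prodLegendre ν y * prodLegendre ν' y * inner ℝ (h x) (h' x) ∂μX
        ∂(sigma M) := by
    change ∫ y, ha.fiberForm y _ _ ∂(sigma M) = _
    refine integral_congr_ae ?_
    filter_upwards [coeFn_legendreTensor ν' h, coeFn_legendreTensor ν h'] with y hy hy'
    rw [hy, hy', map_smul, map_smul, smul_apply, smul_eq_mul, smul_eq_mul,
      ha.fiberForm_apply, ← integral_const_mul, ← integral_const_mul]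
    refine integral_congr_ae (.of_forall fun x => ?_)
    ring
  rw [h1, integral_integral_swap]
  · simp_rw [integral_mul_const]
  · have h2 : Integrable (fun y => prodLegendre ν y * prodLegendre ν' y) (sigma M) :=
      ((memLp_top_prodLegendre ν).mono_exponent le_top : MemLp _ 2 _).integrable_mul
        ((memLp_top_prodLegendre ν').mono_exponent le_top : MemLp _ 2 _)
    have h3 := h2.mul_prod (L2.integrable_inner (𝕜 := ℝ) h h')
    have h4 := h3.bdd_mul (f := fun q : (M → ℝ) × X => a q.2 q.1) (c := A)
      (ha.measurable.comp measurable_swap).aestronglyMeasurable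
      (.of_forall fun q => ha.abs_le q.2 q.1)
    refine h4.congr (.of_forall fun q => ?_)
    simp only [Function.uncurry]
    ring

/-- Continuity gives convergence along rectangles of partial sums. Summability over pairs identifies
that limit with the unordered double sum. -/
theorem apply_eq_tsum_of_hasSum {ι H : Type*} [NormedAddCommGroup H] [NormedSpace ℝ H]
    (T : H →L[ℝ] H →L[ℝ] ℝ) {u v : ι → H} {f g : H} (hu : HasSum u f) (hv : HasSum v g)
    (hs : Summable fun p : ι × ι => T (u p.2) (v p.1)) :
    T f g = ∑' p : ι × ι, T (u p.2) (v p.1) := by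
  classical
  have h1 := hs.hasSum.comp Filter.tendsto_finsetProd_atTop
  have h2 : Filter.Tendsto (fun p : Finset ι × Finset ι =>
      T (∑ j ∈ p.2, u j) (∑ i ∈ p.1, v i)) Filter.atTop (nhds (T f g)) := by
    rw [← Filter.prod_atTop_atTop_eq]
    exact (T.isBoundedBilinearMap.continuous.tendsto (f, g)).comp
      ((hu.comp Filter.tendsto_snd).prodMk_nhds (hv.comp Filter.tendsto_fst))
  refine tendsto_nhds_unique h2 (h1.congr fun p => ?_)
  simp only [Function.comp, map_sum, sum_apply]
  rw [Finset.sum_product, Finset.sum_comm]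

theorem IsBoundedKernel.form_eq_tsum [CompleteSpace F] (ha : IsBoundedKernel a A) (f g : Lp (Lp F 2 μX) 2 (sigma M))
    (hs : Summable fun p : (M →₀ ℕ) × (M →₀ ℕ) =>
      ∫ x, (∫ y, a x y * prodLegendre p.1 y * prodLegendre p.2 y ∂(sigma M)) *
        inner ℝ (legendreCoeff f p.2 x) (legendreCoeff g p.1 x) ∂μX) :
    ha.form (sigma M) f g = ∑' p : (M →₀ ℕ) × (M →₀ ℕ),
      ∫ x, (∫ y, a x y * prodLegendre p.1 y * prodLegendre p.2 y ∂(sigma M)) *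
        inner ℝ (legendreCoeff f p.2 x) (legendreCoeff g p.1 x) ∂μX := by
  have hp := fun p : (M →₀ ℕ) × (M →₀ ℕ) =>
    ha.form_legendreTensor p.1 p.2 (legendreCoeff f p.2) (legendreCoeff g p.1)
  rw [apply_eq_tsum_of_hasSum (ha.form (sigma M)) (hasSum_legendreTensor f)
    (hasSum_legendreTensor g) (hs.congr fun p => (hp p).symm)]
  exact tsum_congr hp

end

/-! ### Level sums and costs -/

section

variable {M : Type u}

theorem absDiff_apply (ν ν' : M →₀ ℕ) (μ : M) : absDiff ν ν' μ = Nat.dist (ν μ) (ν' μ) := rfl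

theorem absDiff_comm (ν ν' : M →₀ ℕ) : absDiff ν ν' = absDiff ν' ν := by
  ext μ; simp only [absDiff_apply, Nat.dist_comm]

theorem absDiff_zero_left (ν : M →₀ ℕ) : absDiff 0 ν = ν := by
  ext μ; simp [absDiff_apply, Nat.dist]

/-- The sequence `(∑_{lev μ = ℓ} |ν_μ - ν'_μ|)_ℓ`. -/
def levelDiff (lev : M → ℕ) (ν ν' : M →₀ ℕ) : ℕ →₀ ℕ := (absDiff ν ν').mapDomain lev

theorem levelDiff_comm (lev : M → ℕ) (ν ν' : M →₀ ℕ) : levelDiff lev ν ν' = levelDiff lev ν' ν := by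
  rw [levelDiff, absDiff_comm, levelDiff]

theorem levelDiff_apply (lev : M → ℕ) (ν ν' : M →₀ ℕ) (ℓ : ℕ) :
    levelDiff lev ν ν' ℓ = (absDiff ν ν').sum fun μ n => if lev μ = ℓ then n else 0 := by
  classical
  rw [levelDiff, Finsupp.mapDomain, Finsupp.sum_apply]
  simp only [Finsupp.single_apply]

theorem lev_mem_support {lev : M → ℕ} {ν ν' : M →₀ ℕ} {μ : M}
    (hμ : μ ∈ (absDiff ν ν').support) : lev μ ∈ (levelDiff lev ν ν').support := by
  rw [Finsupp.mem_support_iff, levelDiff_apply, Finsupp.sum]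
  refine (lt_of_lt_of_le (Nat.pos_of_ne_zero (Finsupp.mem_support_iff.1 hμ)) ?_).ne'
  refine le_trans ?_ (Finset.single_le_sum (f := fun μ' => if lev μ' = lev μ then
    absDiff ν ν' μ' else 0) (fun _ _ => Nat.zero_le _) hμ)
  simp

theorem exists_mem_support {lev : M → ℕ} {ν ν' : M →₀ ℕ} {ℓ : ℕ}
    (hℓ : ℓ ∈ (levelDiff lev ν ν').support) : ∃ μ ∈ (absDiff ν ν').support, lev μ = ℓ := by
  classical
  have := Finsupp.mapDomain_support hℓ
  simpa using this

/-- The levels on which `ν'` exceeds `ν` somewhere. -/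
def upperLevels (lev : M → ℕ) (ν ν' : M →₀ ℕ) : Finset ℕ :=
  ((absDiff ν ν').support.filter fun μ => ν μ < ν' μ).image lev

theorem upperLevels_subset (lev : M → ℕ) (ν ν' : M →₀ ℕ) :
    upperLevels lev ν ν' ⊆ (levelDiff lev ν ν').support := by
  intro ℓ hℓ
  obtain ⟨μ, hμ, rfl⟩ := Finset.mem_image.1 hℓ
  exact lev_mem_support (Finset.mem_filter.1 hμ).1

/-- When levels label the changed indices injectively, the level sums determine the absolute values
`|ν_μ - ν'_μ|` and the upper levels determine the signs. -/
theorem eq_of_levelDiff_eq {lev : M → ℕ} {ν ν₁ ν₂ : M →₀ ℕ}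
    (hlev : levelDiff lev ν ν₁ = levelDiff lev ν ν₂)
    (hup : upperLevels lev ν ν₁ = upperLevels lev ν ν₂) {T : Set M} (hT : InjOn lev T)
    (h₁ : ↑(absDiff ν ν₁).support ⊆ T) (h₂ : ↑(absDiff ν ν₂).support ⊆ T) : ν₁ = ν₂ := by
  have he : absDiff ν ν₁ = absDiff ν ν₂ := Finsupp.mapDomain_injOn T hT h₁ h₂ hlev
  have key : ∀ {ν₁ ν₂ : M →₀ ℕ}, absDiff ν ν₁ = absDiff ν ν₂ →
      upperLevels lev ν ν₁ = upperLevels lev ν ν₂ → ↑(absDiff ν ν₁).support ⊆ T →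
      ∀ μ, ν μ < ν₁ μ → ν μ < ν₂ μ := by
    intro ν₁ ν₂ he hup h₁ μ hμ
    have hs : μ ∈ (absDiff ν ν₁).support := by
      rw [Finsupp.mem_support_iff, absDiff_apply, Nat.dist]; omega
    have h3 : lev μ ∈ upperLevels lev ν ν₂ := by
      rw [← hup]
      exact Finset.mem_image_of_mem _ (Finset.mem_filter.2 ⟨hs, hμ⟩)
    obtain ⟨μ', hμ', hl⟩ := Finset.mem_image.1 h3
    obtain ⟨h4, h5⟩ := Finset.mem_filter.1 hμ'
    rw [← he] at h4
    rwa [hT (h₁ h4) (h₁ hs) hl] at h5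
  ext μ
  have h3 := key he hup h₁ μ
  have h4 := key he.symm hup.symm h₂ μ
  have h5 := DFunLike.congr_fun he μ
  rw [absDiff_apply, absDiff_apply, Nat.dist, Nat.dist] at h5
  omega

end

/-! ### Interaction sets, cost bounds and level points -/

section

variable {d : ℕ} {D : Set (Space d)} {M : Type u} {θ₀ : Space d → ℝ} {θ : M → Space d → ℝ}
  {lev : M → ℕ} {α C' : ℝ} {Q : ℕ}

theorem mem_interactionSet {k : ℕ →₀ ℕ} {ν ν' : M →₀ ℕ} :
    ν' ∈ interactionSet D θ lev k ν ↔ levelDiff lev ν ν' = k ∧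
      ¬ ((fun x => ∏ μ ∈ (absDiff ν ν').support, θ μ x) =ᵐ[volume.restrict D] 0) := by
  rw [interactionSet, mem_ofPred_eq, Finsupp.ext_iff]
  simp only [levelDiff_apply]

/-- The indices that contribute to an interaction have pairwise nonzero products. -/
theorem mul_not_ae_eq_zero {k : ℕ →₀ ℕ} {ν ν' : M →₀ ℕ} (h : ν' ∈ interactionSet D θ lev k ν)
    {μ μ' : M} (hμ : μ ∈ (absDiff ν ν').support) (hμ' : μ' ∈ (absDiff ν ν').support) :
    ¬ ((fun x => θ μ x * θ μ' x) =ᵐ[volume.restrict D] 0) := by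
  intro h0
  refine (mem_interactionSet.1 h).2 ?_
  filter_upwards [h0] with x hx
  rcases mul_eq_zero.1 hx with h1 | h1
  · exact Finset.prod_eq_zero hμ h1
  · exact Finset.prod_eq_zero hμ' h1

theorem IsLevelAssignment.injOn_support (h : IsLevelAssignment D θ α Q C' lev) {k : ℕ →₀ ℕ}
    {ν ν' : M →₀ ℕ} (hν : ν' ∈ interactionSet D θ lev k ν) :
    InjOn lev (absDiff ν ν').support := by
  intro μ hμ μ' hμ' heq
  by_contra hne
  exact mul_not_ae_eq_zero hν hμ hμ' (h.disjoint_same μ μ' heq hne)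

/-- An interacting `ν'` changes exactly one index on the top level `m`. All other changed indices
have nonzero product with it, so `unique_lower` leaves one candidate per lower level. What remains
free is the top index and a sign on each level of `k`. -/
theorem IsLevelAssignment.encard_interactionSet_le (h : IsLevelAssignment D θ α Q C' lev)
    {k : ℕ →₀ ℕ} (hk : k ≠ 0) (ν : M →₀ ℕ) :
    (interactionSet D θ lev k ν).encard ≤
      (({μ | lev μ = k.support.sup id}.ncard * 2 ^ k.support.card : ℕ) : ℕ∞) := by
  classical
  set m := k.support.sup id with hm
  have hmem : m ∈ k.support := by
    obtain ⟨i, hi, hi'⟩ := Finset.exists_mem_eq_sup k.support (Finsupp.support_nonempty_iff.2 hk) id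
    rw [hm, hi']; exact hi
  have hle : ∀ ℓ ∈ k.support, ℓ ≤ m := fun ℓ hℓ => Finset.le_sup (f := id) hℓ
  have hex : ∀ ν' ∈ interactionSet D θ lev k ν, ∃ μ ∈ (absDiff ν ν').support, lev μ = m := by
    intro ν' hν'
    refine exists_mem_support ?_
    rw [(mem_interactionSet.1 hν').1]; exact hmem
  rcases (interactionSet D θ lev k ν).eq_empty_or_nonempty with h0 | ⟨ν₀, hν₀⟩
  · rw [h0, encard_empty]; exact zero_le
  -- Nonemptiness supplies the default value that makes `top` a total function.
  have hM : Nonempty M := ⟨(hex ν₀ hν₀).choose⟩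
  choose! top htop htop' using hex
  have hinj : InjOn (fun ν' => (top ν', upperLevels lev ν ν')) (interactionSet D θ lev k ν) := by
    intro ν₁ h₁ ν₂ h₂ heq
    rw [Prod.mk.injEq] at heq
    obtain ⟨ht, hu⟩ := heq
    have hl₁ := (mem_interactionSet.1 h₁).1
    have hl₂ := (mem_interactionSet.1 h₂).1
    have cross : ∀ μ₁ ∈ (absDiff ν ν₁).support, ∀ μ₂ ∈ (absDiff ν ν₂).support,
        lev μ₁ = lev μ₂ → μ₁ = μ₂ := by
      intro μ₁ hμ₁ μ₂ hμ₂ hl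
      have hlm : lev μ₁ ≤ m := hle _ (hl₁ ▸ lev_mem_support hμ₁)
      rcases hlm.eq_or_lt with h0 | h0
      · rw [h.injOn_support h₁ hμ₁ (htop _ h₁) (h0.trans (htop' _ h₁).symm),
          h.injOn_support h₂ hμ₂ (htop _ h₂) (hl ▸ h0.trans (htop' _ h₂).symm), ht]
      · refine h.unique_lower (top ν₁) (lev μ₁) ((htop' _ h₁).symm ▸ h0)
          ⟨rfl, mul_not_ae_eq_zero h₁ (htop _ h₁) hμ₁⟩ ⟨hl.symm, ?_⟩
        rw [ht]
        exact mul_not_ae_eq_zero h₂ (htop _ h₂) hμ₂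
    refine eq_of_levelDiff_eq (hl₁.trans hl₂.symm) hu
      (T := ↑(absDiff ν ν₁).support ∪ ↑(absDiff ν ν₂).support) ?_ subset_union_left
      subset_union_right
    rintro μ₁ (hμ₁ | hμ₁) μ₂ (hμ₂ | hμ₂) hl
    · exact h.injOn_support h₁ hμ₁ hμ₂ hl
    · exact cross _ hμ₁ _ hμ₂ hl
    · exact (cross _ hμ₂ _ hμ₁ hl.symm).symm
    · exact h.injOn_support h₂ hμ₁ hμ₂ hl
  have hmaps : MapsTo (fun ν' => (top ν', upperLevels lev ν ν')) (interactionSet D θ lev k ν)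
      (((h.finite_level m).toFinset ×ˢ k.support.powerset : Finset (M × Finset ℕ)) :
        Set (M × Finset ℕ)) := by
    intro ν' hν'
    simp only [Finset.coe_product, mem_prod, Finite.coe_toFinset, mem_ofPred_eq, Finset.mem_coe,
      Finset.mem_powerset]
    refine ⟨htop' _ hν', ?_⟩
    have := upperLevels_subset lev ν ν'
    rwa [(mem_interactionSet.1 hν').1] at this
  refine (encard_le_encard_of_injOn hmaps hinj).trans_eq ?_
  rw [encard_coe_eq_coe_finsetCard, Finset.card_product, Finset.card_powerset,
    ← Set.ncard_eq_toFinset_card _ (h.finite_level m)]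

theorem encard_interactionSet_zero_le (ν : M →₀ ℕ) :
    (interactionSet D θ lev 0 ν).encard ≤ 1 := by
  rw [encard_le_one_iff]
  have h0 : ∀ ν' ∈ interactionSet D θ lev 0 ν, ν' = ν := by
    intro ν' hν'
    have h1 := (mem_interactionSet.1 hν').1
    ext μ
    by_contra hne
    have h2 : μ ∈ (absDiff ν ν').support := by
      rw [Finsupp.mem_support_iff, absDiff_apply, Nat.dist]; omega
    have := lev_mem_support (lev := lev) h2
    rw [h1] at this
    simp at this
  exact fun ν₁ ν₂ h₁ h₂ => (h0 ν₁ h₁).trans (h0 ν₂ h₂).symm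

theorem IsLevelAssignment.exists_cost_eq (h : IsLevelAssignment D θ α Q C' lev) {Cb : ℝ}
    (hCb : 1 ≤ Cb) (hC' : C' ≤ Cb) (k : ℕ →₀ ℕ) : ∃ n : ℕ, cost D θ lev k = n ∧
      (n : ℝ) ≤ Cb * 2 ^ k.support.card * ((2 : ℝ) ^ ((d : ℝ) / Q)) ^ (k.support.sup id) := by
  rcases eq_or_ne k 0 with rfl | hk
  · have h1 : cost D θ lev 0 ≤ ((1 : ℕ) : ℕ∞) :=
      iSup_le fun ν => encard_interactionSet_zero_le ν
    obtain ⟨n, hn, hn'⟩ := ENat.le_natCast_iff.1 h1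
    refine ⟨n, hn, ?_⟩
    have : (n : ℝ) ≤ 1 := by exact_mod_cast hn'
    simpa using this.trans hCb
  · have h1 : cost D θ lev k ≤ _ := iSup_le fun ν => h.encard_interactionSet_le hk ν
    obtain ⟨n, hn, hn'⟩ := ENat.le_natCast_iff.1 h1
    refine ⟨n, hn, ?_⟩
    have h2 : (n : ℝ) ≤ ({μ | lev μ = k.support.sup id}.ncard : ℝ) * 2 ^ k.support.card := by
      exact_mod_cast hn'
    have h3 := h.card_level (k.support.sup id)
    rw [Real.rpow_mul_natCast (by norm_num)] at h3
    calc (n : ℝ) ≤ _ := h2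
      _ ≤ (Cb * ((2 : ℝ) ^ ((d : ℝ) / Q)) ^ (k.support.sup id)) * 2 ^ k.support.card := by
        refine mul_le_mul_of_nonneg_right (h3.trans ?_) (by positivity)
        gcongr
      _ = _ := by ring

/-- The witness is the pair `ν = 0`, `ν' = n e_μ`. For `n = 0` the product over changed indices is
empty, equal to 1, and nonzero because `D` has positive measure. -/
theorem one_le_cost_single (n : ℕ) {μ : M} (hD : IsOpen D) (hne : D.Nonempty)
    (hμ : ¬ (θ μ =ᵐ[volume.restrict D] 0)) : 1 ≤ cost D θ lev (Finsupp.single (lev μ) n) := by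
  refine le_trans ?_ (le_iSup _ (0 : M →₀ ℕ))
  rw [one_le_encard_iff_nonempty]
  refine ⟨Finsupp.single μ n, mem_interactionSet.2 ⟨?_, fun h0 => ?_⟩⟩
  · rw [levelDiff, absDiff_zero_left, Finsupp.mapDomain_single]
  · rw [absDiff_zero_left] at h0
    rcases Nat.eq_zero_or_pos n with rfl | hn
    · have h1 : ∀ᵐ x ∂(volume.restrict D), False := by
        filter_upwards [h0] with x hx
        simp at hx
      rw [Filter.eventually_false_iff_eq_bot, ae_eq_bot, Measure.restrict_eq_zero] at h1
      exact (hD.measure_pos volume hne).ne' h1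
    · rw [Finsupp.support_single _ hn.ne'] at h0
      simp only [Finset.prod_singleton] at h0
      exact hμ h0

theorem one_le_cost_zero (hD : IsOpen D) (hne : D.Nonempty) : 1 ≤ cost D θ lev 0 := by
  refine le_trans ?_ (le_iSup _ (0 : M →₀ ℕ))
  rw [one_le_encard_iff_nonempty]
  refine ⟨0, mem_interactionSet.2 ⟨?_, fun h0 => ?_⟩⟩
  · rw [levelDiff, absDiff_zero_left, Finsupp.mapDomain_zero]
  · rw [absDiff_zero_left] at h0
    have h1 : ∀ᵐ x ∂(volume.restrict D), False := by
      filter_upwards [h0] with x hx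
      simp at hx
    rw [Filter.eventually_false_iff_eq_bot, ae_eq_bot, Measure.restrict_eq_zero] at h1
    exact (hD.measure_pos volume hne).ne' h1

theorem cost_eq_zero_of_isEmpty [IsEmpty M] {k : ℕ →₀ ℕ} (hk : k ≠ 0) : cost D θ lev k = 0 := by
  rw [cost, ENat.iSup_eq_zero]
  intro ν
  rw [encard_eq_zero, eq_empty_iff_forall_notMem]
  intro ν' hν'
  refine hk ?_
  rw [← (mem_interactionSet.1 hν').1, levelDiff, Subsingleton.elim (absDiff ν ν') 0,
    Finsupp.mapDomain_zero]

/-! ### Pointwise estimates -/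

/-- The pointwise properties of the expansion functions that hold almost everywhere. -/
structure IsLevelPoint (lev : M → ℕ) (C q : ℝ) (φ : M → ℝ) : Prop where
  disjoint : ∀ μ μ', lev μ = lev μ' → μ ≠ μ' → φ μ * φ μ' = 0
  decay : ∀ μ, |φ μ| ≤ C * q ^ lev μ

theorem IsLevelPoint.injOn {C q : ℝ} {φ : M → ℝ} (h : IsLevelPoint lev C q φ) :
    InjOn lev {μ | φ μ ≠ 0} := by
  intro μ hμ μ' hμ' heq
  by_contra hne
  exact mul_ne_zero hμ hμ' (h.disjoint μ μ' heq hne)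

/-- At a level point each level carries at most one nonzero value, so the sum is dominated by a
geometric series over levels. -/
theorem IsLevelPoint.summable {C q : ℝ} {φ : M → ℝ} (h : IsLevelPoint lev C q φ) (hC : 0 ≤ C)
    (hq0 : 0 < q) (hq : q < 1) : Summable (fun μ => |φ μ|) ∧ ∑' μ, |φ μ| ≤ C * (1 - q)⁻¹ := by
  have hgeo := (hasSum_geometric_of_lt_one hq0.le hq).mul_left C
  have hle : ∀ F : Finset M, ∑ μ ∈ F, |φ μ| ≤ C * (1 - q)⁻¹ := by
    classical
    intro F
    have h1 : ∑ μ ∈ F, |φ μ| = ∑ μ ∈ F.filter (φ · ≠ 0), |φ μ| := by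
      rw [Finset.sum_filter]
      refine Finset.sum_congr rfl fun μ _ => ?_
      split_ifs with h0
      · rfl
      · rw [not_not.1 h0, abs_zero]
    have hinj : InjOn lev (F.filter (φ · ≠ 0) : Finset M) := h.injOn.mono fun μ hμ => by
      simpa using (Finset.mem_filter.1 hμ).2
    calc ∑ μ ∈ F, |φ μ| = ∑ μ ∈ F.filter (φ · ≠ 0), |φ μ| := h1
      _ ≤ ∑ μ ∈ F.filter (φ · ≠ 0), C * q ^ lev μ := Finset.sum_le_sum fun μ _ => h.decay μ
      _ = ∑ ℓ ∈ (F.filter (φ · ≠ 0)).image lev, C * q ^ ℓ := (Finset.sum_image (f := fun ℓ => C * q ^ ℓ) hinj).symm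
      _ ≤ C * (1 - q)⁻¹ := by
        rw [← hgeo.tsum_eq]
        exact hgeo.summable.sum_le_tsum _ fun _ _ => by positivity
  have hs := summable_of_sum_le (fun μ => abs_nonneg (φ μ)) hle
  exact ⟨hs, hs.tsum_le_of_sum_le hle⟩

theorem IsLevelAssignment.ae_isLevelPoint [Countable M] (h : IsLevelAssignment D θ α Q C' lev)
    {Cb : ℝ} (hC' : C' ≤ Cb) :
    ∀ᵐ x ∂(volume.restrict D), IsLevelPoint lev Cb ((2 : ℝ) ^ (-(α / Q))) fun μ => θ μ x := by
  have h1 : ∀ᵐ x ∂(volume.restrict D), ∀ μ μ', lev μ = lev μ' → μ ≠ μ' →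
      θ μ x * θ μ' x = 0 := by
    rw [ae_all_iff]; intro μ
    rw [ae_all_iff]; intro μ'
    by_cases hh : lev μ = lev μ' ∧ μ ≠ μ'
    · filter_upwards [h.disjoint_same μ μ' hh.1 hh.2] with x hx _ _
      exact hx
    · exact .of_forall fun x h1 h2 => absurd ⟨h1, h2⟩ hh
  have h2 := ae_all_iff.2 h.decay
  filter_upwards [h1, h2] with x hx1 hx2
  refine ⟨hx1, fun μ => ?_⟩
  have hf : Finite {μ' // lev μ' = lev μ} := h.finite_level (lev μ)
  have h3 : |θ μ x| ≤ ∑' μ' : {μ' // lev μ' = lev μ}, |θ μ' x| :=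
    (Summable.of_finite (f := fun μ' : {μ' // lev μ' = lev μ} => |θ μ' x|)).le_tsum ⟨μ, rfl⟩
      fun _ _ => abs_nonneg _
  refine h3.trans ((hx2 _).trans ?_)
  rw [← neg_mul, Real.rpow_mul_natCast (by norm_num)]
  gcongr

/-- A nonzero entry changes only indices with `φ μ ≠ 0`, on which levels are injective. Hence `ν'`
is determined by `k` and its upper levels, at most `2 ^ #supp k` choices, and each entry obeys the
same product bound. -/
theorem tsum_levelDiff_le {C q : ℝ} {φ : M → ℝ} (h : IsLevelPoint lev C q φ) {A : ℝ}
    (hA : 0 ≤ A) (hC : 0 ≤ C) (hq : 0 ≤ q) (ν : M →₀ ℕ) (b : (M →₀ ℕ) → ℝ)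
    (hb : ∀ ν', |b ν'| ≤ A * (absDiff ν ν').prod fun μ n => |φ μ| ^ n / n.factorial)
    (k : ℕ →₀ ℕ) :
    ∑' ν', (if levelDiff lev ν ν' = k then ‖b ν'‖ₑ else 0) ≤
      ENNReal.ofReal (A * k.prod fun ℓ n => 2 * ((C * q ^ ℓ) ^ n / n.factorial)) := by
  classical
  have hsupp : ∀ ν', b ν' ≠ 0 → ↑(absDiff ν ν').support ⊆ {μ | φ μ ≠ 0} := by
    intro ν' hν' μ hμ h0
    refine hν' (abs_eq_zero.1 (le_antisymm ((hb ν').trans_eq ?_) (abs_nonneg _)))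
    rw [Finsupp.prod, Finset.prod_eq_zero hμ, mul_zero]
    rw [h0, abs_zero, zero_pow (Finsupp.mem_support_iff.1 hμ), zero_div]
  set N := {ν' | levelDiff lev ν ν' = k ∧ b ν' ≠ 0} with hN
  have hinj : InjOn (upperLevels lev ν) N := fun ν₁ h₁ ν₂ h₂ heq =>
    eq_of_levelDiff_eq (h₁.1.trans h₂.1.symm) heq h.injOn (hsupp _ h₁.2) (hsupp _ h₂.2)
  have hmaps : MapsTo (upperLevels lev ν) N (k.support.powerset : Finset (Finset ℕ)) := by
    intro ν' hν'
    have := upperLevels_subset lev ν ν'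
    rw [hν'.1] at this
    exact Finset.mem_coe.2 (Finset.mem_powerset.2 this)
  have hfin : N.Finite := Set.Finite.of_injOn hmaps hinj (Finset.finite_toSet _)
  have hcard : hfin.toFinset.card ≤ 2 ^ k.support.card := by
    rw [← Finset.card_powerset]
    refine Finset.card_le_card_of_injOn (upperLevels lev ν) (fun ν' hν' => ?_) ?_
    · exact hmaps (by simpa using hν')
    · simpa using hinj
  rw [tsum_eq_sum (s := hfin.toFinset) (fun ν' hν' => by
    simp only [hN, Finite.mem_toFinset, mem_ofPred_eq, not_and, not_not] at hν'
    split_ifs with h0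
    · rw [hν' h0, enorm_zero]
    · rfl)]
  have hterm : ∀ ν' ∈ hfin.toFinset, (if levelDiff lev ν ν' = k then ‖b ν'‖ₑ else 0) ≤
      ENNReal.ofReal (A * k.prod fun ℓ n => (C * q ^ ℓ) ^ n / n.factorial) := by
    intro ν' hν'
    have hν : ν' ∈ N := by simpa using hν'
    rw [if_pos hν.1, Real.enorm_eq_ofReal_abs]
    refine ENNReal.ofReal_le_ofReal ((hb ν').trans (mul_le_mul_of_nonneg_left ?_ hA))
    have hi : InjOn lev (absDiff ν ν').support := h.injOn.mono (hsupp _ hν.2)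
    have hk : k = (absDiff ν ν').mapDomain lev := hν.1.symm
    rw [hk, Finsupp.prod, Finsupp.prod, Finsupp.mapDomain_support_of_injOn _ hi,
      Finset.prod_image hi]
    refine Finset.prod_le_prod (fun _ _ => by positivity) fun μ hμ => ?_
    rw [Finsupp.mapDomain_apply' _ _ Subset.rfl hi hμ]
    have := h.decay μ
    gcongr
  refine (Finset.sum_le_sum hterm).trans ?_
  rw [Finset.sum_const, nsmul_eq_mul, ← ENNReal.ofReal_natCast, ← ENNReal.ofReal_mul (by positivity)]
  refine ENNReal.ofReal_le_ofReal ?_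
  have hnn : 0 ≤ A * k.prod fun ℓ n => (C * q ^ ℓ) ^ n / n.factorial :=
    mul_nonneg hA (Finset.prod_nonneg fun _ _ => by positivity)
  calc _ ≤ (2 ^ k.support.card : ℝ) * (A * k.prod fun ℓ n => (C * q ^ ℓ) ^ n / n.factorial) :=
        mul_le_mul_of_nonneg_right (by exact_mod_cast hcard) hnn
    _ = _ := by
        rw [Finsupp.prod, Finsupp.prod, Finset.prod_mul_distrib, Finset.prod_const]; ring

theorem exists_prod_le (C : ℝ) (hC : 0 ≤ C) (t : ℝ) (ht : 0 ≤ t) :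
    ∃ K : ℝ, 2 ≤ K ∧ ∀ (D q : ℝ), 1 < D → q = D ^ (-t) → ∀ (B : ℝ), 1 ≤ B → ∀ k : ℕ →₀ ℕ,
      (k.prod fun ℓ n => 2 * ((C * q ^ ℓ) ^ n / n.factorial)) ≤
        costBound D K B k * weight D k ^ (1 + t) := by
  set m := ⌈1 + t⌉₊
  -- The factorial must absorb `n ^ (1 + t)`: it is at most `m! eⁿ`, and `(C e)ⁿ / n! ≤ exp (C e)`.
  -- The power `2 ^ (1 + t)` compensates the 2 in the weight, and the summand 2 secures `2 ≤ K`,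
  -- which `costSharp_le_costBound` needs.
  set K := 2 + 2 ^ (1 + t) * (2 * (m.factorial * Real.exp (C * Real.exp 1))) with hK
  have hKpos : 0 < K := by positivity
  refine ⟨K, le_add_of_nonneg_right (by positivity), fun D q hD hq B hB k => ?_⟩
  have hD0 : 0 < D := by linarith
  have hq0 : 0 < q := by rw [hq]; positivity
  have hq1 : q ≤ 1 := by rw [hq]; exact Real.rpow_le_one_of_one_le_of_nonpos hD.le (by linarith)
  have hfac : ∀ ℓ n : ℕ, n ≠ 0 → 2 * ((C * q ^ ℓ) ^ n / n.factorial) ≤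
      K * D ^ ℓ * ((2 * D ^ ℓ * n)⁻¹) ^ (1 + t) := by
    intro ℓ n hn
    have hn1 : (1 : ℝ) ≤ n := by exact_mod_cast Nat.one_le_iff_ne_zero.2 hn
    have hn0 : (0 : ℝ) < n := by linarith
    have h1 : ((2 * D ^ ℓ * n : ℝ)⁻¹) ^ (1 + t) =
        (2 ^ (1 + t))⁻¹ * ((D ^ ℓ)⁻¹ * q ^ ℓ) * ((n : ℝ) ^ (1 + t))⁻¹ := by
      rw [Real.inv_rpow (by positivity), Real.mul_rpow (by positivity) (by positivity),
        Real.mul_rpow (by positivity) (by positivity), mul_inv, mul_inv, hq,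
        Real.rpow_add (by positivity : (0 : ℝ) < D ^ ℓ), Real.rpow_one, mul_inv,
        ← Real.rpow_mul_natCast hD0.le, ← Real.rpow_natCast_mul hD0.le, ← Real.rpow_neg hD0.le]
      congr 4; ring
    have h2 : (n : ℝ) ^ (1 + t) ≤ m.factorial * Real.exp 1 ^ n := by
      calc (n : ℝ) ^ (1 + t) ≤ (n : ℝ) ^ (m : ℝ) :=
            Real.rpow_le_rpow_of_exponent_le hn1 (Nat.le_ceil _)
        _ = n ^ m := Real.rpow_natCast _ _
        _ ≤ m.factorial * Real.exp n := by
            have := Real.pow_div_factorial_le_exp (n : ℝ) hn0.le m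
            rw [div_le_iff₀ (by positivity)] at this
            linarith
        _ = _ := by rw [← Real.exp_nat_mul, mul_one]
    have h3 : (C * Real.exp 1) ^ n / n.factorial ≤ Real.exp (C * Real.exp 1) :=
      Real.pow_div_factorial_le_exp _ (by positivity) n
    have h4 : C ^ n / n.factorial * (n : ℝ) ^ (1 + t) ≤ m.factorial * Real.exp (C * Real.exp 1) := by
      calc C ^ n / n.factorial * (n : ℝ) ^ (1 + t)
          ≤ C ^ n / n.factorial * (m.factorial * Real.exp 1 ^ n) := by gcongr
        _ = m.factorial * ((C * Real.exp 1) ^ n / n.factorial) := by rw [mul_pow]; ring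
        _ ≤ _ := by gcongr
    have h5 : (q ^ ℓ) ^ n ≤ q ^ ℓ :=
      pow_le_of_le_one (by positivity) (pow_le_one₀ hq0.le hq1) hn
    have hnt : 0 < (n : ℝ) ^ (1 + t) := by positivity
    calc 2 * ((C * q ^ ℓ) ^ n / n.factorial)
        = 2 * (C ^ n / n.factorial * (n : ℝ) ^ (1 + t)) * (q ^ ℓ) ^ n * ((n : ℝ) ^ (1 + t))⁻¹ := by
          rw [mul_pow]; field_simp
      _ ≤ 2 * (m.factorial * Real.exp (C * Real.exp 1)) * q ^ ℓ * ((n : ℝ) ^ (1 + t))⁻¹ := by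
          gcongr
      _ ≤ (K * (2 ^ (1 + t))⁻¹) * q ^ ℓ * ((n : ℝ) ^ (1 + t))⁻¹ := by
          have h6 : 2 * (m.factorial * Real.exp (C * Real.exp 1)) ≤ K * (2 ^ (1 + t))⁻¹ := by
            rw [← div_eq_mul_inv, le_div_iff₀ (by positivity), hK]
            linarith
          exact mul_le_mul_of_nonneg_right (mul_le_mul_of_nonneg_right h6 (by positivity))
            (by positivity)
      _ = _ := by rw [h1]; field_simp
  calc (k.prod fun ℓ n => 2 * ((C * q ^ ℓ) ^ n / n.factorial))
      ≤ k.prod fun ℓ n => K * D ^ ℓ * ((2 * D ^ ℓ * n)⁻¹) ^ (1 + t) :=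
        Finset.prod_le_prod (fun _ _ => by positivity)
          fun ℓ hℓ => hfac ℓ _ (Finsupp.mem_support_iff.1 hℓ)
    _ = costBound D K 1 k * weight D k ^ (1 + t) := by
        rw [costBound, weight, Finsupp.prod, Finsupp.prod, Finsupp.prod,
          ← Real.finsetProd_rpow _ _ (fun i _ => by positivity), one_mul, ← Finset.prod_mul_distrib]
    _ ≤ _ := by
        refine mul_le_mul_of_nonneg_right ?_ (Real.rpow_nonneg (weight_pos hD k).le _)
        exact mul_le_mul_of_nonneg_right hB (Finset.prod_nonneg fun _ _ => by positivity)

end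

/-! ### A Schur test -/

theorem ENNReal_mul_le_sq_add_sq (x y : ℝ≥0∞) : x * y ≤ x ^ 2 + y ^ 2 := by
  rcases le_total x y with h | h
  · exact ((mul_le_mul_left h y).trans_eq (sq y).symm).trans le_add_self
  · exact ((mul_le_mul_right h x).trans_eq (sq x).symm).trans le_self_add

/-- The Schur bound is proved at almost every `x` and then integrated, so row and column sums are
needed only pointwise. The estimate `x y ≤ x² + y²` suffices at the price of a constant. -/
theorem tsum_lintegral_schur_le {ι X : Type*} [Countable ι] [MeasurableSpace X] {μX : Measure X}
    {m : ι → ι → X → ℝ≥0∞} (hm : ∀ i j, AEMeasurable (m i j) μX) {f g : ι → X → ℝ≥0∞}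
    (hf : ∀ i, AEMeasurable (f i) μX) (hg : ∀ i, AEMeasurable (g i) μX) {Λ : ℝ≥0∞}
    (hrow : ∀ᵐ x ∂μX, ∀ i, ∑' j, m i j x ≤ Λ) (hcol : ∀ᵐ x ∂μX, ∀ j, ∑' i, m i j x ≤ Λ) :
    ∑' p : ι × ι, ∫⁻ x, m p.1 p.2 x * (f p.2 x * g p.1 x) ∂μX ≤
      Λ * (∑' i, ∫⁻ x, f i x ^ 2 ∂μX + ∑' i, ∫⁻ x, g i x ^ 2 ∂μX) := by
  have hmfg : ∀ p : ι × ι, AEMeasurable (fun x => m p.1 p.2 x * (f p.2 x * g p.1 x)) μX :=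
    fun p => (hm p.1 p.2).mul ((hf p.2).mul (hg p.1))
  have hf2 : AEMeasurable (fun x => ∑' i, f i x ^ 2) μX := .tsum fun i => (hf i).pow_const 2
  have hg2 : AEMeasurable (fun x => ∑' i, g i x ^ 2) μX := .tsum fun i => (hg i).pow_const 2
  have hfg : AEMeasurable (fun x => ∑' i, f i x ^ 2 + ∑' i, g i x ^ 2) μX := hf2.add hg2
  rw [← lintegral_tsum hmfg, ← lintegral_tsum fun i => (hf i).pow_const 2,
    ← lintegral_tsum fun i => (hg i).pow_const 2, ← lintegral_add_left' hf2,
    ← lintegral_const_mul'' _ hfg]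
  refine lintegral_mono_ae ?_
  filter_upwards [hrow, hcol] with x hr hc
  calc ∑' p : ι × ι, m p.1 p.2 x * (f p.2 x * g p.1 x)
      ≤ ∑' p : ι × ι, (m p.1 p.2 x * f p.2 x ^ 2 + m p.1 p.2 x * g p.1 x ^ 2) := by
        refine ENNReal.tsum_le_tsum fun p => ?_
        rw [← mul_add]
        exact mul_le_mul_right (ENNReal_mul_le_sq_add_sq _ _) _
    _ = ∑' j, ∑' i, m i j x * f j x ^ 2 + ∑' i, ∑' j, m i j x * g i x ^ 2 := by
        rw [ENNReal.tsum_add, ENNReal.tsum_prod (f := fun i j => m i j x * f j x ^ 2),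
          ENNReal.tsum_prod (f := fun i j => m i j x * g i x ^ 2), ENNReal.tsum_comm]
    _ ≤ ∑' j, Λ * f j x ^ 2 + ∑' i, Λ * g i x ^ 2 := by
        refine add_le_add (ENNReal.tsum_le_tsum fun j => ?_) (ENNReal.tsum_le_tsum fun i => ?_)
        · rw [ENNReal.tsum_mul_right]; exact mul_le_mul_left (hc j) _
        · rw [ENNReal.tsum_mul_right]; exact mul_le_mul_left (hr i) _
    _ = _ := by rw [ENNReal.tsum_mul_left, ENNReal.tsum_mul_left, mul_add]

/-! ### Auxiliary facts on coefficients and kernel forms -/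

/-- The coefficients `[a]_{νν'}` of a kernel. -/
def kernelCoeff {M : Type u} {X : Type*} (a : X → (M → ℝ) → ℝ) (ν ν' : M →₀ ℕ) (x : X) : ℝ :=
  ∫ y, a x y * prodLegendre ν y * prodLegendre ν' y ∂(sigma M)

theorem kernelCoeff_comm {M : Type u} {X : Type*} (a : X → (M → ℝ) → ℝ) (ν ν' : M →₀ ℕ) (x : X) :
    kernelCoeff a ν ν' x = kernelCoeff a ν' ν x :=
  integral_congr_ae (.of_forall fun _ => mul_right_comm _ _ _)

theorem legendreCoeff_compLp {M : Type u} [Countable M] {E F : Type*} [NormedAddCommGroup E]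
    [InnerProductSpace ℝ E] [CompleteSpace E] [NormedAddCommGroup F] [InnerProductSpace ℝ F]
    [CompleteSpace F] (L : E →L[ℝ] F) (f : Lp E 2 (sigma M)) (ν : M →₀ ℕ) :
    legendreCoeff (L.compLp f) ν = L (legendreCoeff f ν) := by
  rw [legendreCoeff, legendreCoeff,
    ← ContinuousLinearMap.integral_comp_comm _ (integrable_prodLegendre_smul f ν)]
  refine integral_congr_ae ?_
  filter_upwards [L.coeFn_compLp f] with y hy
  rw [hy, map_smul]

theorem IsBoundedKernel.form_eq_of_ae {X : Type*} [MeasurableSpace X] {μX : Measure X}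
    {Ω : Type*} [MeasurableSpace Ω] {F : Type*} [NormedAddCommGroup F] [InnerProductSpace ℝ F]
    {a b : X → Ω → ℝ} {A : ℝ} {σ : Measure Ω} [SFinite μX] [SecondCountableTopology (Lp F 2 μX)]
    (ha : IsBoundedKernel a A) {f g : Lp (Lp F 2 μX) 2 σ} {u w : Ω → Lp F 2 μX}
    (hf : f =ᵐ[σ] u) (hg : g =ᵐ[σ] w) (hab : ∀ᵐ y ∂σ, ∀ᵐ x ∂μX, a x y = b x y) :
    ha.form σ f g = ∫ y, ∫ x, b x y * inner ℝ (u y x) (w y x) ∂μX ∂σ := by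
  rw [ha.form_apply]
  refine integral_congr_ae ?_
  filter_upwards [hf, hg, hab] with y h1 h2 h3
  rw [h1, h2]
  refine integral_congr_ae ?_
  filter_upwards [h3] with x hx
  rw [hx]

/-! ### The gradient fields -/

section

variable {d : ℕ} {D : Set (Space d)}

instance : CompleteSpace (H10 D) := by
  unfold H10; infer_instance

/-- The weak gradient as a bounded operator. -/
def gradL : H10 D →L[ℝ] Lp (Space d) 2 (volume.restrict D) :=
  (WithLp.sndL 2 ℝ (Lp ℝ 2 (volume.restrict D)) (Lp (Space d) 2 (volume.restrict D))).comp
    (H10 D).subtypeL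

variable {M : Type u}

/-- The gradient of an element of `L²(Y, V, σ)`. -/
def gradField (v : VV D M) : Lp (Lp (Space d) 2 (volume.restrict D)) 2 (sigma M) :=
  gradL.compLp v

theorem coeFn_gradField (v : VV D M) : gradField v =ᵐ[sigma M] fun y => grad (v y) :=
  gradL.coeFn_compLp v

theorem enorm_gradField (v : VV D M) : ‖gradField v‖ₑ = energyNorm v := by
  rw [Lp.enorm_def, energyNorm]
  exact eLpNorm_congr_ae (coeFn_gradField v)

theorem grad_coeff [Countable M] (v : VV D M) (ν : M →₀ ℕ) :
    grad (coeff v ν) = legendreCoeff (gradField v) ν := by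
  exact (legendreCoeff_compLp gradL v ν).symm

instance : SecondCountableTopology (Lp (Space d) 2 (volume.restrict D)) := by
  have : Fact ((2 : ℝ≥0∞) ≠ ⊤) := ⟨by simp⟩
  infer_instance

end

/-! ### The log-affine coefficient as a bounded kernel -/

section

variable {d : ℕ} {D : Set (Space d)} {M : Type u} [Countable M] {θ₀ : Space d → ℝ}
  {θ : M → Space d → ℝ} {lev : M → ℕ} {C q R : ℝ}

/-- The functions `θ_μ` are measurable only up to null sets, and the series is controlled only at
level points and on the cube. Measurable representatives cut off to a good set `G` of full measure,
with `y` clipped to the cube, give a kernel that is measurable and bounded everywhere. -/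
theorem exists_kernel (hθ₀ : MemLp θ₀ ∞ (volume.restrict D))
    (hθ : ∀ μ, MemLp (θ μ) ∞ (volume.restrict D))
    (hR : eLpNorm θ₀ ∞ (volume.restrict D) ≤ ENNReal.ofReal R)
    (hpt : ∀ᵐ x ∂(volume.restrict D), IsLevelPoint lev C q fun μ => θ μ x)
    (hC : 0 ≤ C) (hq0 : 0 < q) (hq : q < 1) :
    ∃ a : Space d → (M → ℝ) → ℝ, IsBoundedKernel a (Real.exp (max R 0 + C * (1 - q)⁻¹)) ∧
      ∀ᵐ x ∂(volume.restrict D), IsLevelPoint lev C q (fun μ => θ μ x) ∧ θ₀ x ≤ max R 0 ∧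
        ∀ y, (∀ μ, |y μ| ≤ 1) → a x y = logAffine θ₀ θ x y := by
  have hae0 : ∀ᵐ x ∂(volume.restrict D), θ₀ x ≤ max R 0 := by
    rw [eLpNorm_exponent_top] at hR
    filter_upwards [ae_le_eLpNormEssSup (f := θ₀) (μ := volume.restrict D)] with x hx
    have h2 := (hx.trans hR).trans (ENNReal.ofReal_le_ofReal (le_max_left R 0))
    rw [Real.enorm_eq_ofReal_abs] at h2
    exact (le_abs_self _).trans ((ENNReal.ofReal_le_ofReal_iff (le_max_right R 0)).1 h2)
  have hmk0 := hθ₀.1.ae_eq_mk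
  have hmk := ae_all_iff.2 fun μ => (hθ μ).1.ae_eq_mk
  obtain ⟨G, hG, hGm, hGp⟩ := (hpt.and (hae0.and (hmk0.and hmk))).exists_measurable_mem
  set φ₀ := hθ₀.1.mk θ₀
  set φ : M → Space d → ℝ := fun μ => G.indicator ((hθ μ).1.mk (θ μ)) with hφ
  have hlp : ∀ x, IsLevelPoint lev C q fun μ => φ μ x := by
    intro x
    by_cases hx : x ∈ G
    · have h1 : ∀ μ, φ μ x = θ μ x := fun μ => by
        rw [hφ]; simp only [indicator_of_mem hx]; exact ((hGp x hx).2.2.2 μ).symm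
      simp only [h1]
      exact (hGp x hx).1
    · have h1 : ∀ μ, φ μ x = 0 := fun μ => by rw [hφ]; exact indicator_of_notMem hx _
      simp only [h1]
      exact ⟨fun _ _ _ _ => by simp, fun _ => by rw [abs_zero]; positivity⟩
  have hsum := fun x => (hlp x).summable hC hq0 hq
  have hsum' : ∀ x (y : M → ℝ), Summable fun μ => (clip y : M → ℝ) μ * φ μ x := fun x y =>
    (tendsto_exp_sum (hsum x).1 fun μ => (clip y).2 μ).1
  have hle : ∀ x (y : M → ℝ), ∑' μ, (clip y : M → ℝ) μ * φ μ x ≤ C * (1 - q)⁻¹ := by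
    intro x y
    refine le_trans ((hsum' x y).tsum_le_tsum (fun μ => ?_) (hsum x).1) (hsum x).2
    refine (le_abs_self _).trans ?_
    rw [abs_mul]
    exact mul_le_of_le_one_left (abs_nonneg _) ((clip y).2 μ)
  have hφm : ∀ μ, Measurable (φ μ) := fun μ =>
    ((hθ μ).1.stronglyMeasurable_mk.measurable).indicator hGm
  have hmeas : Measurable fun p : Space d × (M → ℝ) =>
      ∑' μ, (clip p.2 : M → ℝ) μ * φ μ p.1 := by
    refine measurable_of_tendsto_metrizable' Filter.atTop (fun F : Finset M => ?_)
      (tendsto_pi_nhds.2 fun p => (hsum' p.1 p.2).hasSum)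
    refine Finset.measurable_fun_sum _ fun μ _ => ?_
    refine Measurable.mul ?_ ((hφm μ).comp measurable_fst)
    exact ((continuous_apply μ).comp (continuous_subtype_val.comp continuous_clip)).measurable.comp
      measurable_snd
  refine ⟨fun x y => G.indicator (fun x => Real.exp (φ₀ x)) x *
    Real.exp (∑' μ, (clip y : M → ℝ) μ * φ μ x), ⟨?_, fun x y => ?_⟩, ?_⟩
  · refine Measurable.mul ?_ (Real.measurable_exp.comp hmeas)
    exact ((Real.measurable_exp.comp hθ₀.1.stronglyMeasurable_mk.measurable).indicator hGm).comp
      measurable_fst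
  · rw [abs_mul, Real.abs_exp, Real.exp_add]
    refine mul_le_mul ?_ (Real.exp_le_exp.2 (hle x y)) (Real.exp_pos _).le (Real.exp_pos _).le
    by_cases hx : x ∈ G
    · rw [indicator_of_mem hx, Real.abs_exp]
      refine Real.exp_le_exp.2 ?_
      rw [← (hGp x hx).2.2.1]; exact (hGp x hx).2.1
    · rw [indicator_of_notMem hx, abs_zero]; exact (Real.exp_pos _).le
  · filter_upwards [hG] with x hx
    refine ⟨(hGp x hx).1, (hGp x hx).2.1, fun y hy => ?_⟩
    rw [indicator_of_mem hx, ← Real.exp_add, logAffine, clip_eq hy, (hGp x hx).2.2.1]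
    congr 2
    refine tsum_congr fun μ => ?_
    rw [hφ]; simp only [indicator_of_mem hx]; rw [(hGp x hx).2.2.2 μ]

theorem measurable_kernelCoeff {X : Type*} [MeasurableSpace X] {a : X → (M → ℝ) → ℝ} {A : ℝ}
    (ha : IsBoundedKernel a A) (ν ν' : M →₀ ℕ) : Measurable (kernelCoeff a ν ν') := by
  refine StronglyMeasurable.measurable ?_
  refine StronglyMeasurable.integral_prod_right'
    (f := fun p : X × (M → ℝ) => a p.1 p.2 * prodLegendre ν p.2 * prodLegendre ν' p.2) ?_
  exact ((ha.measurable.mul ((continuous_prodLegendre ν).measurable.comp measurable_snd)).mul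
    ((continuous_prodLegendre ν').measurable.comp measurable_snd)).stronglyMeasurable

variable {a : Space d → (M → ℝ) → ℝ}

theorem kernelCoeff_eq_coeffA {x : Space d}
    (ha : ∀ y, (∀ μ, |y μ| ≤ 1) → a x y = logAffine θ₀ θ x y) (ν ν' : M →₀ ℕ) :
    coeffA θ₀ θ ν ν' x = kernelCoeff a ν ν' x := by
  refine integral_congr_ae ?_
  filter_upwards [ae_sigma_abs_le] with y hy
  rw [ha y hy]

theorem abs_kernelCoeff_le {x : Space d} (hx : IsLevelPoint lev C q fun μ => θ μ x)
    (hx0 : θ₀ x ≤ max R 0) (ha : ∀ y, (∀ μ, |y μ| ≤ 1) → a x y = logAffine θ₀ θ x y)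
    (hC : 0 ≤ C) (hq0 : 0 < q) (hq : q < 1) (ν ν' : M →₀ ℕ) :
    |kernelCoeff a ν ν' x| ≤ Real.exp (max R 0 + C * (1 - q)⁻¹) *
      (absDiff ν ν').prod fun μ n => |θ μ x| ^ n / n.factorial := by
  obtain ⟨h1, h2⟩ := hx.summable hC hq0 hq
  have h3 : kernelCoeff a ν ν' x = Real.exp (θ₀ x) *
      ∫ y, Real.exp (∑' μ, y μ * θ μ x) * prodLegendre ν y * prodLegendre ν' y ∂(sigma M) := by
    rw [← kernelCoeff_eq_coeffA ha, coeffA, ← integral_const_mul]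
    refine integral_congr_ae (.of_forall fun y => ?_)
    simp only [logAffine, Real.exp_add]
    ring
  rw [h3, abs_mul, Real.abs_exp, Real.exp_add, mul_assoc]
  refine mul_le_mul (Real.exp_le_exp.2 hx0) ((abs_integral_exp_mul_prodLegendre_le h1 ν ν').trans ?_)
    (abs_nonneg _) (Real.exp_pos _).le
  exact mul_le_mul_of_nonneg_right (Real.exp_le_exp.2 h2)
    (Finset.prod_nonneg fun _ _ => by positivity)

theorem formEntry_eq (ha : ∀ᵐ x ∂(volume.restrict D), ∀ y, (∀ μ, |y μ| ≤ 1) →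
      a x y = logAffine θ₀ θ x y) (v w : VV D M) (ν ν' : M →₀ ℕ) :
    formEntry D θ₀ θ v w ν ν' = ∫ x in D, kernelCoeff a ν ν' x *
      inner ℝ (legendreCoeff (gradField v) ν' x) (legendreCoeff (gradField w) ν x) := by
  rw [formEntry, grad_coeff, grad_coeff]
  refine integral_congr_ae ?_
  filter_upwards [ha] with x hx
  rw [kernelCoeff_eq_coeffA hx]

theorem formB_eq {A : ℝ} (hb : IsBoundedKernel a A) (ha : ∀ᵐ x ∂(volume.restrict D), ∀ y,
      (∀ μ, |y μ| ≤ 1) → a x y = logAffine θ₀ θ x y) (v w : VV D M) :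
    formB D θ₀ θ v w = hb.form (sigma M) (gradField v) (gradField w) := by
  refine (hb.form_eq_of_ae (coeFn_gradField v) (coeFn_gradField w) ?_).symm
  filter_upwards [ae_sigma_abs_le] with y hy
  filter_upwards [ha] with x hx
  exact hx y hy

theorem lintegral_enorm_sq_Lp (f : Lp (Space d) 2 (volume.restrict D)) :
    ∫⁻ x in D, ‖f x‖ₑ ^ 2 = ‖f‖ₑ ^ 2 := by
  rw [Lp.enorm_def, eLpNorm_eq_lintegral_rpow_enorm_toReal (by norm_num) (by norm_num)]
  simp only [ENNReal.toReal_ofNat, one_div]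
  rw [← ENNReal.rpow_natCast, ← ENNReal.rpow_mul]
  norm_num

theorem tsum_enorm_legendreCoeff_sq (f : Lp (Lp (Space d) 2 (volume.restrict D)) 2 (sigma M)) :
    ∑' ν, ∫⁻ x in D, ‖legendreCoeff f ν x‖ₑ ^ 2 = ‖f‖ₑ ^ 2 := by
  simp_rw [lintegral_enorm_sq_Lp]
  have h := hasSum_norm_legendreCoeff_sq f
  have h2 : ∀ x : ℝ, 0 ≤ x → ENNReal.ofReal (x ^ 2) = ENNReal.ofReal x ^ 2 := fun x hx =>
    ENNReal.ofReal_pow hx 2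
  simp_rw [← ofReal_norm, ← h2 _ (norm_nonneg _)]
  rw [← ENNReal.ofReal_tsum_of_nonneg (fun _ => by positivity) h.summable, h.tsum_eq]

/-- Each row is split according to `k = levelDiff`, and `tsum_levelDiff_le` bounds every part;
columns follow from the symmetry of the coefficients. Parseval for the gradient fields turns the
Schur bound into energy norms, without a Poincaré inequality. -/
theorem tsum_formEntry_le (ha : ∀ᵐ x ∂(volume.restrict D), IsLevelPoint lev C q (fun μ => θ μ x) ∧
      θ₀ x ≤ max R 0 ∧ ∀ y, (∀ μ, |y μ| ≤ 1) → a x y = logAffine θ₀ θ x y)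
    (hb : IsBoundedKernel a (Real.exp (max R 0 + C * (1 - q)⁻¹)))
    (hC : 0 ≤ C) (hq0 : 0 < q) (hq : q < 1) (K : Finset (ℕ →₀ ℕ)) (v w : VV D M) :
    ∑' p : (M →₀ ℕ) × (M →₀ ℕ), (if levelDiff lev p.1 p.2 ∈ K then 0 else
        ‖formEntry D θ₀ θ v w p.1 p.2‖ₑ) ≤
      (∑' k : ℕ →₀ ℕ, if k ∈ K then 0 else ENNReal.ofReal (Real.exp (max R 0 + C * (1 - q)⁻¹) *
        k.prod fun ℓ n => 2 * ((C * q ^ ℓ) ^ n / n.factorial))) *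
        (energyNorm v ^ 2 + energyNorm w ^ 2) := by
  classical
  set f := gradField v
  set g := gradField w
  have ha' : ∀ᵐ x ∂(volume.restrict D), ∀ y, (∀ μ, |y μ| ≤ 1) → a x y = logAffine θ₀ θ x y :=
    ha.mono fun x hx => hx.2.2
  set m : (M →₀ ℕ) → (M →₀ ℕ) → Space d → ℝ≥0∞ := fun ν ν' x =>
    if levelDiff lev ν ν' ∈ K then 0 else ‖kernelCoeff a ν ν' x‖ₑ with hm
  have hentry : ∀ p : (M →₀ ℕ) × (M →₀ ℕ), (if levelDiff lev p.1 p.2 ∈ K then 0 else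
        ‖formEntry D θ₀ θ v w p.1 p.2‖ₑ) ≤
      ∫⁻ x in D, m p.1 p.2 x * (‖legendreCoeff f p.2 x‖ₑ * ‖legendreCoeff g p.1 x‖ₑ) := by
    intro p
    by_cases hp : levelDiff lev p.1 p.2 ∈ K
    · rw [if_pos hp]; exact zero_le
    · rw [if_neg hp, formEntry_eq ha']
      refine (enorm_integral_le_lintegral_enorm _).trans (lintegral_mono fun x => ?_)
      simp only [hm, if_neg hp]
      rw [enorm_mul]
      refine mul_le_mul_right ?_ _
      rw [← ofReal_norm, ← ofReal_norm, ← ofReal_norm, ← ENNReal.ofReal_mul (norm_nonneg _)]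
      exact ENNReal.ofReal_le_ofReal (norm_inner_le_norm _ _)
  refine (ENNReal.tsum_le_tsum hentry).trans ?_
  rw [← enorm_gradField, ← enorm_gradField, ← tsum_enorm_legendreCoeff_sq,
    ← tsum_enorm_legendreCoeff_sq]
  have hrow : ∀ᵐ x ∂(volume.restrict D), ∀ ν, ∑' ν', m ν ν' x ≤
      ∑' k : ℕ →₀ ℕ, if k ∈ K then 0 else ENNReal.ofReal (Real.exp (max R 0 + C * (1 - q)⁻¹) *
        k.prod fun ℓ n => 2 * ((C * q ^ ℓ) ^ n / n.factorial)) := by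
    filter_upwards [ha] with x hx ν
    have h1 : ∀ ν', m ν ν' x = ∑' k : ℕ →₀ ℕ, if k ∈ K then 0 else
        (if levelDiff lev ν ν' = k then ‖kernelCoeff a ν ν' x‖ₑ else 0) := by
      intro ν'
      rw [tsum_eq_single (levelDiff lev ν ν') fun k hk => by rw [if_neg (Ne.symm hk), ite_self],
        if_pos rfl]
    simp_rw [h1]
    rw [ENNReal.tsum_comm]
    refine ENNReal.tsum_le_tsum fun k => ?_
    by_cases hk : k ∈ K
    · simp [hk]
    · simp only [if_neg hk]
      exact tsum_levelDiff_le hx.1 (Real.exp_pos _).le hC hq0.le ν (fun ν' => kernelCoeff a ν ν' x)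
        (fun ν' => abs_kernelCoeff_le hx.1 hx.2.1 hx.2.2 hC hq0 hq ν ν') k
  have hsymm : ∀ ν ν' x, m ν ν' x = m ν' ν x := fun ν ν' x => by
    simp only [hm]; rw [levelDiff_comm, kernelCoeff_comm]
  refine tsum_lintegral_schur_le (f := fun ν x => ‖legendreCoeff f ν x‖ₑ)
    (g := fun ν x => ‖legendreCoeff g ν x‖ₑ) (fun ν ν' => ?_)
    (fun ν => (Lp.aestronglyMeasurable _).enorm) (fun ν => (Lp.aestronglyMeasurable _).enorm)
    hrow ?_
  · by_cases hp : levelDiff lev ν ν' ∈ K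
    · simp only [hm, if_pos hp]; exact aemeasurable_const
    · simp only [hm, if_neg hp]; exact (measurable_kernelCoeff hb ν ν').enorm.aemeasurable
  · filter_upwards [hrow] with x hx ν
    simp_rw [hsymm _ ν]
    exact hx ν

/-- The coefficient bound contains a positive power of every `|θ_μ|` with `ν_μ ≠ ν'_μ`, so it
vanishes where their product does. -/
theorem formEntry_eq_zero (ha : ∀ᵐ x ∂(volume.restrict D), IsLevelPoint lev C q (fun μ => θ μ x) ∧
      θ₀ x ≤ max R 0 ∧ ∀ y, (∀ μ, |y μ| ≤ 1) → a x y = logAffine θ₀ θ x y)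
    (hC : 0 ≤ C) (hq0 : 0 < q) (hq : q < 1) (v w : VV D M) {ν ν' : M →₀ ℕ}
    (h0 : (fun x => ∏ μ ∈ (absDiff ν ν').support, θ μ x) =ᵐ[volume.restrict D] 0) :
    formEntry D θ₀ θ v w ν ν' = 0 := by
  rw [formEntry_eq (ha.mono fun x hx => hx.2.2)]
  refine integral_eq_zero_of_ae ?_
  filter_upwards [ha, h0] with x hx hx0
  obtain ⟨μ, hμ, hz⟩ := Finset.prod_eq_zero_iff.1 hx0
  have h1 := abs_kernelCoeff_le hx.1 hx.2.1 hx.2.2 hC hq0 hq ν ν'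
  rw [Finsupp.prod, Finset.prod_eq_zero hμ (by
    rw [hz, abs_zero, zero_pow (Finsupp.mem_support_iff.1 hμ), zero_div]), mul_zero] at h1
  rw [abs_eq_zero.1 (le_antisymm h1 (abs_nonneg _)), zero_mul, Pi.zero_apply]

end

/-! ### Compression of the operator -/

section

variable {d : ℕ} {D : Set (Space d)} {M : Type u} [Countable M] {θ₀ : Space d → ℝ}
  {θ : M → Space d → ℝ} {lev : M → ℕ} {C q R : ℝ}

/-- A log-affine coefficient with a level structure, in the form used for the operator bounds. -/
structure IsLevelData (D : Set (Space d)) (θ₀ : Space d → ℝ) (θ : M → Space d → ℝ) (lev : M → ℕ)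
    (C q R : ℝ) : Prop where
  memLp_zero : MemLp θ₀ ∞ (volume.restrict D)
  memLp : ∀ μ, MemLp (θ μ) ∞ (volume.restrict D)
  eLpNorm_zero_le : eLpNorm θ₀ ∞ (volume.restrict D) ≤ ENNReal.ofReal R
  isLevelPoint : ∀ᵐ x ∂(volume.restrict D), IsLevelPoint lev C q fun μ => θ μ x
  const_nonneg : 0 ≤ C
  rate_pos : 0 < q
  rate_lt_one : q < 1

/-- The bound for the part of the operator with level differences `k`. -/
def blockBound (C q R : ℝ) (k : ℕ →₀ ℕ) : ℝ :=
  Real.exp (max R 0 + C * (1 - q)⁻¹) * k.prod fun ℓ n => 2 * ((C * q ^ ℓ) ^ n / n.factorial)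

theorem IsLevelData.tsum_formEntry_le (h : IsLevelData D θ₀ θ lev C q R)
    (K : Finset (ℕ →₀ ℕ)) (v w : VV D M) :
    ∑' p : (M →₀ ℕ) × (M →₀ ℕ), (if levelDiff lev p.1 p.2 ∈ K then 0 else
        ‖formEntry D θ₀ θ v w p.1 p.2‖ₑ) ≤
      (∑' k : ℕ →₀ ℕ, if k ∈ K then 0 else ENNReal.ofReal (blockBound C q R k)) *
        (energyNorm v ^ 2 + energyNorm w ^ 2) := by
  obtain ⟨a, hb, ha⟩ := exists_kernel h.memLp_zero h.memLp h.eLpNorm_zero_le h.isLevelPoint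
    h.const_nonneg h.rate_pos h.rate_lt_one
  exact StochGalerkin.tsum_formEntry_le ha hb h.const_nonneg h.rate_pos h.rate_lt_one K v w

theorem IsLevelData.summable_formEntry (h : IsLevelData D θ₀ θ lev C q R)
    (hfin : ∑' k, ENNReal.ofReal (blockBound C q R k) ≠ ⊤) (v w : VV D M) :
    Summable fun p : (M →₀ ℕ) × (M →₀ ℕ) => formEntry D θ₀ θ v w p.1 p.2 := by
  have h1 := h.tsum_formEntry_le ∅ v w
  simp only [Finset.notMem_empty, if_false] at h1
  have h2 : ∑' p : (M →₀ ℕ) × (M →₀ ℕ), ‖formEntry D θ₀ θ v w p.1 p.2‖ₑ ≠ ⊤ := by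
    refine ne_top_of_le_ne_top (ENNReal.mul_ne_top hfin (ENNReal.add_ne_top.2 ⟨?_, ?_⟩)) h1
    · rw [← enorm_gradField]; exact ENNReal.pow_ne_top enorm_ne_top
    · rw [← enorm_gradField]; exact ENNReal.pow_ne_top enorm_ne_top
  exact (ENNReal.tsum_coe_ne_top_iff_summable.1 h2).of_nnnorm

theorem IsBoundedKernel.form_gradField_eq_tsum {a : Space d → (M → ℝ) → ℝ} {A : ℝ}
    (hb : IsBoundedKernel a A) (v w : VV D M)
    (hs : Summable fun p : (M →₀ ℕ) × (M →₀ ℕ) =>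
      ∫ x in D, kernelCoeff a p.1 p.2 x *
      inner ℝ (legendreCoeff (gradField v) p.2 x) (legendreCoeff (gradField w) p.1 x)) :
    hb.form (sigma M) (gradField v) (gradField w) = ∑' p : (M →₀ ℕ) × (M →₀ ℕ),
      ∫ x in D, kernelCoeff a p.1 p.2 x *
      inner ℝ (legendreCoeff (gradField v) p.2 x) (legendreCoeff (gradField w) p.1 x) :=
  hb.form_eq_tsum (gradField v) (gradField w) hs

theorem IsLevelData.formB_eq_tsum (h : IsLevelData D θ₀ θ lev C q R)
    (hfin : ∑' k, ENNReal.ofReal (blockBound C q R k) ≠ ⊤) (v w : VV D M) :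
    formB D θ₀ θ v w = ∑' p : (M →₀ ℕ) × (M →₀ ℕ), formEntry D θ₀ θ v w p.1 p.2 := by
  obtain ⟨a, hb, ha⟩ := exists_kernel h.memLp_zero h.memLp h.eLpNorm_zero_le h.isLevelPoint
    h.const_nonneg h.rate_pos h.rate_lt_one
  have ha' : ∀ᵐ x ∂(volume.restrict D), ∀ y, (∀ μ, |y μ| ≤ 1) → a x y = logAffine θ₀ θ x y :=
    ha.mono fun x hx => hx.2.2
  have he := fun p : (M →₀ ℕ) × (M →₀ ℕ) => formEntry_eq ha' v w p.1 p.2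
  have hs := (summable_congr he).1 (h.summable_formEntry hfin v w)
  exact (formB_eq hb ha' v w).trans
    ((hb.form_gradField_eq_tsum v w hs).trans (tsum_congr he).symm)

/-- The nonvanishing condition in the interaction set discards only zero entries, so the truncation
retains exactly the pairs whose level difference lies in `K`. -/
theorem IsLevelData.formBK_eq_tsum (h : IsLevelData D θ₀ θ lev C q R)
    (hfin : ∑' k, ENNReal.ofReal (blockBound C q R k) ≠ ⊤) (K : Finset (ℕ →₀ ℕ)) (v w : VV D M) :
    formBK D θ₀ θ lev K v w = ∑' p : (M →₀ ℕ) × (M →₀ ℕ),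
      if levelDiff lev p.1 p.2 ∈ K then formEntry D θ₀ θ v w p.1 p.2 else 0 := by
  classical
  obtain ⟨a, -, ha⟩ := exists_kernel h.memLp_zero h.memLp h.eLpNorm_zero_le h.isLevelPoint
    h.const_nonneg h.rate_pos h.rate_lt_one
  have hs := h.summable_formEntry hfin v w
  have hsk : ∀ k, Summable fun p : (M →₀ ℕ) × (M →₀ ℕ) =>
      if levelDiff lev p.1 p.2 = k then formEntry D θ₀ θ v w p.1 p.2 else 0 := fun k =>
    (hs.indicator {p : (M →₀ ℕ) × (M →₀ ℕ) | levelDiff lev p.1 p.2 = k}).congr fun p => by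
      rw [indicator_apply]; rfl
  have hk : ∀ k, ∑' ν : M →₀ ℕ, ∑' ν' : interactionSet D θ lev k ν, formEntry D θ₀ θ v w ν ν' =
      ∑' p : (M →₀ ℕ) × (M →₀ ℕ),
        if levelDiff lev p.1 p.2 = k then formEntry D θ₀ θ v w p.1 p.2 else 0 := by
    intro k
    rw [(hsk k).tsum_prod]
    refine tsum_congr fun ν => ?_
    rw [tsum_subtype (interactionSet D θ lev k ν) fun ν' => formEntry D θ₀ θ v w ν ν']
    refine tsum_congr fun ν' => ?_
    rw [indicator_apply]
    simp only [mem_interactionSet]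
    by_cases h1 : levelDiff lev ν ν' = k
    · by_cases h2 : (fun x => ∏ μ ∈ (absDiff ν ν').support, θ μ x) =ᵐ[volume.restrict D] 0
      · rw [formEntry_eq_zero ha h.const_nonneg h.rate_pos h.rate_lt_one v w h2, ite_self, ite_self]
      · rw [if_pos ⟨h1, h2⟩, if_pos h1]
    · rw [if_neg fun h2 => h1 h2.1, if_neg h1]
  rw [formBK, Finset.sum_congr rfl fun k _ => hk k, ← Summable.tsum_finsetSum fun k _ => hsk k]
  refine tsum_congr fun p => ?_
  rw [Finset.sum_ite_eq]

theorem IsLevelData.opNorm_le (h : IsLevelData D θ₀ θ lev C q R)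
    (hfin : ∑' k, ENNReal.ofReal (blockBound C q R k) ≠ ⊤) (K : Finset (ℕ →₀ ℕ)) :
    opNorm (fun v w : VV D M => formB D θ₀ θ v w - formBK D θ₀ θ lev K v w) ≤
      (∑' k : ℕ →₀ ℕ, if k ∈ K then 0 else ENNReal.ofReal (blockBound C q R k)) * 2 := by
  refine iSup₂_le fun v hv => iSup₂_le fun w hw => ?_
  have hs := h.summable_formEntry hfin v w
  have hsK : Summable fun p : (M →₀ ℕ) × (M →₀ ℕ) =>
      if levelDiff lev p.1 p.2 ∈ K then formEntry D θ₀ θ v w p.1 p.2 else 0 :=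
    (hs.indicator {p : (M →₀ ℕ) × (M →₀ ℕ) | levelDiff lev p.1 p.2 ∈ K}).congr fun p => by
      rw [indicator_apply]; rfl
  beta_reduce
  rw [h.formB_eq_tsum hfin, h.formBK_eq_tsum hfin, ← hs.tsum_sub hsK]
  refine (enorm_tsum_le_tsum_enorm).trans ?_
  refine le_trans (ENNReal.tsum_le_tsum fun p => ?_) ((h.tsum_formEntry_le K v w).trans ?_)
  · split_ifs <;> simp
  · refine mul_le_mul_right ?_ _
    calc energyNorm v ^ 2 + energyNorm w ^ 2 ≤ 1 ^ 2 + 1 ^ 2 := by gcongr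
      _ = 2 := by norm_num

theorem tsum_not_mem_range {f : (ℕ →₀ ℕ) → ℝ≥0∞} (e : ℕ ≃ (ℕ →₀ ℕ)) (J : ℕ) :
    (∑' k, if k ∈ (Finset.range J).map e.toEmbedding then 0 else f k) = ∑' j, f (e (j + J)) := by
  rw [← e.tsum_eq, ← ENNReal.summable.sum_add_tsum_nat_add' (k := J)]
  have h1 : ∀ j, (e j ∈ (Finset.range J).map e.toEmbedding) ↔ j < J := fun j => by simp
  simp only [h1]
  rw [Finset.sum_eq_zero fun j hj => if_pos (Finset.mem_range.1 hj), zero_add]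
  exact tsum_congr fun j => if_neg (by omega)

end

end StochGalerkin

end


/-! ### Choice of constants and assembly of the theorem -/

open StochGalerkin

theorem mainTheorem2 (d : ℕ) (hd : 0 < d) (c C : ℝ) (hc : 0 < c) :
    (∃ Q : ℕ, 0 < Q ∧
      ∀ (α : ℝ) (D : Set (StochGalerkin.Space d)), 0 < α → IsOpen D → Bornology.IsBounded D →
        D.Nonempty →
      ∃ C' : ℝ,
      ∀ (M : Type u) [Countable M] (θ₀ : StochGalerkin.Space d → ℝ)
        (θ : M → StochGalerkin.Space d → ℝ) (lvl : M → ℕ),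
        StochGalerkin.IsMultilevel D θ₀ θ lvl α c C →
      ∃ lev : M → ℕ, StochGalerkin.IsLevelAssignment D θ α Q C' lev) ∧
    (∀ (α : ℝ) (Q : ℕ) (C' R : ℝ), 0 < α → 0 < Q →
      ∃ (A : ℝ → NNReal) (G : ℕ → NNReal),
      ∀ (D : Set (StochGalerkin.Space d)), IsOpen D → Bornology.IsBounded D → D.Nonempty →
      ∀ (M : Type u) [Countable M] (θ₀ : StochGalerkin.Space d → ℝ)
        (θ : M → StochGalerkin.Space d → ℝ) (lvl lev : M → ℕ),
        StochGalerkin.IsMultilevel D θ₀ θ lvl α c C →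
        eLpNorm θ₀ ∞ (volume.restrict D) ≤ ENNReal.ofReal R →
        StochGalerkin.IsLevelAssignment D θ α Q C' lev →
      (∀ k : ℕ →₀ ℕ, StochGalerkin.cost D θ lev k ≠ ⊤) ∧
      (∀ (k : ℕ →₀ ℕ) (v w : StochGalerkin.VV D M),
        Summable fun p : (Σ ν : M →₀ ℕ, StochGalerkin.interactionSet D θ lev k ν) =>
          StochGalerkin.formEntry D θ₀ θ v w p.1 p.2) ∧
      ∃ k : ℕ ≃ (ℕ →₀ ℕ),
        (∀ s : ℝ, s < α / d → ∀ J : ℕ, 1 ≤ J →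
          StochGalerkin.opNorm (fun v w : StochGalerkin.VV D M =>
              StochGalerkin.formB D θ₀ θ v w -
                StochGalerkin.formBK D θ₀ θ lev ((Finset.range J).map k.toEmbedding) v w) ≤
            A s * ((∑ j ∈ Finset.range J, StochGalerkin.cost D θ lev (k j) : ℕ∞) : ℝ≥0∞) ^ (-s)) ∧
        (∀ ℓ₀ : ℕ, (Nonempty M → ∃ μ, lev μ ≤ ℓ₀) → ∀ J : ℕ, 1 ≤ J →
          ((∑ j ∈ Finset.range (J + 1), StochGalerkin.cost D θ lev (k j) : ℕ∞) : ℝ≥0∞) ≤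
            G ℓ₀ * 2 ^ ((d : ℝ) / Q) *
              ((∑ j ∈ Finset.range J, StochGalerkin.cost D θ lev (k j) : ℕ∞) : ℝ≥0∞))) := by
  refine ⟨⟨⌈C * (2 * C + 1) ^ d⌉₊ + 1, by omega, fun α D hα hD hb _ => ?_⟩, ?_⟩
  · obtain ⟨r, hr0, hr⟩ := hb.closure.subset_ball_lt 0 0
    exact ⟨C * max 1 (r ^ d) + C * 2 ^ α, fun M _ θ₀ θ lvl h =>
      h.exists_levelAssignment hc hα hD hb hr0 hr⟩
  intro α Q C' R hα hQ
  have hd' : (0 : ℝ) < d := by exact_mod_cast hd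
  have hQ' : (0 : ℝ) < Q := by exact_mod_cast hQ
  set t := α / d with ht
  have ht0 : 0 < t := div_pos hα hd'
  set B := (2 : ℝ) ^ ((d : ℝ) / Q) with hB
  have hB1 : 1 < B := Real.one_lt_rpow (by norm_num) (by positivity)
  set q := (2 : ℝ) ^ (-(α / Q)) with hq
  have hqB : q = B ^ (-t) := by
    rw [hq, hB, ← Real.rpow_mul (by norm_num), ht]
    congr 1; field_simp
  have hq0 : 0 < q := by positivity
  have hq1 : q < 1 := Real.rpow_lt_one_of_one_lt_of_neg (by norm_num)
    (neg_lt_zero.2 (by positivity))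
  -- The lower bound 1 covers `cost 0`, which the cardinality bound of the levels does not control.
  set Cb := max 1 C' with hCb
  have hCb1 : 1 ≤ Cb := le_max_left _ _
  have hCb0 : 0 < Cb := by linarith
  obtain ⟨K, hK2, hK⟩ := exists_prod_le Cb hCb0.le t ht0.le
  have hK0 : 0 < K := by linarith
  set E := Real.exp (max R 0 + Cb * (1 - q)⁻¹) with hE
  have hE0 : 0 < E := Real.exp_pos _
  have hblock : ∀ k, blockBound Cb q R k ≤ E * (costBound B K Cb k * weight B k ^ (1 + t)) :=
    fun k => mul_le_mul_of_nonneg_left (hK B q hB1 hqB Cb hCb1 k) hE0.le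
  have hnn : ∀ k, 0 ≤ costBound B K Cb k * weight B k ^ (1 + t) := fun k =>
    mul_nonneg (costBound_pos hB1 hK0 hCb0 k).le (Real.rpow_nonneg (weight_pos hB1 k).le _)
  have hsum : Summable fun k => costBound B K Cb k * weight B k ^ (1 + t) :=
    summable_costBound_mul_weight hB1 hK0 (by linarith)
  have hfin : ∑' k, ENNReal.ofReal (blockBound Cb q R k) ≠ ⊤ :=
    ne_top_of_le_ne_top (hsum.mul_left E).tsum_ofReal_ne_top
      (ENNReal.tsum_le_tsum fun k => ENNReal.ofReal_le_ofReal (hblock k))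
  -- The enumeration and all constants are fixed by `α`, `d`, `Q`, `C'`, `R` before the domain and
  -- the expansion are introduced.
  obtain ⟨e, he, he0⟩ := exists_enumeration hB1
  let N : ℝ → ℝ := fun s => (∑' k, costBound B K Cb k * weight B k ^ ((1 + t) / (1 + s))) ^ (1 + s)
  refine ⟨fun s => (2 * E * N (max s 0)).toNNReal, fun ℓ₀ => (1 + 2 * Cb * B ^ ℓ₀).toNNReal,
    fun D hD hb hne M _ θ₀ θ lvl lev hml hR hla => ?_⟩
  have hdata : IsLevelData D θ₀ θ lev Cb q R := ⟨hml.memLp_zero, hml.memLp, hR,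
    hla.ae_isLevelPoint (le_max_right _ _), hCb0.le, hq0, hq1⟩
  choose n hn hn' using hla.exists_cost_eq hCb1 (le_max_right 1 C')
  have hcost : ∀ k, (n k : ℝ) ≤ costBound B K Cb k := fun k =>
    (hn' k).trans (costSharp_le_costBound hB1 hK2 hCb0 k)
  have hn0 : 1 ≤ n 0 := by
    have := one_le_cost_zero (θ := θ) (lev := lev) hD hne
    rw [hn] at this; exact_mod_cast this
  have hS : ∀ J : ℕ, ((∑ j ∈ Finset.range J, cost D θ lev (e j) : ℕ∞) : ℝ≥0∞) =
      ENNReal.ofReal (∑ j ∈ Finset.range J, (n (e j) : ℝ)) := by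
    intro J
    simp_rw [hn]
    rw [← Nat.cast_sum, ← Nat.cast_sum, ENNReal.ofReal_natCast, ENat.toENNReal_coe]
  have hS1 : ∀ J : ℕ, 1 ≤ J → 1 ≤ ∑ j ∈ Finset.range J, (n (e j) : ℝ) := by
    intro J hJ
    refine le_trans ?_ (Finset.single_le_sum (f := fun j => (n (e j) : ℝ))
      (fun _ _ => Nat.cast_nonneg _) (Finset.mem_range.2 hJ))
    simp only [he0]
    exact_mod_cast hn0
  refine ⟨fun k => by rw [hn]; exact ENat.natCast_ne_top _, fun k v w => ?_, e, ?_, ?_⟩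
  · refine (hdata.summable_formEntry hfin v w).comp_injective
      (i := fun p : (Σ ν : M →₀ ℕ, interactionSet D θ lev k ν) => (p.1, (p.2 : M →₀ ℕ))) ?_
    rintro ⟨ν₁, ν₁'⟩ ⟨ν₂, ν₂'⟩ h
    simp only [Prod.mk.injEq] at h
    obtain ⟨rfl, h2⟩ := h
    rw [Subtype.ext h2]
  · intro s hs J hJ
    -- The Stechkin estimate needs a nonnegative exponent. For negative `s` the case `s' = 0` is
    -- enough, since the total cost is at least `cost 0 ≥ 1`.
    set s' := max s 0
    have hs' : s' < t := max_lt hs ht0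
    have hSJ := hS1 J hJ
    have htail := tail_le he hB1 hK0 hCb0 (le_max_right s 0) hs' hcost (J := J) (by linarith)
    refine (hdata.opNorm_le hfin _).trans ?_
    rw [tsum_not_mem_range, hS]
    have hshift := (summable_nat_add_iff J).2 (hsum.comp_injective e.injective)
    have h1 : ∑' j, ENNReal.ofReal (blockBound Cb q R (e (j + J))) ≤
        ENNReal.ofReal (E * (N s' * (∑ j ∈ Finset.range J, (n (e j) : ℝ)) ^ (-s'))) := by
      calc _ ≤ ∑' j, ENNReal.ofReal
            (E * (costBound B K Cb (e (j + J)) * weight B (e (j + J)) ^ (1 + t))) :=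
            ENNReal.tsum_le_tsum fun j => ENNReal.ofReal_le_ofReal (hblock _)
        _ = ENNReal.ofReal (∑' j, E * (costBound B K Cb (e (j + J)) *
              weight B (e (j + J)) ^ (1 + t))) :=
            (ENNReal.ofReal_tsum_of_nonneg (fun j => mul_nonneg hE0.le (hnn _))
              (hshift.mul_left E)).symm
        _ ≤ _ := by
            refine ENNReal.ofReal_le_ofReal ?_
            rw [tsum_mul_left]
            exact mul_le_mul_of_nonneg_left htail hE0.le
    have hN0 : 0 ≤ N s' := Real.rpow_nonneg (tsum_nonneg fun k =>
      mul_nonneg (costBound_pos hB1 hK0 hCb0 k).le (Real.rpow_nonneg (weight_pos hB1 k).le _)) _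
    rw [ENNReal.ofReal_rpow_of_pos (by linarith), ← ENNReal.ofReal,
      ← ENNReal.ofReal_mul (by positivity)]
    refine (mul_le_mul_left h1 2).trans ?_
    rw [← ENNReal.ofReal_ofNat 2, ← ENNReal.ofReal_mul (by positivity)]
    refine ENNReal.ofReal_le_ofReal ?_
    have h2 : (∑ j ∈ Finset.range J, (n (e j) : ℝ)) ^ (-s') ≤
        (∑ j ∈ Finset.range J, (n (e j) : ℝ)) ^ (-s) :=
      Real.rpow_le_rpow_of_exponent_le hSJ (neg_le_neg (le_max_left _ _))
    calc _ = 2 * E * N s' * (∑ j ∈ Finset.range J, (n (e j) : ℝ)) ^ (-s') := by ring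
      _ ≤ _ := mul_le_mul_of_nonneg_left h2 (by positivity)
  · intro ℓ₀ hℓ₀ J hJ
    have hSJ := hS1 J hJ
    have hnext : (n (e J) : ℝ) ≤ 2 * Cb * B ^ ℓ₀ * ∑ j ∈ Finset.range J, (n (e j) : ℝ) := by
      rcases isEmpty_or_nonempty M with hM | hM
      · have h0 : n (e J) = 0 := by
          have h1 : e J ≠ 0 := fun h => by
            have := e.injective (h.trans he0.symm); omega
          have h2 := cost_eq_zero_of_isEmpty (D := D) (θ := θ) (lev := lev) h1
          rw [hn] at h2; exact_mod_cast h2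
        rw [h0, Nat.cast_zero]
        positivity
      · obtain ⟨μ, hμ⟩ := hℓ₀ hM
        refine (next_cost_le he he0 hB1 hCb0 (fun k => Nat.cast_nonneg (n k)) hn'
          (ℓ₁ := lev μ) (fun m => ?_) hJ).trans ?_
        · have := one_le_cost_single (lev := lev) m hD hne
            (hml.not_ae_eq_zero hD.measurableSet hc μ)
          rw [hn] at this; exact_mod_cast this
        · gcongr
          exact hB1.le
    rw [hS, hS, Finset.sum_range_succ]
    have h2 : (2 : ℝ≥0∞) ^ ((d : ℝ) / Q) = ENNReal.ofReal B := by
      rw [hB, ← ENNReal.ofReal_rpow_of_pos (by norm_num), ENNReal.ofReal_ofNat]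
    rw [h2, ← ENNReal.ofReal, ← ENNReal.ofReal_mul (by positivity),
      ← ENNReal.ofReal_mul (by positivity)]
    refine ENNReal.ofReal_le_ofReal ?_
    have h3 : 0 ≤ (1 + 2 * Cb * B ^ ℓ₀) * ∑ j ∈ Finset.range J, (n (e j) : ℝ) := by positivity
    -- The 1 accounts for the previous costs, the second term for the new one; the factor `B ≥ 1`
    -- only enlarges the bound.
    calc _ ≤ (1 + 2 * Cb * B ^ ℓ₀) * ∑ j ∈ Finset.range J, (n (e j) : ℝ) := by linarith
      _ ≤ ((1 + 2 * Cb * B ^ ℓ₀) * ∑ j ∈ Finset.range J, (n (e j) : ℝ)) * B :=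
        le_mul_of_one_le_right h3 hB1.le
      _ = _ := by ring
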